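/- Consider the following problem, Nested Norm $k$-Clustering with inner norm $\mathrm{top}_\ell$ and outer norm $\ell_1$. The input consists of a finite set $P$ of points, a finite set $F$ of facilities, a metric $\delta$ on $P\cup F$ with non-negative rational values, a number $k\in\mathbb{N}$ and a number $\ell\in\mathbb{N}$ with $1\le \ell\le |P|$. A solution $(X,\sigma)$ consists of a set $X\subseteq F$ with $|X|\le k$ and an assignment $\sigma\colon P\to X$. The cost of the cluster of $x\in X$ is $\mathrm{top}_\ell$, the sum of the $\ell$ largest entries, of the vector $\big(\delta(p,x)\cdot\mathbb{1}[x=\sigma(p)]\big)_{p\in P}$, and the cost of $(X,\sigma)$ is the sum of the costs of its clusters over all $x\in X$. The goal is to find a solution of minimum cost. **Theorem.** For every $\varepsilon>0$ there is a polynomial-time factor-$(13.5+\varepsilon)$ approximation algorithm for this problem. That is, there are an algorithm and a polynomial (both may depend on $\varepsilon$) such that on every input the algorithm halts within a number of steps bounded by the polynomial in the bit length of the input (all numbers being written in binary, and rationals as fractions), and, whenever a solution exists, it outputs a solution whose cost is at most $(13.5+\varepsilon)$ times the minimum cost of a solution. -/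

import Mathlib

/-! ### A random access machine with logarithmic cost

The memory consists of arrays of natural numbers, all but the input cells being `0` initially; a
program mentions only finitely many arrays. Programs are structured (`loop` is a while loop). Every
operation is charged the binary lengths of its operands and of its result, and every memory access
the binary lengths of the address and of the content. -/

namespace RAM

/-- `s a i` is the content of cell `i` of array `a`. -/
abbrev Mem : Type := ℕ → ℕ → ℕ

/-- Arithmetic operations. -/
inductive Op where
  | add
  | sub
  | mul
  | div

/-- Subtraction is truncated at `0`; division is rounded down, with `x / 0 = 0`. -/
def Op.eval : Op → ℕ → ℕ → ℕ
  | .add, x, y => x + y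
  | .sub, x, y => x - y
  | .mul, x, y => x * y
  | .div, x, y => x / y

/-- Expressions; `read a e` is the content of the cell of array `a` whose index is the value
of `e`. -/
inductive Exp where
  | const (n : ℕ)
  | read (a : ℕ) (e : Exp)
  | op (o : Op) (e₁ e₂ : Exp)

/-- The value of an expression. -/
def Exp.eval (s : Mem) : Exp → ℕ
  | .const n => n
  | .read a e => s a (e.eval s)
  | .op o e₁ e₂ => o.eval (e₁.eval s) (e₂.eval s)

/-- The time for evaluating an expression; `Nat.size` is the binary length. -/
def Exp.cost (s : Mem) : Exp → ℕ
  | .const n => 1 + n.size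
  | .read a e => e.cost s + 1 + (e.eval s).size + (s a (e.eval s)).size
  | .op o e₁ e₂ => e₁.cost s + e₂.cost s + 1 + (e₁.eval s).size + (e₂.eval s).size
      + (o.eval (e₁.eval s) (e₂.eval s)).size

/-- Programs. `write a i e` stores the value of `e` in cell `i` of array `a`; a test `e` counts as
true if its value is not `0`. -/
inductive Prog where
  | skip
  | write (a : ℕ) (i e : Exp)
  | seq (c d : Prog)
  | ite (e : Exp) (c d : Prog)
  | loop (e : Exp) (c : Prog)

/-- `Exec c s s' t`: the program `c`, started in memory `s`, halts in memory `s'` after time `t`. -/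
inductive Exec : Prog → Mem → Mem → ℕ → Prop
  | skip (s : Mem) : Exec .skip s s 1
  | write (s : Mem) (a : ℕ) (i e : Exp) :
      Exec (.write a i e) s
        (Function.update s a (Function.update (s a) (i.eval s) (e.eval s)))
        (1 + i.cost s + e.cost s)
  | seq {c d : Prog} {s s' s'' : Mem} {t t' : ℕ} (h : Exec c s s' t) (h' : Exec d s' s'' t') :
      Exec (.seq c d) s s'' (t + t')
  | ite_true {e : Exp} {c d : Prog} {s s' : Mem} {t : ℕ} (he : e.eval s ≠ 0)
      (h : Exec c s s' t) : Exec (.ite e c d) s s' (1 + e.cost s + t)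
  | ite_false {e : Exp} {c d : Prog} {s s' : Mem} {t : ℕ} (he : e.eval s = 0)
      (h : Exec d s s' t) : Exec (.ite e c d) s s' (1 + e.cost s + t)
  | loop_true {e : Exp} {c : Prog} {s s' s'' : Mem} {t t' : ℕ} (he : e.eval s ≠ 0)
      (h : Exec c s s' t) (h' : Exec (.loop e c) s' s'' t') :
      Exec (.loop e c) s s'' (1 + e.cost s + t + t')
  | loop_false {e : Exp} {c : Prog} {s : Mem} (he : e.eval s = 0) :
      Exec (.loop e c) s s (1 + e.cost s)

end RAM

/-! ### Nested norm `k`-clustering -/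

namespace NestedNorm

/-- The sum of the `ℓ` largest entries of `x`. -/
noncomputable def topNorm (ℓ : ℕ) {ι : Type*} [Fintype ι] (x : ι → ℝ) : ℝ :=
  (((Finset.univ.val.map x).sort (· ≥ ·)).take ℓ).sum

/-- The sum of the absolute values of the entries of `x`. -/
noncomputable def lOneNorm {ι : Type*} [Fintype ι] (x : ι → ℝ) : ℝ := ∑ i, |x i|

/-- The data of a clustering instance: a finite metric space `P ∪ F` (its elements numbered from
`0` to `N - 1`), made up of the points `P` and the facilities `F`, which may overlap, and the bound
`k` on the number of centers. Distances are rational, so that they can be written down. -/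
structure Space where
  N : ℕ
  P : Finset (Fin N)
  F : Finset (Fin N)
  union_eq : P ∪ F = Finset.univ
  δ : Fin N → Fin N → ℚ≥0
  eq_iff : ∀ u v, δ u v = 0 ↔ u = v
  symm : ∀ u v, δ u v = δ v u
  triangle : ∀ u v w, δ u w ≤ δ u v + δ v w
  k : ℕ

/-- At most `k` facilities, and an assignment of the points to them. -/
structure Solution (I : Space) where
  X : Finset (Fin I.N)
  subset : X ⊆ I.F
  card_le : X.card ≤ I.k
  σ : {p // p ∈ I.P} → {x // x ∈ X}

/-- The cluster cost vector of the center `x`. -/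
noncomputable def clusterVec {I : Space} (S : Solution I) (x : {x // x ∈ S.X}) :
    {p // p ∈ I.P} → ℝ :=
  fun p => if x = S.σ p then (I.δ p.1 x.1 : ℝ) else 0

/-- The cost of a solution for the inner norm `f` and the outer norm `g`. -/
noncomputable def cost {I : Space} (S : Solution I) (f : ({p // p ∈ I.P} → ℝ) → ℝ)
    (g : ({x // x ∈ S.X} → ℝ) → ℝ) : ℝ :=
  g fun x => f (clusterVec S x)

/-- An instance of nested norm `k`-clustering with inner norm `top_ℓ`, for some `1 ≤ ℓ ≤ |P|`, and
outer norm `ℓ₁`. -/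
structure TopInstance extends Space where
  ℓ : ℕ
  one_le : 1 ≤ ℓ
  le_card : ℓ ≤ P.card

/-- The objective with inner norm `top_ℓ` and outer norm `ℓ₁`. -/
noncomputable def TopInstance.objective (I : TopInstance) (S : Solution I.toSpace) : ℝ :=
  cost S (topNorm I.ℓ) lOneNorm

/-- The input memory: array 0 holds `N`, `k` and `ℓ`, arrays 1 and 2 the characteristic vectors of
`P` and `F`, and arrays 3 and 4 the numerators and denominators of the distances, the one from `u`
to `v` in cell `u * N + v`. All other cells are `0`. -/
def TopInstance.input (I : TopInstance) : RAM.Mem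
  | 0, 0 => I.N
  | 0, 1 => I.k
  | 0, 2 => I.ℓ
  | 1, i => if h : i < I.N then (if (⟨i, h⟩ : Fin I.N) ∈ I.P then 1 else 0) else 0
  | 2, i => if h : i < I.N then (if (⟨i, h⟩ : Fin I.N) ∈ I.F then 1 else 0) else 0
  | 3, i => if h : i < I.N * I.N then
      (I.δ (Fin.divNat ⟨i, h⟩) (Fin.modNat ⟨i, h⟩)).num else 0
  | 4, i => if h : i < I.N * I.N then
      (I.δ (Fin.divNat ⟨i, h⟩) (Fin.modNat ⟨i, h⟩)).den else 0
  | _, _ => 0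

/-- The length of the input in bits. -/
def TopInstance.bits (I : TopInstance) : ℕ :=
  I.N.size + I.k.size + I.ℓ.size + 2 * I.N
    + ∑ u, ∑ v, ((I.δ u v).num.size + (I.δ u v).den.size)

/-- The memory `s` holds the solution `S`: array 5 is the characteristic vector of `X`, and cell `p`
of array 6 is `σ p`, for each point `p`. -/
def Solution.StoredIn {I : Space} (S : Solution I) (s : RAM.Mem) : Prop :=
  (∀ v : Fin I.N, s 5 v = if v ∈ S.X then 1 else 0) ∧
    ∀ p : {p // p ∈ I.P}, s 6 p.1 = ((S.σ p).1 : ℕ)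

/-- The program `c` is a polynomial-time factor-`α` approximation algorithm: on every instance it
halts in time polynomial in the length of the input, and if the instance has a solution at all then
the output is a solution whose cost is at most `α` times the cost of every solution. -/
def IsPolyTimeApprox (c : RAM.Prog) (α : ℝ) : Prop :=
  ∃ q : Polynomial ℕ, ∀ I : TopInstance, ∃ (s : RAM.Mem) (t : ℕ),
    RAM.Exec c I.input s t ∧ t ≤ q.eval I.bits ∧
      (Nonempty (Solution I.toSpace) →
        ∃ S : Solution I.toSpace, S.StoredIn s ∧
          ∀ Y : Solution I.toSpace, I.objective S ≤ α * I.objective Y)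

end NestedNorm

/-! The `top_ℓ` norm of a nonnegative vector `x` is the minimum over `r ≥ 0` of `ℓ * r + ∑ max (x i
- r) 0`, attained at the `ℓ`-th largest entry (`topNorm_le`, `exists_topNorm_eq`). The task is
therefore to choose at most `k` balls, where a ball of radius `r` costs `ℓ * r` and every point pays
its distance to a ball. Radii may be restricted to distances from the center, which leaves `N * N`
candidate balls. The largest radius used by the optimum is guessed by trying all distances, and
larger balls are discarded.

Replace the bound `k` by a price `lam` per ball. As in the primal-dual method for facility location,
the dual variables of the points grow uniformly; a point pays for the balls it has reached and stops
once it reaches a ball that is fully paid. Among the paid balls a set without common contributors is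
selected greedily by decreasing radius, and the radii are tripled. A point without a contribution to
a selected ball is led to one through a conflicting ball of no larger radius, so with weak duality
(`sum_le_of_dual_feasible`) one gets, up to rounding, `C + 3 * lam * (number opened) ≤ 3 * (U + lam
* y)` for every solution of cost `U` with `y` centers (`PrimalDual.cost_le`).

Bisection over integral multipliers ends with two neighbouring values whose solutions have `k₁ ≤ k <
k₂` centers and costs `C₁`, `C₂`, or directly with a good feasible solution. Put `α = (k₂ - k) / (k₂
- k₁)`; then `α * C₁ + (1 - α) * C₂ ≤ 3 * U` up to rounding. If `α ≥ 1/4`, the first solution costs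
at most `12 * U`. Otherwise facilities of the second solution are grouped by their nearest facility
in the first, and groups are merged in the order of cost per saved facility until `k` centers remain
(`exists_threshold`, `exists_merge`). The result costs at most `2 * C₂ + 3 * L + 2 * α * (C₁ + C₂)`,
with `L ≤ U` being `ℓ` times the guessed radius, hence at most `13 * U` (`le_or_le_of_combination`).

Times and multipliers are integers, and the total rounding error is at most `24 * N ^ 3`. Distances
are scaled to integral multiples of `100 * N ^ 3`, so the error is absorbed by raising 13 to 13.5,
also if the optimum is 0 (`le_of_costBound`).

For the running time, the algorithm is written in a language whose loops are bounded by `N`, by `N *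
N` or by the bit length of a read-only number, and whose products have a read-only factor. A
statement then lengthens the cells by an amount polynomial in the read-only data alone, whatever
their present length; lengths add up over the rounds of a loop instead of multiplying, and
well-formedness implies polynomial time (`E.correct`, `S.correct`). -/

namespace ArrayLang

/-! ### A language of array programs and its compilation to the machine. -/

open RAM Polynomial

/-- `iter n f x` is `f (n - 1) (⋯ (f 0 x))`. -/
def iter {α : Type*} (n : ℕ) (f : ℕ → α → α) (x : α) : α :=
  Nat.rec x (fun i y => f i y) n

@[simp] theorem iter_zero {α : Type*} (f : ℕ → α → α) (x : α) : iter 0 f x = x := rfl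

@[simp] theorem iter_succ {α : Type*} (n : ℕ) (f : ℕ → α → α) (x : α) :
    iter (n + 1) f x = f n (iter n f x) := rfl

/-- The two bounds for bounded loops: the number in cell `0` of array `0`, and its square. -/
inductive Range where
  | n
  | nn

def Range.val (m : Mem) : Range → ℕ
  | .n => m 0 0
  | .nn => m 0 0 * m 0 0

def Range.exp : Range → RAM.Exp
  | .n => .read 0 (.const 0)
  | .nn => .op .mul (.read 0 (.const 0)) (.read 0 (.const 0))

inductive Fold where
  | sum
  | min
  | max

def Fold.eval : Fold → ℕ → ℕ → ℕ
  | .sum, x, y => x + y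
  | .min, x, y => x - (x - y)
  | .max, x, y => x + (y - x)

def Fold.exp : Fold → RAM.Exp → RAM.Exp → RAM.Exp
  | .sum, x, y => .op .add x y
  | .min, x, y => .op .sub x (.op .sub x y)
  | .max, x, y => .op .add x (.op .sub y x)

/-- Expressions with bounded folds. `mul x a i` is the product of `x` and of cell `i` of the
array `a`, which has to be read-only. -/
inductive E where
  | num (n : ℕ)
  | var (v : ℕ)
  | get (a : ℕ) (i : E)
  | add (x y : E)
  | sub (x y : E)
  | div (x y : E)
  | mul (x : E) (a : ℕ) (i : E)
  | ite (c x y : E)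
  | fold (k : Fold) (d : Range) (v : ℕ) (x e : E)

def E.eval : E → (ℕ → ℕ) → Mem → ℕ
  | .num n, _, _ => n
  | .var v, ρ, _ => ρ v
  | .get a i, ρ, m => m a (i.eval ρ m)
  | .add x y, ρ, m => x.eval ρ m + y.eval ρ m
  | .sub x y, ρ, m => x.eval ρ m - y.eval ρ m
  | .div x y, ρ, m => x.eval ρ m / y.eval ρ m
  | .mul x a i, ρ, m => x.eval ρ m * m a (i.eval ρ m)
  | .ite c x y, ρ, m => if c.eval ρ m ≠ 0 then x.eval ρ m else y.eval ρ m
  | .fold k d v x e, ρ, m =>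
      iter (d.val m) (fun i acc => k.eval acc (e.eval (Function.update ρ v i) m)) (x.eval ρ m)

/-- Well-formedness, with `ro` the set of read-only arrays and `sc` the list of the variables in
scope. -/
def E.wf (ro : ℕ → Bool) : List ℕ → E → Bool
  | _, .num _ => true
  | sc, .var v => sc.contains v
  | sc, .get a i => decide (a < 100) && i.wf ro sc
  | sc, .add x y => x.wf ro sc && y.wf ro sc
  | sc, .sub x y => x.wf ro sc && y.wf ro sc
  | sc, .div x y => x.wf ro sc && y.wf ro sc
  | sc, .mul x a i => decide (a < 100) && ro a && x.wf ro sc && i.wf ro sc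
  | sc, .ite c x y => c.wf ro sc && x.wf ro sc && y.wf ro sc
  | sc, .fold _ _ v x e => !sc.contains v && x.wf ro sc && e.wf ro (v :: sc)

/-- Cell `i` of the array of temporaries. -/
def tmp (i : ℕ) : RAM.Exp := .read 101 (.const i)

/-- The cell of the variable `v`. -/
def loc (v : ℕ) : RAM.Exp := .read 100 (.const v)

/-- A program that computes the value of the expression in temporary `i`. -/
def E.comp : E → ℕ → Prog
  | .num n, i => .write 101 (.const i) (.const n)
  | .var v, i => .write 101 (.const i) (loc v)
  | .get a x, i => .seq (x.comp i) (.write 101 (.const i) (.read a (tmp i)))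
  | .add x y, i => .seq (x.comp i) (.seq (y.comp (i + 1))
      (.write 101 (.const i) (.op .add (tmp i) (tmp (i + 1)))))
  | .sub x y, i => .seq (x.comp i) (.seq (y.comp (i + 1))
      (.write 101 (.const i) (.op .sub (tmp i) (tmp (i + 1)))))
  | .div x y, i => .seq (x.comp i) (.seq (y.comp (i + 1))
      (.write 101 (.const i) (.op .div (tmp i) (tmp (i + 1)))))
  | .mul x a y, i => .seq (x.comp i) (.seq (y.comp (i + 1))
      (.write 101 (.const i) (.op .mul (tmp i) (.read a (tmp (i + 1))))))
  | .ite c x y, i => .seq (c.comp i) (.ite (tmp i) (x.comp i) (y.comp i))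
  | .fold k d v x e, i => .seq (x.comp i) (.seq (.write 100 (.const v) (.const 0))
      (.loop (.op .sub d.exp (loc v)) (.seq (e.comp (i + 1))
        (.seq (.write 101 (.const i) (k.exp (tmp i) (tmp (i + 1))))
          (.write 100 (.const v) (.op .add (loc v) (.const 1)))))))

/-- Statements. `rep d v c` runs `c` with the variable `v` going through the numbers below `d`;
`bits a v c` runs `c` as often as the number in cell `0` of the read-only array `a` has bits. -/
inductive S where
  | skip
  | set (a : ℕ) (i e : E)
  | seq (c d : S)
  | ite (e : E) (c d : S)
  | rep (d : Range) (v : ℕ) (c : S)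
  | bits (a v : ℕ) (c : S)

/-- The memory after storing `x` in cell `i` of the array `a`. -/
def store (m : Mem) (a i x : ℕ) : Mem := Function.update m a (Function.update (m a) i x)

def S.run : S → (ℕ → ℕ) → Mem → Mem
  | .skip, _, m => m
  | .set a i e, ρ, m => store m a (i.eval ρ m) (e.eval ρ m)
  | .seq c d, ρ, m => d.run ρ (c.run ρ m)
  | .ite e c d, ρ, m => if e.eval ρ m ≠ 0 then c.run ρ m else d.run ρ m
  | .rep d v c, ρ, m => iter (d.val m) (fun i m => c.run (Function.update ρ v i) m) m
  | .bits a v c, ρ, m =>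
      iter (m a 0).size (fun i m' => c.run (Function.update ρ v (m a 0 / 2 ^ i)) m') m

def S.wf (ro : ℕ → Bool) : List ℕ → S → Bool
  | _, .skip => true
  | sc, .set a i e => decide (a < 100) && !ro a && i.wf ro sc && e.wf ro sc
  | sc, .seq c d => c.wf ro sc && d.wf ro sc
  | sc, .ite e c d => e.wf ro sc && c.wf ro sc && d.wf ro sc
  | sc, .rep _ v c => !sc.contains v && c.wf ro (v :: sc)
  | sc, .bits a v c => decide (a < 100) && ro a && !sc.contains v && c.wf ro (v :: sc)

def S.comp : S → Prog
  | .skip => .skip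
  | .set a i e => .seq (i.comp 0) (.seq (e.comp 1) (.write a (tmp 0) (tmp 1)))
  | .seq c d => .seq c.comp d.comp
  | .ite e c d => .seq (e.comp 0) (.ite (tmp 0) c.comp d.comp)
  | .rep d v c => .seq (.write 100 (.const v) (.const 0))
      (.loop (.op .sub d.exp (loc v)) (.seq c.comp
        (.write 100 (.const v) (.op .add (loc v) (.const 1)))))
  | .bits a v c => .seq (.write 100 (.const v) (.read a (.const 0)))
      (.loop (loc v) (.seq c.comp
        (.write 100 (.const v) (.op .div (loc v) (.const 2)))))

/-! #### Sizes -/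

theorem size_add_le (x y : ℕ) : (x + y).size ≤ max x.size y.size + 1 := by
  rw [Nat.size_le, pow_succ]
  have h1 : x < 2 ^ max x.size y.size := Nat.size_le.1 (le_max_left _ _)
  have h2 : y < 2 ^ max x.size y.size := Nat.size_le.1 (le_max_right _ _)
  omega

theorem size_mul_le (x y : ℕ) : (x * y).size ≤ x.size + y.size := by
  rw [Nat.size_le, pow_add]
  exact Nat.mul_lt_mul'' (Nat.lt_size_self x) (Nat.lt_size_self y)

theorem size_le_self (x : ℕ) : x.size ≤ x := by
  rw [Nat.size_le]; exact Nat.lt_two_pow_self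

theorem eval_mono (q : ℕ[X]) {x y : ℕ} (h : x ≤ y) : q.eval x ≤ q.eval y := by
  rw [eval_eq_sum, eval_eq_sum]
  exact Finset.sum_le_sum fun i _ => Nat.mul_le_mul_left _ (Nat.pow_le_pow_left h i)

/-- All cells have at most `M` bits. -/
def Bdd (c : Mem) (M : ℕ) : Prop := ∀ a i, (c a i).size ≤ M

theorem Bdd.mono {c : Mem} {M M' : ℕ} (h : Bdd c M) (hM : M ≤ M') : Bdd c M' :=
  fun a i => (h a i).trans hM

theorem Bdd.store {c : Mem} {M : ℕ} (h : Bdd c M) {x : ℕ} (a i : ℕ) (hx : x.size ≤ M) :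
    Bdd (store c a i x) M := by
  intro a' i'
  unfold ArrayLang.store
  by_cases ha : a' = a
  · subst ha
    by_cases hi : i' = i
    · subst hi; simpa using hx
    · simpa [hi] using h a' i'
  · simpa [ha] using h a' i'

/-- The expression is fixed, so its constants and its depth go into `C`; each operation at most adds
the lengths of its operands, plus one bit. -/
theorem exp_bound (x : RAM.Exp) : ∃ C : ℕ, ∀ s M, Bdd s M →
    x.cost s ≤ C * (M + 1) ∧ (x.eval s).size ≤ C * (M + 1) := by
  induction x with
  | const n =>
    refine ⟨1 + n.size, fun s M _ => ?_⟩
    simp only [RAM.Exp.cost, RAM.Exp.eval]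
    constructor <;> nlinarith
  | read a e ih =>
    obtain ⟨C, hC⟩ := ih
    refine ⟨2 * C + 2, fun s M h => ?_⟩
    obtain ⟨h1, h2⟩ := hC s M h
    have h3 := h a (e.eval s)
    simp only [RAM.Exp.cost, RAM.Exp.eval]
    constructor <;> nlinarith
  | op o e₁ e₂ ih₁ ih₂ =>
    obtain ⟨C, hC⟩ := ih₁
    obtain ⟨D, hD⟩ := ih₂
    refine ⟨3 * C + 3 * D + 2, fun s M h => ?_⟩
    obtain ⟨h1, h2⟩ := hC s M h
    obtain ⟨h3, h4⟩ := hD s M h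
    have h5 : (o.eval (e₁.eval s) (e₂.eval s)).size
        ≤ (e₁.eval s).size + (e₂.eval s).size + 1 := by
      cases o
      · exact (size_add_le _ _).trans (by omega)
      · exact (Nat.size_le_size (Nat.sub_le _ _)).trans (by omega)
      · exact (size_mul_le _ _).trans (by omega)
      · exact (Nat.size_le_size (Nat.div_le_self _ _)).trans (by omega)
    simp only [RAM.Exp.cost, RAM.Exp.eval]
    constructor <;> nlinarith

/-! ### Correctness and running time of compiled code. -/

theorem exec_write (a : ℕ) (i e : RAM.Exp) : ∃ C : ℕ, ∀ s M, Bdd s M →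
    ∃ t, Exec (.write a i e) s (store s a (i.eval s) (e.eval s)) t ∧ t ≤ C * (M + 1) := by
  obtain ⟨C, hC⟩ := exp_bound i
  obtain ⟨D, hD⟩ := exp_bound e
  refine ⟨C + D + 1, fun s M h => ⟨_, Exec.write s a i e, ?_⟩⟩
  have := (hC s M h).1
  have := (hD s M h).1
  nlinarith

theorem exec_loop {e : RAM.Exp} {c : Prog} {n T T' : ℕ} (I : ℕ → Mem → Prop)
    (htest : ∀ j ≤ n, ∀ s, I j s → (e.eval s = 0 ↔ j = n) ∧ e.cost s ≤ T)
    (hbody : ∀ j < n, ∀ s, I j s → ∃ s' t, Exec c s s' t ∧ I (j + 1) s' ∧ t ≤ T')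
    {s : Mem} (h0 : I 0 s) :
    ∃ s' t, Exec (.loop e c) s s' t ∧ I n s' ∧ t ≤ n * (1 + T + T') + (1 + T) := by
  suffices H : ∀ k j, j + k = n → ∀ s, I j s →
      ∃ s' t, Exec (.loop e c) s s' t ∧ I n s' ∧ t ≤ k * (1 + T + T') + (1 + T) from
    H n 0 (by omega) s h0
  intro k
  induction k with
  | zero =>
    intro j hj s hs
    obtain ⟨h1, h2⟩ := htest j (by omega) s hs
    have hjn : j = n := by omega
    exact ⟨s, _, Exec.loop_false (h1.2 hjn), hjn ▸ hs, by omega⟩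
  | succ k ih =>
    intro j hj s hs
    obtain ⟨h1, h2⟩ := htest j (by omega) s hs
    obtain ⟨s', t, h3, h4, h5⟩ := hbody j (by omega) s hs
    obtain ⟨s'', t', h6, h7, h8⟩ := ih (j + 1) (by omega) s' h4
    refine ⟨s'', _, Exec.loop_true (fun h => ?_) h3 h6, h7, ?_⟩
    · have := h1.1 h; omega
    · rw [Nat.add_mul, Nat.one_mul]; omega

/-- The machine memory `c` represents the memory `m` and the variables `ρ`. -/
structure Rel (c m : Mem) (ρ : ℕ → ℕ) (sc : List ℕ) : Prop where
  mem : ∀ a < 100, c a = m a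
  var : ∀ v ∈ sc, c 100 v = ρ v

/-- The read-only part of the memory has at most `b` bits per cell, and the loop bound is at
most `b`. -/
structure Ctx (ro : ℕ → Bool) (m : Mem) (b : ℕ) : Prop where
  ro : ∀ a, ro a → ∀ i, (m a i).size ≤ b
  n : m 0 0 ≤ b

theorem Range.val_le {ro : ℕ → Bool} {m : Mem} {b : ℕ} (h : Ctx ro m b) (d : Range) :
    d.val m ≤ b + b * b := by
  have := h.n
  cases d <;> simp only [Range.val]
  · nlinarith
  · nlinarith

theorem Range.exp_eval {c m : Mem} (h : c 0 = m 0) (d : Range) : d.exp.eval c = d.val m := by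
  cases d <;> simp [Range.exp, Range.val, RAM.Exp.eval, h, RAM.Op.eval]

theorem Fold.exp_eval (k : Fold) (x y : RAM.Exp) (c : Mem) :
    (k.exp x y).eval c = k.eval (x.eval c) (y.eval c) := by
  cases k <;> rfl

theorem Fold.size_eval_le (k : Fold) {x y M : ℕ} (hx : x.size ≤ M) (hy : y.size ≤ M) :
    (k.eval x y).size ≤ M + 1 := by
  have h1 : k.eval x y ≤ x + y := by cases k <;> simp only [Fold.eval] <;> omega
  exact (Nat.size_le_size h1).trans ((size_add_le _ _).trans (by omega))

theorem store_same (c : Mem) (a i x : ℕ) : store c a i x a i = x := by simp [store]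

theorem store_array (c : Mem) {a a' : ℕ} (i x : ℕ) (h : a' ≠ a) : store c a i x a' = c a' := by
  simp [store, h]

theorem store_cell (c : Mem) (a : ℕ) {i i' : ℕ} (x : ℕ) (h : i' ≠ i) :
    store c a i x a i' = c a i' := by
  simp [store, h]

theorem Rel.store_tmp {c m : Mem} {ρ : ℕ → ℕ} {sc : List ℕ} (h : Rel c m ρ sc) (i x : ℕ) :
    Rel (store c 101 i x) m ρ sc :=
  ⟨fun a ha => by rw [store_array _ _ _ (by omega), h.mem a ha],
   fun v hv => by rw [store_array _ _ _ (by omega), h.var v hv]⟩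

theorem Rel.store_loc {c m : Mem} {ρ : ℕ → ℕ} {sc : List ℕ} (h : Rel c m ρ sc) (v x : ℕ) :
    Rel (store c 100 v x) m (Function.update ρ v x) (v :: sc) :=
  ⟨fun a ha => by rw [store_array _ _ _ (by omega), h.mem a ha],
   fun w hw => by
    by_cases hwv : w = v
    · subst hwv; simp [store_same]
    · rw [store_cell _ _ _ hwv, Function.update_of_ne hwv, h.var w (by simpa [hwv] using hw)]⟩

theorem Rel.drop {c m : Mem} {ρ : ℕ → ℕ} {sc : List ℕ} {v x : ℕ}
    (h : Rel c m (Function.update ρ v x) (v :: sc)) (hv : v ∉ sc) : Rel c m ρ sc :=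
  ⟨h.mem, fun w hw => by
    rw [h.var w (List.mem_cons_of_mem _ hw), Function.update_of_ne (by rintro rfl; exact hv hw)]⟩

/-- The specification of the compilation of an expression. -/
def E.Correct (ro : ℕ → Bool) (e : E) (i : ℕ) (sc : List ℕ) : Prop :=
  ∃ g q : ℕ[X], ∀ b M c m ρ, Ctx ro m b → b ≤ M → Bdd c M → Rel c m ρ sc →
    ∃ c' t, Exec (e.comp i) c c' t ∧ t ≤ q.eval M ∧ Bdd c' (M + g.eval b) ∧ Rel c' m ρ sc ∧
      c' 101 i = e.eval ρ m ∧ ∀ j < i, c' 101 j = c 101 j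

theorem E.correct_leaf {ro : ℕ → Bool} {e : E} {i : ℕ} {sc : List ℕ} {x : RAM.Exp}
    (hcomp : e.comp i = .write 101 (.const i) x) (G : ℕ)
    (hx : ∀ c m ρ, Rel c m ρ sc → x.eval c = e.eval ρ m)
    (hsize : ∀ c M, Bdd c M → (x.eval c).size ≤ M + G) : e.Correct ro i sc := by
  obtain ⟨C, hC⟩ := exec_write 101 (.const i) x
  refine ⟨Polynomial.C G, Polynomial.C C * (X + 1), fun b M c m ρ hctx hb hc hr => ?_⟩
  obtain ⟨t, h1, h2⟩ := hC c M hc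
  refine ⟨_, t, hcomp ▸ h1, by simpa using h2, ?_, hr.store_tmp _ _, ?_, ?_⟩
  · exact (hc.mono (by simp)).store _ _ (by simpa using hsize c M hc)
  · rw [RAM.Exp.eval, store_same, hx c m ρ hr]
  · intro j hj
    rw [RAM.Exp.eval, store_cell _ _ _ (by omega)]

theorem E.correct_binary {ro : ℕ → Bool} {e x y : E} {i : ℕ} {sc : List ℕ} {z : RAM.Exp}
    (hcomp : e.comp i = .seq (x.comp i) (.seq (y.comp (i + 1)) (.write 101 (.const i) z)))
    (hx : x.Correct ro i sc) (hy : y.Correct ro (i + 1) sc)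
    (hz : ∀ c m ρ, Rel c m ρ sc → c 101 i = x.eval ρ m → c 101 (i + 1) = y.eval ρ m →
      z.eval c = e.eval ρ m)
    (hsize : ∀ c m ρ b M, Rel c m ρ sc → Ctx ro m b → Bdd c M → (z.eval c).size ≤ M + b + 1) :
    e.Correct ro i sc := by
  obtain ⟨g₁, q₁, h₁⟩ := hx
  obtain ⟨g₂, q₂, h₂⟩ := hy
  obtain ⟨C, hC⟩ := exec_write 101 (.const i) z
  refine ⟨g₁ + g₂ + X + 1, q₁ + q₂.comp (X + g₁) + Polynomial.C C * (X + g₁ + g₂ + 1),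
    fun b M c m ρ hctx hb hc hr => ?_⟩
  obtain ⟨c1, t1, e1, ht1, hb1, hr1, hv1, hf1⟩ := h₁ b M c m ρ hctx hb hc hr
  obtain ⟨c2, t2, e2, ht2, hb2, hr2, hv2, hf2⟩ :=
    h₂ b _ c1 m ρ hctx (by omega) hb1 hr1
  obtain ⟨t3, e3, ht3⟩ := hC c2 _ hb2
  have hz' : z.eval c2 = e.eval ρ m := hz c2 m ρ hr2 (by rw [hf2 i (by omega), hv1]) hv2
  refine ⟨_, _, hcomp ▸ Exec.seq e1 (Exec.seq e2 e3), ?_, ?_, hr2.store_tmp _ _, ?_, ?_⟩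
  · have m1 := eval_mono g₁ hb
    have m2 := eval_mono g₂ hb
    have m3 := eval_mono q₂ (Nat.add_le_add_left m1 M)
    simp only [eval_add, eval_comp, eval_mul, eval_X, eval_one, eval_C]
    have : C * (M + Polynomial.eval b g₁ + Polynomial.eval b g₂ + 1)
        ≤ C * (M + Polynomial.eval M g₁ + Polynomial.eval M g₂ + 1) :=
      Nat.mul_le_mul_left _ (by omega)
    omega
  · have := hsize c2 m ρ b _ hr2 hctx hb2
    simp only [eval_add, eval_X, eval_one]
    exact (hb2.mono (by omega)).store _ _ (by omega)
  · rw [RAM.Exp.eval, store_same, hz']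
  · intro j hj
    rw [RAM.Exp.eval, store_cell _ _ _ (by omega), hf2 j (by omega), hf1 j hj]

theorem E.correct_get {ro : ℕ → Bool} {x : E} {a i : ℕ} {sc : List ℕ} (ha : a < 100)
    (hx : x.Correct ro i sc) : (E.get a x).Correct ro i sc := by
  obtain ⟨g₁, q₁, h₁⟩ := hx
  obtain ⟨C, hC⟩ := exec_write 101 (.const i) (.read a (tmp i))
  refine ⟨g₁, q₁ + Polynomial.C C * (X + g₁ + 1), fun b M c m ρ hctx hb hc hr => ?_⟩
  obtain ⟨c1, t1, e1, ht1, hb1, hr1, hv1, hf1⟩ := h₁ b M c m ρ hctx hb hc hr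
  obtain ⟨t3, e3, ht3⟩ := hC c1 _ hb1
  refine ⟨_, _, Exec.seq e1 e3, ?_, hb1.store _ _ (hb1 _ _), hr1.store_tmp _ _, ?_, ?_⟩
  · have m1 := eval_mono g₁ hb
    simp only [eval_add, eval_mul, eval_X, eval_one, eval_C]
    have : C * (M + Polynomial.eval b g₁ + 1) ≤ C * (M + Polynomial.eval M g₁ + 1) :=
      Nat.mul_le_mul_left _ (by omega)
    omega
  · simp only [RAM.Exp.eval, store_same, E.eval, tmp, hv1, hr1.mem a ha]
  · intro j hj
    rw [RAM.Exp.eval, store_cell _ _ _ (by omega), hf1 j hj]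

theorem E.correct_ite {ro : ℕ → Bool} {x y z : E} {i : ℕ} {sc : List ℕ}
    (hx : x.Correct ro i sc) (hy : y.Correct ro i sc) (hz : z.Correct ro i sc) :
    (E.ite x y z).Correct ro i sc := by
  obtain ⟨g₁, q₁, h₁⟩ := hx
  obtain ⟨g₂, q₂, h₂⟩ := hy
  obtain ⟨g₃, q₃, h₃⟩ := hz
  obtain ⟨C, hC⟩ := exp_bound (tmp i)
  refine ⟨g₁ + g₂ + g₃, q₁ + q₂.comp (X + g₁) + q₃.comp (X + g₁)
    + (Polynomial.C C * (X + g₁ + 1) + 1), fun b M c m ρ hctx hb hc hr => ?_⟩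
  obtain ⟨c1, t1, e1, ht1, hb1, hr1, hv1, hf1⟩ := h₁ b M c m ρ hctx hb hc hr
  have m1 := eval_mono g₁ hb
  have m2 := eval_mono q₂ (Nat.add_le_add_left m1 M)
  have m3 := eval_mono q₃ (Nat.add_le_add_left m1 M)
  have hcost := (hC c1 _ hb1).1
  have : C * (M + Polynomial.eval b g₁ + 1) ≤ C * (M + Polynomial.eval M g₁ + 1) :=
      Nat.mul_le_mul_left _ (by omega)
  have hv1' : (tmp i).eval c1 = x.eval ρ m := by simpa [tmp, RAM.Exp.eval] using hv1
  simp only [eval_add, eval_comp, eval_mul, eval_X, eval_one, eval_C, E.eval]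
  by_cases h : x.eval ρ m ≠ 0
  · obtain ⟨c2, t2, e2, ht2, hb2, hr2, hv2, hf2⟩ := h₂ b _ c1 m ρ hctx (by omega) hb1 hr1
    refine ⟨c2, _, Exec.seq e1 (Exec.ite_true (hv1' ▸ h) e2), ?_, hb2.mono (by omega), hr2, ?_, ?_⟩
    · omega
    · rw [if_pos h, hv2]
    · intro j hj; rw [hf2 j hj, hf1 j hj]
  · obtain ⟨c2, t2, e2, ht2, hb2, hr2, hv2, hf2⟩ := h₃ b _ c1 m ρ hctx (by omega) hb1 hr1
    refine ⟨c2, _, Exec.seq e1 (Exec.ite_false (by rw [hv1']; exact not_not.1 h) e2), ?_,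
      hb2.mono (by omega), hr2, ?_, ?_⟩
    · omega
    · rw [if_neg h, hv2]
    · intro j hj; rw [hf2 j hj, hf1 j hj]

/-- The growth `g₂` of the body depends on `b` only, not on the current bound `M`. Thus `j` rounds
add `j * (g₂ + 1)` bits, and a polynomial number of rounds keeps the memory polynomial. -/
theorem E.correct_fold {ro : ℕ → Bool} {k : Fold} {d : Range} {v : ℕ} {x e : E} {i : ℕ}
    {sc : List ℕ} (hv : v ∉ sc) (hx : x.Correct ro i sc) (he : e.Correct ro (i + 1) (v :: sc)) :
    (E.fold k d v x e).Correct ro i sc := by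
  obtain ⟨g₁, q₁, h₁⟩ := hx
  obtain ⟨g₂, q₂, h₂⟩ := he
  obtain ⟨C₁, hC₁⟩ := exec_write 100 (.const v) (.const 0)
  obtain ⟨C₂, hC₂⟩ := exec_write 101 (.const i) (k.exp (tmp i) (tmp (i + 1)))
  obtain ⟨C₃, hC₃⟩ := exec_write 100 (.const v) (.op .add (loc v) (.const 1))
  obtain ⟨C₄, hC₄⟩ := exp_bound (.op .sub d.exp (loc v))
  -- `r` bounds the number of rounds for both kinds of ranges. In `G` it also pays for the loop
  -- counter, and the `+ 1` is the extra bit produced by one fold operation.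
  set r : ℕ[X] := X + X * X with hr_def
  set G : ℕ[X] := g₁ + r + r * (g₂ + 1) with hG
  refine ⟨G, q₁ + Polynomial.C C₁ * (X + G + 1)
      + (r * (1 + Polynomial.C C₄ * (X + G + 1) + (q₂.comp (X + G)
          + Polynomial.C (C₂ + C₃) * (X + G + 1))) + (1 + Polynomial.C C₄ * (X + G + 1))),
    fun b M c m ρ hctx hb hc hr => ?_⟩
  obtain ⟨c1, t1, e1, ht1, hb1, hr1, hv1, hf1⟩ := h₁ b M c m ρ hctx hb hc hr
  set n := d.val m with hn
  have hnr : n ≤ r.eval b := by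
    have := Range.val_le hctx d; simpa [hr_def] using this
  have hGb : G.eval b = g₁.eval b + r.eval b + r.eval b * (g₂.eval b + 1) := by
    simp [hG]
  have hGM := eval_mono G hb
  have hrM := eval_mono r hb
  set L := M + G.eval M with hL
  obtain ⟨t2, e2, ht2⟩ := hC₁ c1 _ hb1
  let I : ℕ → Mem → Prop := fun j s =>
    Bdd s (M + g₁.eval b + r.eval b + j * (g₂.eval b + 1)) ∧
      Rel s m (Function.update ρ v j) (v :: sc) ∧
      s 101 i = iter j (fun i acc => k.eval acc (e.eval (Function.update ρ v i) m)) (x.eval ρ m) ∧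
      ∀ j' < i, s 101 j' = c 101 j'
  have hI : ∀ j ≤ n, ∀ s, I j s → Bdd s L := by
    intro j hj s hs
    refine hs.1.mono ?_
    have : j * (g₂.eval b + 1) ≤ r.eval b * (g₂.eval b + 1) :=
      Nat.mul_le_mul_right _ (hj.trans hnr)
    omega
  have hloop := exec_loop (e := .op .sub d.exp (loc v))
    (c := .seq (e.comp (i + 1)) (.seq (.write 101 (.const i) (k.exp (tmp i) (tmp (i + 1))))
          (.write 100 (.const v) (.op .add (loc v) (.const 1)))))
    (n := n) (T := C₄ * (L + 1)) (T' := q₂.eval L + (C₂ + C₃) * (L + 1)) I ?_ ?_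
    (s := store c1 100 v 0) ?_
  · obtain ⟨s', t, h1, h2, h3⟩ := hloop
    refine ⟨s', _, Exec.seq e1 (Exec.seq e2 h1), ?_, ?_, h2.2.1.drop hv, ?_, h2.2.2.2⟩
    · simp only [eval_add, eval_comp, eval_mul, eval_X, eval_one, eval_C]
      rw [← hL]
      have a1 : C₁ * (M + Polynomial.eval b g₁ + 1) ≤ C₁ * (L + 1) :=
        Nat.mul_le_mul_left _ (by omega)
      have a2 : n * (1 + C₄ * (L + 1) + (q₂.eval L + (C₂ + C₃) * (L + 1)))
          ≤ r.eval M * (1 + C₄ * (L + 1) + (q₂.eval L + (C₂ + C₃) * (L + 1))) :=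
        Nat.mul_le_mul_right _ (hnr.trans hrM)
      omega
    · refine h2.1.mono ?_
      have : n * (g₂.eval b + 1) ≤ r.eval b * (g₂.eval b + 1) := Nat.mul_le_mul_right _ hnr
      omega
    · rw [h2.2.2.1]; rfl
  · intro j hj s hs
    have hb' := hI j hj s hs
    refine ⟨?_, (hC₄ s L hb').1⟩
    have h1 : d.exp.eval s = n := Range.exp_eval (hs.2.1.mem 0 (by omega)) d
    have h2 : (loc v).eval s = j := by
      simpa [loc, RAM.Exp.eval] using hs.2.1.var v (by simp)
    simp only [RAM.Exp.eval, RAM.Op.eval, h1, h2]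
    omega
  · intro j hj s hs
    obtain ⟨c3, t3, e3, ht3, hb3, hr3, hv3, hf3⟩ :=
      h₂ b _ s m _ hctx (by omega) hs.1 hs.2.1
    have hmul : (j + 1) * (g₂.eval b + 1) = j * (g₂.eval b + 1) + (g₂.eval b + 1) := by ring
    have hmul' : (j + 1) * (g₂.eval b + 1) ≤ r.eval b * (g₂.eval b + 1) :=
      Nat.mul_le_mul_right _ (by omega)
    obtain ⟨t4, e4, ht4⟩ := hC₂ c3 _ hb3
    have hb4 : Bdd (store c3 101 i ((k.exp (tmp i) (tmp (i + 1))).eval c3))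
        (M + g₁.eval b + r.eval b + (j + 1) * (g₂.eval b + 1)) := by
      refine (hb3.mono (by omega)).store _ _ ?_
      rw [Fold.exp_eval]
      refine (Fold.size_eval_le k (hb3 _ _) (hb3 _ _)).trans (by omega)
    obtain ⟨t5, e5, ht5⟩ := hC₃ _ _ hb4
    have hvar : (RAM.Exp.op .add (loc v) (.const 1)).eval
        (store c3 101 i ((k.exp (tmp i) (tmp (i + 1))).eval c3)) = j + 1 := by
      have : store c3 101 i ((k.exp (tmp i) (tmp (i + 1))).eval c3) 100 v = j := by
        rw [store_array _ _ _ (by omega), hr3.var v (by simp), Function.update_self]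
      simp [RAM.Exp.eval, RAM.Op.eval, loc, this]
    refine ⟨_, _, Exec.seq e3 (Exec.seq e4 e5), ⟨?_, ?_, ?_, ?_⟩, ?_⟩
    · refine hb4.store _ _ ?_
      rw [hvar]
      refine (size_le_self _).trans ?_
      omega
    · rw [hvar]
      have := (((hr3.drop hv).store_tmp i ((k.exp (tmp i) (tmp (i + 1))).eval c3)).store_loc v (j + 1))
      simpa [RAM.Exp.eval] using this
    · rw [store_array _ _ _ (by omega), Fold.exp_eval, iter_succ, ← hs.2.2.1, ← hv3,
        ← hf3 i (by omega)]
      exact store_same _ _ _ _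
    · intro j' hj'
      rw [store_array _ _ _ (by omega), ← hs.2.2.2 j' hj', ← hf3 j' (by omega)]
      exact store_cell _ _ _ (by omega)
    · have hle : M + Polynomial.eval b g₁ + Polynomial.eval b r + j * (Polynomial.eval b g₂ + 1) ≤ L := by omega
      have a0 := eval_mono q₂ hle
      have a1 : C₂ * (M + Polynomial.eval b g₁ + Polynomial.eval b r + j * (Polynomial.eval b g₂ + 1) + Polynomial.eval b g₂ + 1)
          ≤ C₂ * (L + 1) :=
      Nat.mul_le_mul_left _ (by omega)
      have a2 : C₃ * (M + g₁.eval b + r.eval b + (j + 1) * (g₂.eval b + 1) + 1)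
          ≤ C₃ * (L + 1) :=
      Nat.mul_le_mul_left _ (by omega)
      rw [Nat.add_mul]
      omega
  · refine ⟨?_, hr1.store_loc v 0, ?_, ?_⟩
    · exact (hb1.mono (by omega)).store _ _ (by simp)
    · rw [store_array _ _ _ (by omega), hv1]; rfl
    · intro j' hj'
      rw [store_array _ _ _ (by omega), hf1 j' hj']

theorem E.correct (ro : ℕ → Bool) (e : E) (i : ℕ) (sc : List ℕ) (h : e.wf ro sc) :
    e.Correct ro i sc := by
  induction e generalizing i sc with
  | num n =>
    exact correct_leaf rfl n.size (fun _ _ _ _ => rfl)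
      (fun _ _ _ => by simp [RAM.Exp.eval])
  | var v =>
    refine correct_leaf rfl 0 (fun c m ρ hr => ?_) (fun c M hc => hc _ _)
    exact hr.var v (by simpa [E.wf] using h)
  | get a x ih =>
    simp only [E.wf, Bool.and_eq_true, decide_eq_true_eq] at h
    exact correct_get h.1 (ih _ _ h.2)
  | add x y ihx ihy =>
    simp only [E.wf, Bool.and_eq_true] at h
    refine correct_binary rfl (ihx _ _ h.1) (ihy _ _ h.2) (fun c m ρ hr h1 h2 => ?_)
      (fun c m ρ b M hr hctx hc => ?_)
    · simp only [tmp, RAM.Exp.eval, h1, h2]; rfl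
    · have h1 := hc 101 i
      have h2 := hc 101 (i + 1)
      exact (size_add_le (c 101 i) (c 101 (i + 1))).trans (by omega)
  | sub x y ihx ihy =>
    simp only [E.wf, Bool.and_eq_true] at h
    refine correct_binary rfl (ihx _ _ h.1) (ihy _ _ h.2) (fun c m ρ hr h1 h2 => ?_)
      (fun c m ρ b M hr hctx hc => ?_)
    · simp only [tmp, RAM.Exp.eval, h1, h2]; rfl
    · exact (Nat.size_le_size (Nat.sub_le (c 101 i) (c 101 (i + 1)))).trans
        ((hc 101 i).trans (by omega))
  | div x y ihx ihy =>
    simp only [E.wf, Bool.and_eq_true] at h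
    refine correct_binary rfl (ihx _ _ h.1) (ihy _ _ h.2) (fun c m ρ hr h1 h2 => ?_)
      (fun c m ρ b M hr hctx hc => ?_)
    · simp only [tmp, RAM.Exp.eval, h1, h2]; rfl
    · exact (Nat.size_le_size (Nat.div_le_self (c 101 i) (c 101 (i + 1)))).trans
        ((hc 101 i).trans (by omega))
  | mul x a y ihx ihy =>
    simp only [E.wf, Bool.and_eq_true, decide_eq_true_eq] at h
    refine correct_binary rfl (ihx _ _ h.1.2) (ihy _ _ h.2) (fun c m ρ hr h1 h2 => ?_)
      (fun c m ρ b M hr hctx hc => ?_)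
    · simp only [tmp, RAM.Exp.eval, h1, h2, hr.mem a h.1.1.1]; rfl
    · have h1 := hc 101 i
      -- The factor taken from a read-only array has at most `b` bits, so the product is longer by
      -- at most `b` bits.
      have h2 : (c a (c 101 (i + 1))).size ≤ b := by
        rw [hr.mem a h.1.1.1]; exact hctx.ro a h.1.1.2 _
      exact (size_mul_le (c 101 i) (c a (c 101 (i + 1)))).trans (by omega)
  | ite x y z ihx ihy ihz =>
    simp only [E.wf, Bool.and_eq_true] at h
    exact correct_ite (ihx _ _ h.1.1) (ihy _ _ h.1.2) (ihz _ _ h.2)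
  | fold k d v x e ihx ihe =>
    simp only [E.wf, Bool.and_eq_true] at h
    exact correct_fold (by simpa using h.1.1) (ihx _ _ h.1.2) (ihe _ _ h.2)

/-- The specification of the compilation of a statement. -/
def S.Correct (ro : ℕ → Bool) (p : S) (sc : List ℕ) : Prop :=
  ∃ g q : ℕ[X], ∀ b M c m ρ, Ctx ro m b → b ≤ M → Bdd c M → Rel c m ρ sc →
    ∃ c' t, Exec p.comp c c' t ∧ t ≤ q.eval M ∧ Bdd c' (M + g.eval b) ∧
      Rel c' (p.run ρ m) ρ sc ∧ ∀ a, ro a → p.run ρ m a = m a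

theorem Ctx.congr {ro : ℕ → Bool} {m m' : Mem} {b : ℕ} (h : Ctx ro m b) (h0 : ro 0)
    (hm : ∀ a, ro a → m' a = m a) : Ctx ro m' b :=
  ⟨fun a ha i => by rw [hm a ha]; exact h.ro a ha i, by rw [hm 0 h0]; exact h.n⟩

theorem Rel.store_mem {c m : Mem} {ρ : ℕ → ℕ} {sc : List ℕ} (h : Rel c m ρ sc) {a : ℕ}
    (ha : a < 100) (i x : ℕ) : Rel (store c a i x) (store m a i x) ρ sc :=
  ⟨fun a' ha' => by
    by_cases haa : a' = a
    · subst haa; simp [store, h.mem a' ha]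
    · rw [store_array _ _ _ haa, store_array _ _ _ haa, h.mem a' ha'],
   fun v hv => by rw [store_array _ _ _ (by omega), h.var v hv]⟩

theorem S.correct_set {ro : ℕ → Bool} {a : ℕ} {i e : E} {sc : List ℕ} (ha : a < 100)
    (hro : ro a = false) (hi : i.wf ro sc) (he : e.wf ro sc) : (S.set a i e).Correct ro sc := by
  obtain ⟨g₁, q₁, h₁⟩ := E.correct ro i 0 sc hi
  obtain ⟨g₂, q₂, h₂⟩ := E.correct ro e 1 sc he
  obtain ⟨C, hC⟩ := exec_write a (tmp 0) (tmp 1)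
  refine ⟨g₁ + g₂, q₁ + q₂.comp (X + g₁) + Polynomial.C C * (X + g₁ + g₂ + 1),
    fun b M c m ρ hctx hb hc hr => ?_⟩
  obtain ⟨c1, t1, e1, ht1, hb1, hr1, hv1, hf1⟩ := h₁ b M c m ρ hctx hb hc hr
  obtain ⟨c2, t2, e2, ht2, hb2, hr2, hv2, hf2⟩ :=
    h₂ b _ c1 m ρ hctx (by omega) hb1 hr1
  obtain ⟨t3, e3, ht3⟩ := hC c2 _ hb2
  have hv1' : (tmp 0).eval c2 = i.eval ρ m := by
    simp only [tmp, RAM.Exp.eval, hf2 0 (by omega), hv1]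
  have hv2' : (tmp 1).eval c2 = e.eval ρ m := by simp only [tmp, RAM.Exp.eval, hv2]
  refine ⟨_, _, Exec.seq e1 (Exec.seq e2 e3), ?_, ?_, ?_, ?_⟩
  · have m1 := eval_mono g₁ hb
    have m2 := eval_mono g₂ hb
    have m3 := eval_mono q₂ (Nat.add_le_add_left m1 M)
    simp only [eval_add, eval_comp, eval_mul, eval_X, eval_one, eval_C]
    have : C * (M + Polynomial.eval b g₁ + Polynomial.eval b g₂ + 1)
        ≤ C * (M + Polynomial.eval M g₁ + Polynomial.eval M g₂ + 1) :=
      Nat.mul_le_mul_left _ (by omega)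
    omega
  · simp only [eval_add]
    exact (hb2.mono (by omega)).store _ _ ((hb2 _ _).trans (by omega))
  · rw [hv1', hv2']; exact hr2.store_mem ha _ _
  · intro a' ha'
    exact store_array _ _ _ (by rintro rfl; simp [hro] at ha')

theorem S.correct_seq {ro : ℕ → Bool} {p p' : S} {sc : List ℕ} (h0 : ro 0)
    (hp : p.Correct ro sc) (hp' : p'.Correct ro sc) : (S.seq p p').Correct ro sc := by
  obtain ⟨g₁, q₁, h₁⟩ := hp
  obtain ⟨g₂, q₂, h₂⟩ := hp'
  refine ⟨g₁ + g₂, q₁ + q₂.comp (X + g₁), fun b M c m ρ hctx hb hc hr => ?_⟩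
  obtain ⟨c1, t1, e1, ht1, hb1, hr1, hf1⟩ := h₁ b M c m ρ hctx hb hc hr
  obtain ⟨c2, t2, e2, ht2, hb2, hr2, hf2⟩ :=
    h₂ b _ c1 _ ρ (hctx.congr h0 hf1) (by omega) hb1 hr1
  refine ⟨c2, _, Exec.seq e1 e2, ?_, ?_, hr2, fun a ha => (hf2 a ha).trans (hf1 a ha)⟩
  · have m3 := eval_mono q₂ (Nat.add_le_add_left (eval_mono g₁ hb) M)
    simp only [eval_add, eval_comp, eval_X]
    omega
  · simpa [add_assoc] using hb2

theorem S.correct_ite {ro : ℕ → Bool} {x : E} {p p' : S} {sc : List ℕ} (hx : x.wf ro sc)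
    (hp : p.Correct ro sc) (hp' : p'.Correct ro sc) : (S.ite x p p').Correct ro sc := by
  obtain ⟨g₁, q₁, h₁⟩ := E.correct ro x 0 sc hx
  obtain ⟨g₂, q₂, h₂⟩ := hp
  obtain ⟨g₃, q₃, h₃⟩ := hp'
  obtain ⟨C, hC⟩ := exp_bound (tmp 0)
  refine ⟨g₁ + g₂ + g₃, q₁ + q₂.comp (X + g₁) + q₃.comp (X + g₁)
    + (Polynomial.C C * (X + g₁ + 1) + 1), fun b M c m ρ hctx hb hc hr => ?_⟩
  obtain ⟨c1, t1, e1, ht1, hb1, hr1, hv1, hf1⟩ := h₁ b M c m ρ hctx hb hc hr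
  have m1 := eval_mono g₁ hb
  have m2 := eval_mono q₂ (Nat.add_le_add_left m1 M)
  have m3 := eval_mono q₃ (Nat.add_le_add_left m1 M)
  have hcost := (hC c1 _ hb1).1
  have : C * (M + Polynomial.eval b g₁ + 1) ≤ C * (M + Polynomial.eval M g₁ + 1) :=
    Nat.mul_le_mul_left _ (by omega)
  have hv1' : (tmp 0).eval c1 = x.eval ρ m := by simpa [tmp, RAM.Exp.eval] using hv1
  simp only [eval_add, eval_comp, eval_mul, eval_X, eval_one, eval_C, S.run]
  by_cases h : x.eval ρ m ≠ 0
  · obtain ⟨c2, t2, e2, ht2, hb2, hr2, hf2⟩ := h₂ b _ c1 m ρ hctx (by omega) hb1 hr1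
    rw [if_pos h]
    exact ⟨c2, _, Exec.seq e1 (Exec.ite_true (hv1' ▸ h) e2), by omega, hb2.mono (by omega),
      hr2, hf2⟩
  · obtain ⟨c2, t2, e2, ht2, hb2, hr2, hf2⟩ := h₃ b _ c1 m ρ hctx (by omega) hb1 hr1
    rw [if_neg h]
    exact ⟨c2, _, Exec.seq e1 (Exec.ite_false (by rw [hv1']; exact not_not.1 h) e2), by omega,
      hb2.mono (by omega), hr2, hf2⟩

/-- The common part of the two kinds of loops; `val j` is the content of the cell of the loop
variable before round `j`. -/
theorem S.correct_loop {ro : ℕ → Bool} (h0 : ro 0) {p : S} {v : ℕ} {sc : List ℕ} (hv : v ∉ sc)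
    (hp : p.Correct ro (v :: sc)) (test first next : RAM.Exp) (N : ℕ[X]) :
    ∃ g q : ℕ[X], ∀ b M c m ρ, Ctx ro m b → b ≤ M → Bdd c M → Rel c m ρ sc →
      ∀ (n : ℕ) (val : ℕ → ℕ), n ≤ N.eval b → (∀ j ≤ n, (val j).size ≤ M + N.eval b) →
      first.eval c = val 0 →
      (∀ j < n, ∀ s m', Rel s m' (Function.update ρ v (val j)) (v :: sc) →
        (∀ a, ro a → m' a = m a) →
        next.eval s = val (j + 1)) →
      (∀ j ≤ n, ∀ s m', Rel s m' (Function.update ρ v (val j)) (v :: sc) →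
        (∀ a, ro a → m' a = m a) → (test.eval s = 0 ↔ j = n)) →
      ∃ c' t, Exec (.seq (.write 100 (.const v) first)
          (.loop test (.seq p.comp (.write 100 (.const v) next)))) c c' t ∧
        t ≤ q.eval M ∧ Bdd c' (M + g.eval b) ∧
        Rel c' (iter n (fun i m => p.run (Function.update ρ v (val i)) m) m) ρ sc ∧
        ∀ a, ro a → iter n (fun i m => p.run (Function.update ρ v (val i)) m) m a = m a := by
  obtain ⟨g₂, q₂, h₂⟩ := hp
  obtain ⟨C₁, hC₁⟩ := exec_write 100 (.const v) first
  obtain ⟨C₃, hC₃⟩ := exec_write 100 (.const v) next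
  obtain ⟨C₄, hC₄⟩ := exp_bound test
  set G : ℕ[X] := N + N * g₂ with hG
  refine ⟨G, Polynomial.C C₁ * (X + G + 1)
      + (N * (1 + Polynomial.C C₄ * (X + G + 1) + (q₂.comp (X + G)
          + Polynomial.C C₃ * (X + G + 1))) + (1 + Polynomial.C C₄ * (X + G + 1))),
    fun b M c m ρ hctx hb hc hr n val hn hval hfirst hnext htest => ?_⟩
  have hGb : G.eval b = N.eval b + N.eval b * g₂.eval b := by simp [hG]
  have hGM := eval_mono G hb
  have hNM := eval_mono N hb
  set L := M + G.eval M with hL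
  obtain ⟨t2, e2, ht2⟩ := hC₁ c M hc
  let mj : ℕ → Mem := fun j => iter j (fun i m => p.run (Function.update ρ v (val i)) m) m
  let I : ℕ → Mem → Prop := fun j s =>
    Bdd s (M + N.eval b + j * g₂.eval b) ∧
      Rel s (mj j) (Function.update ρ v (val j)) (v :: sc) ∧ ∀ a, ro a → mj j a = m a
  have hI : ∀ j ≤ n, ∀ s, I j s → Bdd s L := by
    intro j hj s hs
    refine hs.1.mono ?_
    have : j * g₂.eval b ≤ N.eval b * g₂.eval b := Nat.mul_le_mul_right _ (hj.trans hn)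
    omega
  have hloop := exec_loop (e := test) (c := .seq p.comp (.write 100 (.const v) next))
    (n := n) (T := C₄ * (L + 1)) (T' := q₂.eval L + C₃ * (L + 1)) I ?_ ?_
    (s := store c 100 v (val 0)) ?_
  · obtain ⟨s', t, h1, h2, h3⟩ := hloop
    rw [hfirst] at e2
    refine ⟨s', _, Exec.seq e2 h1, ?_, ?_, h2.2.1.drop hv, h2.2.2⟩
    · simp only [eval_add, eval_comp, eval_mul, eval_X, eval_one, eval_C]
      rw [← hL]
      have a1 : C₁ * (M + 1) ≤ C₁ * (L + 1) :=
        Nat.mul_le_mul_left _ (by omega)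
      have a2 : n * (1 + C₄ * (L + 1) + (q₂.eval L + C₃ * (L + 1)))
          ≤ N.eval M * (1 + C₄ * (L + 1) + (q₂.eval L + C₃ * (L + 1))) :=
        Nat.mul_le_mul_right _ (hn.trans hNM)
      omega
    · refine h2.1.mono ?_
      have : n * g₂.eval b ≤ N.eval b * g₂.eval b := Nat.mul_le_mul_right _ hn
      omega
  · intro j hj s hs
    exact ⟨htest j hj s _ hs.2.1 hs.2.2, (hC₄ s L (hI j hj s hs)).1⟩
  · intro j hj s hs
    obtain ⟨c3, t3, e3, ht3, hb3, hr3, hf3⟩ :=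
      h₂ b _ s _ _ (hctx.congr h0 hs.2.2) (by omega) hs.1 hs.2.1
    have hmul : (j + 1) * g₂.eval b = j * g₂.eval b + g₂.eval b := by ring
    have hmul' : (j + 1) * g₂.eval b ≤ N.eval b * g₂.eval b := Nat.mul_le_mul_right _ (by omega)
    have hro : ∀ a, ro a → mj (j + 1) a = m a := fun a ha => (hf3 a ha).trans (hs.2.2 a ha)
    obtain ⟨t5, e5, ht5⟩ := hC₃ c3 _ hb3
    have hvar : next.eval c3 = val (j + 1) := hnext j hj c3 _ hr3 hro
    refine ⟨_, _, Exec.seq e3 e5, ⟨?_, ?_, hro⟩, ?_⟩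
    · refine (hb3.mono (by omega)).store _ _ ?_
      rw [hvar]
      exact (hval _ (by omega)).trans (by omega)
    · rw [hvar]
      have := hr3.store_loc v (val (j + 1))
      simp only [Function.update_idem] at this
      exact ⟨this.mem, fun w hw => this.var w (List.mem_cons.2 (by
        rcases List.mem_cons.1 hw with h | h
        · exact Or.inl h
        · exact Or.inr (List.mem_cons_of_mem _ h)))⟩
    · have hle : M + Polynomial.eval b N + j * Polynomial.eval b g₂ ≤ L := by omega
      have a0 := eval_mono q₂ hle
      have a2 : C₃ * (M + N.eval b + j * g₂.eval b + g₂.eval b + 1) ≤ C₃ * (L + 1) :=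
        Nat.mul_le_mul_left _ (by omega)
      omega
  · refine ⟨?_, hr.store_loc v _, fun _ _ => rfl⟩
    exact (hc.mono (by omega)).store _ _ ((hval 0 (by omega)).trans (by omega))

theorem S.correct_rep {ro : ℕ → Bool} (h0 : ro 0) {p : S} {d : Range} {v : ℕ} {sc : List ℕ}
    (hv : v ∉ sc) (hp : p.Correct ro (v :: sc)) : (S.rep d v p).Correct ro sc := by
  obtain ⟨g, q, h⟩ := S.correct_loop h0 hv hp (.op .sub d.exp (loc v)) (.const 0)
    (.op .add (loc v) (.const 1)) (X + X * X)
  refine ⟨g, q, fun b M c m ρ hctx hb hc hr => ?_⟩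
  have hn : d.val m ≤ (X + X * X : ℕ[X]).eval b := by simpa using Range.val_le hctx d
  refine h b M c m ρ hctx hb hc hr (d.val m) (fun j => j) hn
    (fun j hj => (size_le_self j).trans (by omega)) rfl (fun j hj s m' hs _ => ?_)
    (fun j hj s m' hs hm => ?_)
  · have := hs.var v (by simp)
    simp [loc, RAM.Exp.eval, RAM.Op.eval, this]
  · have h1 : d.exp.eval s = d.val m := Range.exp_eval ((hs.mem 0 (by omega)).trans (hm 0 h0)) d
    have h2 : (loc v).eval s = j := by simpa [loc, RAM.Exp.eval] using hs.var v (by simp)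
    simp only [RAM.Exp.eval, RAM.Op.eval, h1, h2]
    omega

/-- The loop variable is halved in every round, and `m a 0 / 2 ^ j` vanishes exactly if `j` is at
least the bit length of `m a 0`. -/
theorem S.correct_bits {ro : ℕ → Bool} (h0 : ro 0) {p : S} {a v : ℕ} {sc : List ℕ}
    (ha : a < 100) (hro : ro a) (hv : v ∉ sc) (hp : p.Correct ro (v :: sc)) :
    (S.bits a v p).Correct ro sc := by
  obtain ⟨g, q, h⟩ := S.correct_loop h0 hv hp (loc v) (.read a (.const 0))
    (.op .div (loc v) (.const 2)) X
  refine ⟨g, q, fun b M c m ρ hctx hb hc hr => ?_⟩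
  have hn : (m a 0).size ≤ (X : ℕ[X]).eval b := by simpa using hctx.ro a hro 0
  refine h b M c m ρ hctx hb hc hr (m a 0).size (fun j => m a 0 / 2 ^ j) hn
    (fun j hj => (Nat.size_le_size (Nat.div_le_self _ _)).trans (by omega)) ?_
    (fun j hj s m' hs _ => ?_) (fun j hj s m' hs hm => ?_)
  · simp [RAM.Exp.eval, hr.mem a ha]
  · have := hs.var v (by simp)
    simp [loc, RAM.Exp.eval, RAM.Op.eval, this, pow_succ, Nat.div_div_eq_div_mul]
  · have h2 : (loc v).eval s = m a 0 / 2 ^ j := by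
      simpa [loc, RAM.Exp.eval] using hs.var v (by simp)
    rw [h2, Nat.div_eq_zero_iff]
    have : m a 0 < 2 ^ j ↔ (m a 0).size ≤ j := Nat.size_le.symm
    simp only [this, pow_eq_zero_iff', OfNat.ofNat_ne_zero, false_and, false_or]
    omega

theorem S.correct (ro : ℕ → Bool) (h0 : ro 0) (p : S) (sc : List ℕ) (h : p.wf ro sc) :
    p.Correct ro sc := by
  induction p generalizing sc with
  | skip =>
    refine ⟨0, 1, fun b M c m ρ hctx hb hc hr =>
      ⟨c, 1, Exec.skip c, by simp, by simpa using hc, hr, fun _ _ => rfl⟩⟩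
  | set a i e =>
    simp only [S.wf, Bool.and_eq_true, decide_eq_true_eq] at h
    exact correct_set h.1.1.1 (by simpa using h.1.1.2) h.1.2 h.2
  | seq p p' ih ih' =>
    simp only [S.wf, Bool.and_eq_true] at h
    exact correct_seq h0 (ih _ h.1) (ih' _ h.2)
  | ite e p p' ih ih' =>
    simp only [S.wf, Bool.and_eq_true] at h
    exact correct_ite h.1.1 (ih _ h.1.2) (ih' _ h.2)
  | rep d v p ih =>
    simp only [S.wf, Bool.and_eq_true] at h
    exact correct_rep h0 (by simpa using h.1) (ih _ h.2)
  | bits a v p ih =>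
    simp only [S.wf, Bool.and_eq_true, decide_eq_true_eq] at h
    exact correct_bits h0 h.1.1.1 h.1.1.2 (by simpa using h.1.2) (ih _ h.2)

/-- A statement that is well-formed for the read-only arrays `ro`, followed by one that is
well-formed for `ro'`, runs in polynomial time. -/
theorem exists_exec_seq {ro ro' : ℕ → Bool} (h0 : ro 0) (hro' : ∀ a, ro' a → a < 100) (h0' : ro' 0)
    {p p' : S}
    (hp : p.wf ro []) (hp' : p'.wf ro' []) :
    ∃ q : ℕ[X], ∀ b m ρ, Bdd m b → m 0 0 ≤ b → ∃ c t, Exec (.seq p.comp p'.comp) m c t ∧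
      t ≤ q.eval b ∧ ∀ a < 100, c a = p'.run ρ (p.run ρ m) a := by
  obtain ⟨g₁, q₁, h₁⟩ := S.correct ro h0 p [] hp
  obtain ⟨g₂, q₂, h₂⟩ := S.correct ro' h0' p' [] hp'
  refine ⟨q₁ + q₂.comp (X + g₁), fun b m ρ hm hb => ?_⟩
  obtain ⟨c1, t1, e1, ht1, hb1, hr1, hf1⟩ := h₁ b b m m ρ ⟨fun a _ i => hm a i, hb⟩ le_rfl hm
    ⟨fun _ _ => rfl, fun _ h => absurd h (by simp)⟩
  -- All cells have at most `b + g₁(b)` bits after the first statement, so its results may serve as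
  -- read-only data of the second one.
  have hctx : Ctx ro' (p.run ρ m) (b + g₁.eval b) :=
    ⟨fun a ha i => by rw [← hr1.mem a (hro' a ha)]; exact hb1 a i, by rw [hf1 0 h0]; omega⟩
  obtain ⟨c2, t2, e2, ht2, -, hr2, -⟩ := h₂ (b + g₁.eval b) _ c1 (p.run ρ m) ρ hctx le_rfl hb1 hr1
  refine ⟨c2, _, Exec.seq e1 e2, ?_, hr2.mem⟩
  simp only [eval_add, eval_comp, eval_X]
  omega

end ArrayLang

namespace Clustering

open Finset

/-! #### A greedy bound for fractional knapsacks -/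

/-- `i` comes before `g` in the order of increasing ratios `w / m`; ties are broken by the index. -/
def Before (w m : ℕ → ℕ) (i g : ℕ) : Prop :=
  w i * m g < w g * m i ∨ (w i * m g = w g * m i ∧ i < g)

-- `g` is the first element in the order of `key` at which the accumulated size reaches `K`.
open Classical in
theorem exists_prefix {α : Type*} [LinearOrder α] {I : Finset ℕ} {m : ℕ → ℕ} {key : ℕ → α}
    (hkey : Function.Injective key) {K : ℕ} (h1 : 1 ≤ K) (hK : K ≤ ∑ i ∈ I, m i) :
    ∃ g ∈ I, ∑ i ∈ I.filter (fun i => key i < key g), m i < K ∧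
      K ≤ ∑ i ∈ I.filter (fun i => key i < key g), m i + m g := by
  have hI : I.Nonempty := by
    rw [nonempty_iff_ne_empty]; rintro rfl; simp at hK; omega
  have hsplit : ∀ g ∈ I, ∑ i ∈ I.filter (fun i => key i ≤ key g), m i
      = ∑ i ∈ I.filter (fun i => key i < key g), m i + m g := by
    intro g hg
    have : I.filter (fun i => key i ≤ key g)
        = insert g (I.filter (fun i => key i < key g)) := by
      ext i
      simp only [mem_filter, mem_insert, le_iff_lt_or_eq, hkey.eq_iff]
      constructor
      · rintro ⟨h, h' | h'⟩
        · exact Or.inr ⟨h, h'⟩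
        · exact Or.inl h'
      · rintro (h | h)
        · exact ⟨h ▸ hg, Or.inr h⟩
        · exact ⟨h.1, Or.inl h.2⟩
    rw [this, sum_insert (by simp), add_comm]
  set J := I.filter (fun g => K ≤ ∑ i ∈ I.filter (fun i => key i ≤ key g), m i) with hJ
  have hJn : J.Nonempty := by
    obtain ⟨g, hg, hmax⟩ := I.exists_max_image key hI
    refine ⟨g, mem_filter.2 ⟨hg, ?_⟩⟩
    rwa [filter_true_of_mem (fun i hi => hmax i hi)]
  obtain ⟨g, hg, hmin⟩ := J.exists_min_image key hJn
  obtain ⟨hgI, hgK⟩ := mem_filter.1 hg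
  refine ⟨g, hgI, ?_, by rwa [hsplit g hgI] at hgK⟩
  by_contra hcon
  push Not at hcon
  have hne : (I.filter (fun i => key i < key g)).Nonempty := by
    rw [nonempty_iff_ne_empty]; intro h; rw [h] at hcon; simp at hcon; omega
  obtain ⟨g', hg', hmax⟩ := (I.filter (fun i => key i < key g)).exists_max_image key hne
  obtain ⟨hg'I, hlt⟩ := mem_filter.1 hg'
  have : g' ∈ J := by
    refine mem_filter.2 ⟨hg'I, hcon.trans (le_of_eq ?_)⟩
    congr 1
    ext i
    simp only [mem_filter]
    exact ⟨fun h => ⟨h.1, hmax i (mem_filter.2 h)⟩, fun h => ⟨h.1, h.2.trans_lt hlt⟩⟩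
  exact absurd (hmin g' this) (not_le.2 hlt)

-- All elements before `g` have a ratio `w / m` at most that of `g`, all others at least that. So a
-- prefix of total size `K`, with the fraction `s / m g` of `g`, costs per unit at most as much as
-- the whole set. Denominators are cleared.
open Classical in
theorem exists_knapsack {I : Finset ℕ} {m w : ℕ → ℕ} (hm : ∀ i ∈ I, 1 ≤ m i) {K : ℕ}
    (h1 : 1 ≤ K) (hK : K ≤ ∑ i ∈ I, m i) :
    ∃ g ∈ I, ∃ s, 1 ≤ s ∧ s ≤ m g ∧ ∑ i ∈ I.filter (fun i => Before w m i g), m i + s = K ∧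
      (∑ i ∈ I, m i) * (m g * (∑ i ∈ I.filter (fun i => Before w m i g), w i) + s * w g)
        ≤ K * m g * ∑ i ∈ I, w i := by
  -- The index as second component makes the key injective and agrees with the tie-breaking in
  -- `Before`.
  let key : ℕ → ℚ ×ₗ ℕ := fun i => toLex ((w i : ℚ) / m i, i)
  have hkey : Function.Injective key := fun i j h => by
    have := congrArg (fun x => (ofLex x).2) h
    simpa [key] using this
  obtain ⟨g, hg, hlt, hle⟩ := exists_prefix hkey h1 hK
  have hmg : (0 : ℚ) < m g := by exact_mod_cast hm g hg
  have hbefore : I.filter (fun i => key i < key g) = I.filter (fun i => Before w m i g) := by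
    refine filter_congr fun i hi => ?_
    have hmi : (0 : ℚ) < m i := by exact_mod_cast hm i hi
    simp only [key, Before, Prod.Lex.toLex_lt_toLex, div_lt_div_iff₀ hmi hmg, div_eq_div_iff hmi.ne' hmg.ne']
    norm_cast
  rw [hbefore] at hlt hle
  set A := I.filter (fun i => Before w m i g) with hA
  refine ⟨g, hg, K - ∑ i ∈ A, m i, by omega, by omega,
    by change ∑ i ∈ A, m i + _ = K; omega, ?_⟩
  have hAI : A ⊆ I := filter_subset _ _
  have hsA : ∀ i ∈ A, (w i : ℚ) * m g ≤ w g * m i := by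
    intro i hi
    rcases (mem_filter.1 hi).2 with h | h
    · exact_mod_cast h.le
    · exact_mod_cast h.1.le
  have hsB : ∀ i ∈ I \ A, (w g : ℚ) * m i ≤ w i * m g := by
    intro i hi
    obtain ⟨hi1, hi2⟩ := mem_sdiff.1 hi
    by_contra hcon
    push Not at hcon
    exact hi2 (mem_filter.2 ⟨hi1, Or.inl (by exact_mod_cast hcon)⟩)
  have e1 : (∑ i ∈ A, (w i : ℚ)) * m g ≤ w g * ∑ i ∈ A, (m i : ℚ) := by
    rw [sum_mul, mul_sum]; exact sum_le_sum hsA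
  have e2 : (w g : ℚ) * ∑ i ∈ I \ A, (m i : ℚ) ≤ (∑ i ∈ I \ A, (w i : ℚ)) * m g := by
    rw [sum_mul, mul_sum]; exact sum_le_sum hsB
  have f1 : ∑ i ∈ I \ A, (m i : ℚ) + ∑ i ∈ A, (m i : ℚ) = ∑ i ∈ I, (m i : ℚ) := sum_sdiff hAI
  have f2 : ∑ i ∈ I \ A, (w i : ℚ) + ∑ i ∈ A, (w i : ℚ) = ∑ i ∈ I, (w i : ℚ) := sum_sdiff hAI
  have hs : ((K - ∑ i ∈ A, m i : ℕ) : ℚ) = K - ∑ i ∈ A, (m i : ℚ) := by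
    rw [Nat.cast_sub hlt.le]; push_cast; rfl
  have hKM : (K : ℚ) ≤ ∑ i ∈ I, (m i : ℚ) := by exact_mod_cast hK
  have goal : (∑ i ∈ I, (m i : ℚ)) * (m g * (∑ i ∈ A, (w i : ℚ))
      + ((K - ∑ i ∈ A, m i : ℕ) : ℚ) * w g) ≤ K * m g * ∑ i ∈ I, (w i : ℚ) := by
    rw [hs, ← f2, ← f1]
    rw [← f1] at hKM
    have hK0 : (0 : ℚ) ≤ K := by positivity
    nlinarith [mul_le_mul_of_nonneg_left e2 hK0, mul_le_mul_of_nonneg_left e1 (sub_nonneg.2 hKM)]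
  exact_mod_cast goal

/-! #### Costs of solutions -/

/-- The distances on the numbers below `N` form a metric space. -/
structure IsDist (N : ℕ) (D : ℕ → ℕ → ℕ) : Prop where
  self : ∀ u < N, D u u = 0
  symm : ∀ u < N, ∀ v < N, D u v = D v u
  tri : ∀ u < N, ∀ v < N, ∀ w < N, D u w ≤ D u v + D v w

/-- A solution is given by a function `R`: the facility `x` is closed if `R x = 0`, and otherwise
open with radius `R x - 1`. The facility `x` is the one nearest to `v`, at distance `d`. -/
structure IsNear (N : ℕ) (D : ℕ → ℕ → ℕ) (R : ℕ → ℕ) (v x d : ℕ) : Prop where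
  lt : x < N
  ne : R x ≠ 0
  eq : D v x - (R x - 1) = d
  le : ∀ y < N, R y ≠ 0 → d ≤ D v y - (R y - 1)

/-- The distance from `v` to the nearest ball. -/
noncomputable def near (N : ℕ) (D : ℕ → ℕ → ℕ) (R : ℕ → ℕ) (v : ℕ) : ℕ :=
  sInf {d | ∃ y < N, R y ≠ 0 ∧ D v y - (R y - 1) = d}

theorem near_le {N : ℕ} {D : ℕ → ℕ → ℕ} {R : ℕ → ℕ} {v y : ℕ} (hy : y < N) (hR : R y ≠ 0) :
    near N D R v ≤ D v y - (R y - 1) := Nat.sInf_le ⟨y, hy, hR, rfl⟩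

theorem IsNear.near_eq {N : ℕ} {D : ℕ → ℕ → ℕ} {R : ℕ → ℕ} {v x d : ℕ} (h : IsNear N D R v x d) :
    near N D R v = d := by
  refine le_antisymm ((near_le h.lt h.ne).trans h.eq.le) ?_
  obtain ⟨y, hy, hR, he⟩ := Nat.sInf_mem (s := {d | ∃ y < N, R y ≠ 0 ∧ D v y - (R y - 1) = d})
    ⟨d, x, h.lt, h.ne, h.eq⟩
  rw [near, ← he]
  exact h.le y hy hR

theorem exists_isNear {N : ℕ} (D : ℕ → ℕ → ℕ) {R : ℕ → ℕ} (v : ℕ) {y : ℕ} (hy : y < N)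
    (hR : R y ≠ 0) : ∃ x, IsNear N D R v x (near N D R v) := by
  obtain ⟨x, hx, hR', he⟩ := Nat.sInf_mem (s := {d | ∃ y < N, R y ≠ 0 ∧ D v y - (R y - 1) = d})
    ⟨_, y, hy, hR, rfl⟩
  exact ⟨x, hx, hR', he, fun z hz hRz => near_le hz hRz⟩

/-- The open facilities. -/
def opened (N : ℕ) (R : ℕ → ℕ) : Finset ℕ := (range N).filter fun x => R x ≠ 0

theorem mem_opened {N : ℕ} {R : ℕ → ℕ} {x : ℕ} : x ∈ opened N R ↔ x < N ∧ R x ≠ 0 := by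
  simp [opened]

/-- The cost of a solution. -/
noncomputable def cost (N : ℕ) (P : Finset ℕ) (D : ℕ → ℕ → ℕ) (l : ℕ) (R : ℕ → ℕ) : ℕ :=
  ∑ x ∈ range N, l * (R x - 1) + ∑ p ∈ P, near N D R p

/-- Weak duality: `A p` is at most what `p` pays to its own ball plus its distance to that ball, and
no ball receives more than its price. -/
theorem sum_le_of_dual_feasible {P Y : Finset ℕ} {D : ℕ → ℕ → ℕ} {l lam : ℕ} {σ r A : ℕ → ℕ}
    (hσ : ∀ p ∈ P, σ p ∈ Y)
    (h : ∀ x ∈ Y, ∑ p ∈ P, (A p - (D p x - r x)) ≤ lam + l * r x) :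
    ∑ p ∈ P, A p ≤ lam * #Y + (∑ x ∈ Y, l * r x + ∑ p ∈ P, (D p (σ p) - r (σ p))) := by
  have h1 : ∑ p ∈ P, A p
      ≤ ∑ p ∈ P, (A p - (D p (σ p) - r (σ p))) + ∑ p ∈ P, (D p (σ p) - r (σ p)) := by
    rw [← sum_add_distrib]; exact sum_le_sum fun p _ => by omega
  have h2 : ∑ p ∈ P, (A p - (D p (σ p) - r (σ p))) ≤ ∑ x ∈ Y, (lam + l * r x) := by
    rw [← sum_fiberwise_of_maps_to hσ]
    refine sum_le_sum fun x hx => le_trans ?_ (h x hx)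
    refine le_trans (le_of_eq ?_) (sum_le_sum_of_subset (filter_subset (fun p => σ p = x) P))
    exact sum_congr rfl fun p hp => by rw [(mem_filter.1 hp).2]
  rw [sum_add_distrib, sum_const, smul_eq_mul, mul_comm] at h2
  omega

/-! #### The primal-dual algorithm -/

/-- The distance from `p` to the ball number `b`: the balls are numbered such that the center of `b`
is `b / N`, and the radius is the distance from `b / N` to `b % N`. -/
def bdist (N : ℕ) (D : ℕ → ℕ → ℕ) (p b : ℕ) : ℕ := D p (b / N) - D (b / N) (b % N)

/-- The radius of the ball number `b`. -/
def brad (N : ℕ) (D : ℕ → ℕ → ℕ) (b : ℕ) : ℕ := D (b / N) (b % N)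

/-- The dual solution `A` contributes to both balls. -/
def Conflict (N : ℕ) (P : Finset ℕ) (D : ℕ → ℕ → ℕ) (A : ℕ → ℕ) (b b' : ℕ) : Prop :=
  ∃ p ∈ P, bdist N D p b < A p ∧ bdist N D p b' < A p

/-- The outcome `A`, `sel` of the primal-dual algorithm for the Lagrange multiplier `lam` and the set
`Bs` of balls; `T b` is the time at which `b` was paid for. -/
structure PrimalDual (N : ℕ) (P : Finset ℕ) (D : ℕ → ℕ → ℕ) (l lam : ℕ) (Bs : Finset ℕ)
    (T A : ℕ → ℕ) (sel : Finset ℕ) : Prop where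
  subset : sel ⊆ Bs
  feasible : ∀ b ∈ Bs, ∑ p ∈ P, (A p - bdist N D p b) ≤ lam + l * brad N D b
  paid : ∀ b ∈ sel, lam + l * brad N D b ≤ ∑ p ∈ P, (A p - bdist N D p b) + N
  indep : ∀ b ∈ sel, ∀ b' ∈ sel, b ≠ b' → ¬Conflict N P D A b b'
  le_time : ∀ b ∈ Bs, ∀ p ∈ P, bdist N D p b < A p → A p ≤ T b
  dominated : ∀ p ∈ P, ∃ b ∈ Bs, T b ≤ A p ∧ bdist N D p b ≤ A p ∧
    ∃ b' ∈ sel, brad N D b ≤ brad N D b' ∧ (b' = b ∨ Conflict N P D A b b')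

/-- `R` opens the centers of the selected balls with three times their radius. -/
structure Tripled (N : ℕ) (D : ℕ → ℕ → ℕ) (sel : Finset ℕ) (R : ℕ → ℕ) : Prop where
  le : ∀ b ∈ sel, 3 * brad N D b + 1 ≤ R (b / N)
  eq : ∀ x < N, R x ≠ 0 → ∃ b ∈ sel, b / N = x ∧ R x = 3 * brad N D b + 1

/-- Several selected balls may share a center; each open facility is charged to one selected ball
that gives it its radius, and this is injective because the center is determined by the ball. -/
theorem Tripled.sum_le {N : ℕ} {D : ℕ → ℕ → ℕ} {sel : Finset ℕ} {R : ℕ → ℕ}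
    (h : Tripled N D sel R) (l c : ℕ) :
    ∑ x ∈ range N, l * (R x - 1) + c * #(opened N R)
      ≤ ∑ b ∈ sel, (c + 3 * (l * brad N D b)) := by
  have h1 : ∑ x ∈ range N, l * (R x - 1) = ∑ x ∈ opened N R, l * (R x - 1) := by
    rw [opened, sum_filter]
    refine sum_congr rfl fun x _ => ?_
    split_ifs with h
    · rfl
    · rw [not_not.1 h]; rfl
  have h2 : ∀ x, ∃ b, x ∈ opened N R → b ∈ sel ∧ b / N = x ∧ R x = 3 * brad N D b + 1 := by
    intro x
    by_cases hx : x ∈ opened N R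
    · obtain ⟨b, hb⟩ := h.eq x (mem_opened.1 hx).1 (mem_opened.1 hx).2
      exact ⟨b, fun _ => hb⟩
    · exact ⟨0, fun h => absurd h hx⟩
  choose f hf using h2
  have hinj : Set.InjOn f (opened N R : Set ℕ) := fun x hx y hy hxy => by
    rw [← (hf x hx).2.1, ← (hf y hy).2.1, hxy]
  have hsub : (opened N R).image f ⊆ sel := by
    intro b hb
    obtain ⟨x, hx, rfl⟩ := mem_image.1 hb
    exact (hf x hx).1
  refine le_trans (le_of_eq ?_) (sum_le_sum_of_subset hsub)
  rw [sum_image hinj, h1, sum_add_distrib, sum_const, smul_eq_mul, add_comm, mul_comm c]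
  congr 1
  refine sum_congr rfl fun x hx => ?_
  rw [(hf x hx).2.2, Nat.add_sub_cancel]; ring

/-- The dual variables pay three times: once a point's payments to the selected balls are multiplied
by 3, what remains of `3 * A p` still covers its distance to a tripled ball. The payments cover the
prices up to `N` for each of the at most `N * N` selected balls, whence the error term. -/
theorem PrimalDual.cost_le {N : ℕ} {P : Finset ℕ} {D : ℕ → ℕ → ℕ} {l lam : ℕ} {Bs : Finset ℕ}
    {T A : ℕ → ℕ} {sel : Finset ℕ} (h : PrimalDual N P D l lam Bs T A sel) (hD : IsDist N D)
    (hP : P ⊆ range N) (hBs : Bs ⊆ range (N * N)) {R : ℕ → ℕ} (hR : Tripled N D sel R) :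
    cost N P D l R + 3 * lam * #(opened N R) ≤ 3 * ∑ p ∈ P, A p + 3 * N * (N * N) := by
  have hcen : ∀ b ∈ Bs, b / N < N := fun b hb =>
    Nat.div_lt_of_lt_mul (mem_range.1 (hBs hb))
  have hne : ∀ b ∈ sel, R (b / N) ≠ 0 := fun b hb => by have := hR.le b hb; omega
  have hpoint : ∀ p ∈ P, near N D R p + 3 * ∑ b ∈ sel, (A p - bdist N D p b) ≤ 3 * A p := by
    intro p hp
    have hpN := mem_range.1 (hP hp)
    by_cases hc : ∃ b ∈ sel, bdist N D p b < A p
    · obtain ⟨b, hb, hlt⟩ := hc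
      -- By independence a point contributes to at most one selected ball.
      have hsum : ∑ b ∈ sel, (A p - bdist N D p b) = A p - bdist N D p b := by
        refine sum_eq_single_of_mem b hb fun b' hb' hbb => ?_
        have := h.indep b' hb' b hb hbb
        by_contra hcon
        exact this ⟨p, hp, by omega, hlt⟩
      have h1 := near_le (D := D) (v := p) (hcen b (h.subset hb)) (hne b hb)
      have h2 := hR.le b hb
      rw [hsum]
      unfold bdist brad at *
      omega
    · push Not at hc
      have hsum : ∑ b ∈ sel, (A p - bdist N D p b) = 0 :=
        sum_eq_zero fun b hb => Nat.sub_eq_zero_of_le (hc b hb)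
      rw [hsum]
      obtain ⟨b, hb, hT, hpb, b', hb', hr, hconf⟩ := h.dominated p hp
      have h1 := near_le (D := D) (v := p) (hcen b' (h.subset hb')) (hne b' hb')
      have h2 := hR.le b' hb'
      rcases hconf with rfl | ⟨q, hq, hq1, hq2⟩
      · unfold bdist brad at *; omega
      -- Go from `p` to the center of `b`, to a common contributor `q`, to the center of `b'`. Each
      -- leg is at most `A p` plus a radius, since `A q ≤ T b ≤ A p`, and each radius is at most
      -- that of `b'`. This is where tripling and the order by radius are used.
      · have hqN := mem_range.1 (hP hq)
        have h3 := h.le_time b hb q hq hq1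
        have t1 := hD.tri p hpN _ (hcen b hb) _ (hcen b' (h.subset hb'))
        have t2 := hD.tri _ (hcen b hb) q hqN _ (hcen b' (h.subset hb'))
        have t3 := hD.symm _ (hcen b hb) q hqN
        unfold bdist brad at *
        omega
  have hsum := sum_le_sum hpoint
  rw [sum_add_distrib, ← mul_sum, sum_comm, ← mul_sum] at hsum
  have hpaid := sum_le_sum h.paid
  have htrip := hR.sum_le l (3 * lam)
  have hcard : #sel ≤ N * N := by
    simpa using card_le_card (h.subset.trans hBs)
  have e1 : ∑ b ∈ sel, (3 * lam + 3 * (l * brad N D b))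
      = 3 * ∑ b ∈ sel, (lam + l * brad N D b) := by
    rw [mul_sum]; exact sum_congr rfl fun _ _ => by ring
  have e2 : ∑ b ∈ sel, (∑ p ∈ P, (A p - bdist N D p b) + N)
      = ∑ b ∈ sel, ∑ p ∈ P, (A p - bdist N D p b) + #sel * N := by
    rw [sum_add_distrib, sum_const, smul_eq_mul]
  have e3 : #sel * N ≤ N * (N * N) := by
    rw [mul_comm]; exact Nat.mul_le_mul_left _ hcard
  have e4 : 3 * N * (N * N) = 3 * (N * (N * N)) := by ring
  rw [cost]
  omega

/-- For a very large multiplier, paying a ball requires some point with a dual value above every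
distance `Q`. Such a point contributes to all balls, so any two selected balls conflict. -/
theorem PrimalDual.card_opened_le_one {N : ℕ} {P : Finset ℕ} {D : ℕ → ℕ → ℕ} {l lam : ℕ}
    {Bs : Finset ℕ} {T A : ℕ → ℕ} {sel : Finset ℕ} (h : PrimalDual N P D l lam Bs T A sel)
    (hP : P ⊆ range N) (hBs : Bs ⊆ range (N * N)) {Q : ℕ} (hQ : ∀ u < N, ∀ v < N, D u v ≤ Q)
    (hlam : N * Q + N < lam) {R : ℕ → ℕ} (hR : Tripled N D sel R) : #(opened N R) ≤ 1 := by
  have hsel : #sel ≤ 1 := by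
    refine card_le_one.2 fun b hb b' hb' => ?_
    by_contra hne
    refine h.indep b hb b' hb' hne ?_
    have h1 : ∑ p ∈ P, Q < ∑ p ∈ P, (A p - bdist N D p b) := by
      have h2 := h.paid b hb
      have h3 : ∑ p ∈ P, Q ≤ N * Q := by
        rw [sum_const, smul_eq_mul]
        exact Nat.mul_le_mul_right _ (by simpa using card_le_card hP)
      omega
    obtain ⟨p, hp, hlt⟩ := exists_lt_of_sum_lt h1
    have h4 := hQ p (mem_range.1 (hP hp)) (b' / N)
      (Nat.div_lt_of_lt_mul (mem_range.1 (hBs (h.subset hb'))))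
    exact ⟨p, hp, by omega, by unfold bdist; omega⟩
  have := hR.sum_le 0 1
  simp only [zero_mul, sum_const_zero, one_mul, zero_add, mul_zero, add_zero, sum_const,
    smul_eq_mul, mul_one] at this
  omega

end Clustering

namespace Clustering

open Finset

/-! #### Combining two solutions -/

/-- The facilities of `R` that are assigned to `i`. -/
def group (N : ℕ) (R x₁ : ℕ → ℕ) (i : ℕ) : Finset ℕ := (opened N R).filter fun j => x₁ j = i

/-- The cost of closing `j`. -/
def closeCost (P : Finset ℕ) (x₂ d₁ d₂ : ℕ → ℕ) (j : ℕ) : ℕ :=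
  ∑ p ∈ P.filter (fun p => x₂ p = j), (d₁ p + d₂ p)

/-- The largest radius of a facility assigned to `i`. -/
def maxRad (N : ℕ) (R x₁ : ℕ → ℕ) (i : ℕ) : ℕ := (group N R x₁ i).sup fun j => R j - 1

/-- The cost of replacing all facilities of `R₂` that are assigned to `i` by the facility `i`
of `R₁`. -/
def mergeCost (N : ℕ) (l : ℕ) (R₁ R₂ x₁ e : ℕ → ℕ) (i : ℕ) : ℕ :=
  l * ((R₁ i - 1) + maxRad N R₂ x₁ i) + ∑ j ∈ group N R₂ x₁ i, e j

/-- The number of facilities that are saved by this. -/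
def saving (N : ℕ) (R₂ x₁ : ℕ → ℕ) (i : ℕ) : ℕ := #(group N R₂ x₁ i) - 1

/-- The facility `j` of `R₂` is closed if the threshold is the facility `j₀`. -/
def Closed (N : ℕ) (l : ℕ) (R₁ R₂ x₁ e : ℕ → ℕ) (j₀ j : ℕ) : Prop :=
  j ∈ opened N R₂ ∧
    ((2 ≤ #(group N R₂ x₁ (x₁ j)) ∧
        Before (mergeCost N l R₁ R₂ x₁ e) (saving N R₂ x₁) (x₁ j) (x₁ j₀)) ∨
      (x₁ j = x₁ j₀ ∧ (e j < e j₀ ∨ (e j = e j₀ ∧ j ≤ j₀))))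

/-- `R` results from `R₂` by replacing the closed facilities by facilities of `R₁`. -/
structure Merged (N : ℕ) (R₁ R₂ x₁ : ℕ → ℕ) (cl : ℕ → Prop) (R : ℕ → ℕ) : Prop where
  le_kept : ∀ j < N, R₂ j ≠ 0 → ¬cl j → R₂ j ≤ R j
  le_new : ∀ j < N, cl j → R₁ (x₁ j) + 2 * (R₂ j - 1) ≤ R (x₁ j)
  eq : ∀ x < N, R x ≠ 0 → (R₂ x ≠ 0 ∧ ¬cl x ∧ R x = R₂ x) ∨
    ∃ j < N, cl j ∧ x₁ j = x ∧ R x = R₁ x + 2 * (R₂ j - 1)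

theorem sum_opened {N : ℕ} (R f : ℕ → ℕ) (hf : ∀ x, R x = 0 → f x = 0) :
    ∑ x ∈ opened N R, f x = ∑ x ∈ range N, f x := by
  rw [opened, sum_filter]
  refine sum_congr rfl fun x _ => ?_
  split_ifs with h
  · rfl
  · exact (hf x (not_not.1 h)).symm

/-- Let `j = x₂ p` be closed. The facility `x₁ j` is nearest to `j`, so its ball in `R₁` is within
`D j p + d₁ p` of `j`; a second copy of `D p j` leads from `p` to `j`. Both copies are at most `d₂
p` plus the radius of `j`, and the enlargement by twice this radius cancels the latter. -/
theorem Merged.near_le {N : ℕ} {D : ℕ → ℕ → ℕ} (hD : IsDist N D) {R₁ R₂ x₁ x₂ d₁ d₂ : ℕ → ℕ}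
    (h₁ : ∀ v < N, IsNear N D R₁ v (x₁ v) (d₁ v)) (h₂ : ∀ v < N, IsNear N D R₂ v (x₂ v) (d₂ v))
    {cl : ℕ → Prop} {R : ℕ → ℕ} (hR : Merged N R₁ R₂ x₁ cl R)
    {p : ℕ} (hp : p < N) :
    (¬cl (x₂ p) → near N D R p ≤ d₂ p) ∧ near N D R p ≤ d₂ p + (d₁ p + d₂ p) := by
  have n2 := h₂ p hp
  have hkept : ¬cl (x₂ p) → near N D R p ≤ d₂ p := fun hc => by
    have h3 := hR.le_kept _ n2.lt n2.ne hc
    have h4 := n2.ne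
    have h5 := Clustering.near_le (D := D) (v := p) n2.lt (by omega : R (x₂ p) ≠ 0)
    have h6 := n2.eq
    omega
  refine ⟨hkept, ?_⟩
  by_cases hc : cl (x₂ p)
  · have n1 := h₁ p hp
    have nj := h₁ _ n2.lt
    have h3 := hR.le_new _ n2.lt hc
    have h4 := nj.ne
    have h5 := Clustering.near_le (D := D) (v := p) nj.lt (by omega : R (x₁ (x₂ p)) ≠ 0)
    have h6 := nj.le _ n1.lt n1.ne
    have h7 := n1.eq
    have h8 := nj.eq
    have h9 := n2.eq
    have t1 := hD.tri p hp _ n2.lt _ nj.lt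
    have t2 := hD.tri _ n2.lt p hp _ n1.lt
    have t3 := hD.symm p hp _ n2.lt
    omega
  · exact (hkept hc).trans (by omega)

theorem sum_group_le {N : ℕ} (R₂ x₁ f : ℕ → ℕ) (I : Finset ℕ) :
    ∑ i ∈ I, ∑ j ∈ group N R₂ x₁ i, f j ≤ ∑ j ∈ opened N R₂, f j := by
  unfold group
  rw [sum_fiberwise_eq_sum_filter]
  exact sum_le_sum_of_subset (filter_subset _ _)

theorem sum_closeCost {N : ℕ} {P : Finset ℕ} {R₂ x₂ : ℕ → ℕ} (d₁ d₂ : ℕ → ℕ)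
    (h : ∀ p ∈ P, x₂ p ∈ opened N R₂) :
    ∑ j ∈ opened N R₂, closeCost P x₂ d₁ d₂ j = ∑ p ∈ P, (d₁ p + d₂ p) :=
  sum_fiberwise_of_maps_to h _

/-- The groups are disjoint: the radii of `R₁` and the largest radii of the groups are charged to
the radius terms of the two costs, and the closing costs add up to all distances in both solutions.
-/
theorem sum_mergeCost_le {N : ℕ} {P : Finset ℕ} {D : ℕ → ℕ → ℕ} {R₁ R₂ x₁ x₂ d₁ d₂ : ℕ → ℕ}
    (hP : P ⊆ range N) (l : ℕ)
    (h₁ : ∀ v < N, IsNear N D R₁ v (x₁ v) (d₁ v)) (h₂ : ∀ v < N, IsNear N D R₂ v (x₂ v) (d₂ v))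
    {I : Finset ℕ} (hI : I ⊆ range N) :
    ∑ i ∈ I, mergeCost N l R₁ R₂ x₁ (closeCost P x₂ d₁ d₂) i
      ≤ cost N P D l R₁ + cost N P D l R₂ := by
  have e1 : ∑ p ∈ P, (d₁ p + d₂ p) = ∑ p ∈ P, near N D R₁ p + ∑ p ∈ P, near N D R₂ p := by
    rw [← sum_add_distrib]
    exact sum_congr rfl fun p hp => by
      rw [(h₁ p (mem_range.1 (hP hp))).near_eq, (h₂ p (mem_range.1 (hP hp))).near_eq]
  have e2 := sum_closeCost (N := N) (R₂ := R₂) d₁ d₂ (P := P) (x₂ := x₂)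
    fun p hp => mem_opened.2 ⟨(h₂ p (mem_range.1 (hP hp))).lt, (h₂ p (mem_range.1 (hP hp))).ne⟩
  have e3 := sum_group_le (N := N) R₂ x₁ (closeCost P x₂ d₁ d₂) I
  have e4 : ∑ i ∈ I, l * (R₁ i - 1) ≤ ∑ x ∈ range N, l * (R₁ x - 1) := sum_le_sum_of_subset hI
  have e5 : ∑ i ∈ I, l * maxRad N R₂ x₁ i ≤ ∑ x ∈ range N, l * (R₂ x - 1) := by
    refine le_trans (sum_le_sum fun i _ => ?_)
      ((sum_group_le (N := N) R₂ x₁ (fun j => l * (R₂ j - 1)) I).trans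
        (sum_opened R₂ _ fun x hx => by simp [hx]).le)
    rw [← mul_sum]
    refine Nat.mul_le_mul_left _ (Finset.sup_le fun j hj => ?_)
    exact single_le_sum (f := fun j => R₂ j - 1) (fun _ _ => Nat.zero_le _) hj
  unfold mergeCost cost
  simp only [mul_add, sum_add_distrib]
  omega

/-- There is at most one group per facility of `R₁`, so merging every group would leave no more
facilities than `R₁` has. -/
theorem sub_le_sum_saving {N : ℕ} {D : ℕ → ℕ → ℕ} {R₁ R₂ x₁ d₁ : ℕ → ℕ}
    (h₁ : ∀ v < N, IsNear N D R₁ v (x₁ v) (d₁ v)) :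
    #(opened N R₂) ≤ ∑ i ∈ (range N).filter (fun i => 2 ≤ #(group N R₂ x₁ i)), saving N R₂ x₁ i
      + #(opened N R₁) := by
  have h : ∀ j ∈ opened N R₂, x₁ j ∈ opened N R₁ := fun j hj =>
    mem_opened.2 ⟨(h₁ j (mem_opened.1 hj).1).lt, (h₁ j (mem_opened.1 hj).1).ne⟩
  rw [card_eq_sum_card_fiberwise h]
  have e1 : ∑ i ∈ opened N R₁, #(group N R₂ x₁ i)
      ≤ ∑ i ∈ opened N R₁, (saving N R₂ x₁ i + 1) :=
    sum_le_sum fun i _ => by unfold saving; omega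
  have e2 : ∑ i ∈ opened N R₁, saving N R₂ x₁ i
      ≤ ∑ i ∈ (range N).filter (fun i => 2 ≤ #(group N R₂ x₁ i)), saving N R₂ x₁ i := by
    rw [sum_filter]
    refine le_trans (sum_le_sum fun i _ => ?_) (sum_le_sum_of_subset (filter_subset _ _))
    split_ifs with hi
    · exact le_rfl
    · unfold saving; omega
  rw [sum_add_distrib, sum_const, smul_eq_mul, mul_one] at e1
  exact e1.trans (by omega)

-- A knapsack argument on the groups: `A` consists of the groups merged completely, and the group of
-- `x₁ j₀` is merged only in part. The set `C` of closed facilities is described by the single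
-- facility `j₀`, so that a program can find it by trying all `j₀`. The radius cost of the partial
-- group is left out here and added in `exists_merge`.
open Classical in
theorem exists_threshold {N : ℕ} {P : Finset ℕ} {D : ℕ → ℕ → ℕ} {R₁ R₂ x₁ x₂ d₁ d₂ : ℕ → ℕ}
    (hP : P ⊆ range N) (l k : ℕ)
    (h₁ : ∀ v < N, IsNear N D R₁ v (x₁ v) (d₁ v)) (h₂ : ∀ v < N, IsNear N D R₂ v (x₂ v) (d₂ v))
    (hk₁ : #(opened N R₁) ≤ k) (hk₂ : k < #(opened N R₂)) :
    ∃ j₀ ∈ opened N R₂, ∃ A C : Finset ℕ, A ⊆ range N ∧ x₁ j₀ ∉ A ∧ j₀ ∈ C ∧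
      (∀ j, j ∈ C ↔ Closed N l R₁ R₂ x₁ (closeCost P x₂ d₁ d₂) j₀ j) ∧
      (∀ j ∈ C, x₁ j ∈ insert (x₁ j₀) A) ∧
      #(opened N R₂) + #A + 1 ≤ k + #C ∧
      (#(opened N R₂) - #(opened N R₁)) *
        (∑ i ∈ A, l * ((R₁ i - 1) + maxRad N R₂ x₁ i) + ∑ j ∈ C, closeCost P x₂ d₁ d₂ j)
        ≤ 2 * (#(opened N R₂) - k) * (cost N P D l R₁ + cost N P D l R₂) := by
  set e := closeCost P x₂ d₁ d₂ with he
  set w := mergeCost N l R₁ R₂ x₁ e with hw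
  set m := saving N R₂ x₁ with hm
  set I := (range N).filter (fun i => 2 ≤ #(group N R₂ x₁ i)) with hI
  have hsav := sub_le_sum_saving (R₂ := R₂) h₁
  have hmI : ∀ i ∈ I, 1 ≤ m i := fun i hi => by
    have := (mem_filter.1 hi).2; simp only [hm, saving]; omega
  -- The number of facilities to get rid of is `k₂ - k`; of these, `s` come from the group of `g`.
  obtain ⟨g, hg, s, hs1, hsm, hsK, hbound⟩ := exists_knapsack (w := w) hmI
    (K := #(opened N R₂) - k) (by omega) (by rw [← hI, ← hm] at hsav; omega)
  set A := I.filter (fun i => Before w m i g) with hA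
  have hgm : m g + 1 = #(group N R₂ x₁ g) := by
    have := (mem_filter.1 hg).2; simp only [hm, saving]; omega
  -- Saving `s` facilities means closing `s + 1` of them, as the facility `g` of `R₁` is opened
  -- instead. With unit sizes, the knapsack takes the ones with the smallest closing costs.
  obtain ⟨j₀, hj₀, s', hs'1, hs'2, hs'3, hbound'⟩ := exists_knapsack (I := group N R₂ x₁ g)
    (m := fun _ => 1) (w := e) (fun _ _ => le_rfl) (K := s + 1) (by omega)
    (by rw [sum_const, smul_eq_mul, mul_one]; omega)
  obtain ⟨hj₀o, rfl⟩ := mem_filter.1 hj₀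
  set B := (group N R₂ x₁ (x₁ j₀)).filter (fun i => Before e (fun _ => 1) i j₀) with hB
  obtain rfl : s' = 1 := by omega
  have hj₀B : j₀ ∉ B := fun h => by
    rcases (mem_filter.1 h).2 with h | h <;> omega
  have hgA : x₁ j₀ ∉ A := fun h => by
    rcases (mem_filter.1 h).2 with h | h <;> omega
  set C := (opened N R₂).filter (fun j => x₁ j ∈ A) ∪ insert j₀ B with hC
  have hdisj : Disjoint ((opened N R₂).filter (fun j => x₁ j ∈ A)) (insert j₀ B) := by
    rw [disjoint_left]
    intro j hj hj'
    have h1 := (mem_filter.1 hj).2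
    have h2 : x₁ j = x₁ j₀ := by
      rcases mem_insert.1 hj' with rfl | h
      · rfl
      · exact (mem_filter.1 (mem_filter.1 h).1).2
    exact hgA (h2 ▸ h1)
  have hmemC : ∀ j, j ∈ C ↔ Closed N l R₁ R₂ x₁ e j₀ j := by
    intro j
    have hAiff : x₁ j < N → (x₁ j ∈ A ↔ 2 ≤ #(group N R₂ x₁ (x₁ j)) ∧ Before w m (x₁ j) (x₁ j₀)) :=
      fun hlt => by rw [hA, mem_filter, hI, mem_filter, mem_range]; simp [hlt]
    have hBiff : j ∈ B ↔ (j ∈ opened N R₂ ∧ x₁ j = x₁ j₀) ∧ Before e (fun _ => 1) j j₀ := by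
      rw [hB, mem_filter, group, mem_filter]
    simp only [hC, mem_union, mem_insert, mem_filter, Closed, hBiff]
    by_cases hj : j ∈ opened N R₂
    · have hlt : x₁ j < N := (h₁ j (mem_opened.1 hj).1).lt
      simp only [hj, true_and, hAiff hlt]
      constructor
      · rintro (h | rfl | ⟨h1, h2⟩)
        · exact Or.inl h
        · exact Or.inr ⟨rfl, Or.inr ⟨rfl, le_rfl⟩⟩
        · refine Or.inr ⟨h1, ?_⟩
          rcases h2 with h2 | ⟨h2, h3⟩
          · exact Or.inl (by simpa using h2)
          · exact Or.inr ⟨by simpa using h2, h3.le⟩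
      · rintro (h | ⟨h1, h2⟩)
        · exact Or.inl h
        · by_cases hjj : j = j₀
          · exact Or.inr (Or.inl hjj)
          · refine Or.inr (Or.inr ⟨h1, ?_⟩)
            rcases h2 with h2 | ⟨h2, h3⟩
            · exact Or.inl (by simpa using h2)
            · exact Or.inr ⟨by simpa using h2, lt_of_le_of_ne h3 hjj⟩
    · simp only [hj, false_and, false_or, or_false, iff_false]
      rintro rfl; exact hj hj₀o
  have hsumC : ∀ f : ℕ → ℕ, ∑ j ∈ C, f j
      = ∑ i ∈ A, ∑ j ∈ group N R₂ x₁ i, f j + (∑ j ∈ B, f j + f j₀) := by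
    intro f
    rw [hC, sum_union hdisj, sum_insert hj₀B]
    unfold group
    rw [sum_fiberwise_eq_sum_filter, add_comm (f j₀)]
  have hcardB : #B = s := by
    have : ∑ i ∈ B, 1 + 1 = s + 1 := hs'3
    simpa using this
  refine ⟨j₀, hj₀o, A, C, (filter_subset _ _).trans (filter_subset _ _), hgA,
    mem_union_right _ (mem_insert_self _ _), hmemC, ?_, ?_, ?_⟩
  · intro j hj
    rcases mem_union.1 hj with h | h
    · exact mem_insert_of_mem (mem_filter.1 h).2
    · refine mem_insert.2 (Or.inl ?_)
      rcases mem_insert.1 h with rfl | h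
      · rfl
      · exact (mem_filter.1 (mem_filter.1 h).1).2
  · have h3 := hsumC (fun _ => 1)
    simp only [sum_const, smul_eq_mul, mul_one, hcardB] at h3
    have h4 : ∑ i ∈ A, #(group N R₂ x₁ i) = ∑ i ∈ A, m i + #A := by
      rw [card_eq_sum_ones, ← sum_add_distrib]
      refine sum_congr rfl fun i hi => ?_
      have := (mem_filter.1 ((filter_subset _ _) hi : i ∈ I)).2
      simp only [hm, saving]; omega
    have h5 : ∑ i ∈ A, m i + s = #(opened N R₂) - k := hsK
    omega
  · have h3 := hsumC e
    have hwA : ∑ i ∈ A, l * ((R₁ i - 1) + maxRad N R₂ x₁ i)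
        + ∑ i ∈ A, ∑ j ∈ group N R₂ x₁ i, e j = ∑ i ∈ A, w i := by
      rw [← sum_add_distrib]; rfl
    set Ep := ∑ j ∈ B, e j + e j₀ with hEp
    set Eg := ∑ j ∈ group N R₂ x₁ (x₁ j₀), e j with hEg
    have hEgw : Eg ≤ w (x₁ j₀) := Nat.le_add_left _ _
    have hb2 : (m (x₁ j₀) + 1) * Ep ≤ (s + 1) * Eg := by
      have : (∑ i ∈ group N R₂ x₁ (x₁ j₀), 1) * (1 * ∑ i ∈ B, e i + 1 * e j₀)
        ≤ (s + 1) * 1 * ∑ i ∈ group N R₂ x₁ (x₁ j₀), e i := hbound'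
      simpa [hgm, one_mul] using this
    -- The `s + 1` cheapest of `m + 1` facilities cost at most the fraction `(s + 1) / (m + 1)` of
    -- the group, and this is at most `2 * s / m` because `s ≥ 1`. Hence the factor 2 in the bound.
    have hb3 : m (x₁ j₀) * Ep ≤ 2 * s * w (x₁ j₀) := by
      have h5 : (m (x₁ j₀) + 1) * (m (x₁ j₀) * Ep) ≤ (m (x₁ j₀) + 1) * (2 * s * Eg) := by
        calc (m (x₁ j₀) + 1) * (m (x₁ j₀) * Ep) = m (x₁ j₀) * ((m (x₁ j₀) + 1) * Ep) := by ring
          _ ≤ m (x₁ j₀) * ((s + 1) * Eg) := Nat.mul_le_mul_left _ hb2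
          _ ≤ (m (x₁ j₀) + 1) * (2 * s * Eg) := by
            have : m (x₁ j₀) * (s + 1) ≤ (m (x₁ j₀) + 1) * (2 * s) := by nlinarith
            calc m (x₁ j₀) * ((s + 1) * Eg) = (m (x₁ j₀) * (s + 1)) * Eg := by ring
              _ ≤ (m (x₁ j₀) + 1) * (2 * s) * Eg := Nat.mul_le_mul_right _ this
              _ = _ := by ring
      exact (Nat.le_of_mul_le_mul_left h5 (by omega)).trans (Nat.mul_le_mul_left _ hEgw)
    have hwI := sum_mergeCost_le hP l h₁ h₂ (I := I) (filter_subset _ _)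
    have hb4 : (∑ i ∈ I, m i) * (m (x₁ j₀) * ∑ i ∈ A, w i + s * w (x₁ j₀))
        ≤ (#(opened N R₂) - k) * m (x₁ j₀) * ∑ i ∈ I, w i := hbound
    have hM : #(opened N R₂) - #(opened N R₁) ≤ ∑ i ∈ I, m i := by
      change #(opened N R₂) ≤ ∑ i ∈ I, m i + _ at hsav; omega
    have hmpos := hmI _ hg
    rw [h3, ← add_assoc, hwA]
    refine le_of_mul_le_mul_left ?_ (show 0 < m (x₁ j₀) from hmpos)
    calc m (x₁ j₀) * ((#(opened N R₂) - #(opened N R₁)) * (∑ i ∈ A, w i + Ep))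
        = (#(opened N R₂) - #(opened N R₁)) * (m (x₁ j₀) * ∑ i ∈ A, w i + m (x₁ j₀) * Ep) := by
          ring
      _ ≤ (∑ i ∈ I, m i) * (2 * (m (x₁ j₀) * ∑ i ∈ A, w i + s * w (x₁ j₀))) :=
          Nat.mul_le_mul hM (by linarith [Nat.zero_le (m (x₁ j₀) * ∑ i ∈ A, w i)])
      _ = 2 * ((∑ i ∈ I, m i) * (m (x₁ j₀) * ∑ i ∈ A, w i + s * w (x₁ j₀))) := by ring
      _ ≤ 2 * ((#(opened N R₂) - k) * m (x₁ j₀) * ∑ i ∈ I, w i) := Nat.mul_le_mul_left _ hb4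
      _ ≤ 2 * ((#(opened N R₂) - k) * m (x₁ j₀) * (cost N P D l R₁ + cost N P D l R₂)) :=
          Nat.mul_le_mul_left _ (Nat.mul_le_mul_left _ hwI)
      _ = _ := by ring

-- On top of the knapsack bound come the original cost of `R₂` and the full radius cost of the
-- partially merged group. The latter is not proportional to the savings: its `R₂` part is bounded
-- by all radii of `R₂`, which gives the second copy of the cost of `R₂`, and its `R₁` part by `l *
-- r`.
open Classical in
theorem exists_merge {N : ℕ} {P : Finset ℕ} {D : ℕ → ℕ → ℕ} (hD : IsDist N D)
    {R₁ R₂ x₁ x₂ d₁ d₂ : ℕ → ℕ} (hP : P ⊆ range N) (l k : ℕ)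
    (h₁ : ∀ v < N, IsNear N D R₁ v (x₁ v) (d₁ v)) (h₂ : ∀ v < N, IsNear N D R₂ v (x₂ v) (d₂ v))
    (hk₁ : #(opened N R₁) ≤ k) (hk₂ : k < #(opened N R₂)) {r : ℕ}
    (hr : ∀ x < N, R₁ x ≤ r + 1) :
    ∃ j₀ < N, ∀ R, Merged N R₁ R₂ x₁ (Closed N l R₁ R₂ x₁ (closeCost P x₂ d₁ d₂) j₀) R →
      1 ≤ #(opened N R) ∧ #(opened N R) ≤ k ∧
      (#(opened N R₂) - #(opened N R₁)) * cost N P D l R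
        ≤ (#(opened N R₂) - #(opened N R₁)) * (2 * cost N P D l R₂ + l * r)
          + 2 * (#(opened N R₂) - k) * (cost N P D l R₁ + cost N P D l R₂) := by
  obtain ⟨j₀, hj₀, A, C, hAN, hjA, hjC, hC, hCA, hcard, hbound⟩ :=
    exists_threshold hP l k h₁ h₂ hk₁ hk₂
  refine ⟨j₀, (mem_opened.1 hj₀).1, fun R hR => ?_⟩
  have hCo : C ⊆ opened N R₂ := fun j hj => ((hC j).1 hj).1
  have hj₀N := (mem_opened.1 hj₀).1
  have hg := h₁ j₀ hj₀N
  have hsub : opened N R ⊆ (opened N R₂ \ C) ∪ insert (x₁ j₀) A := by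
    intro x hx
    obtain ⟨hxN, hxR⟩ := mem_opened.1 hx
    rcases hR.eq x hxN hxR with ⟨h1, h2, -⟩ | ⟨j, hj, hcl, rfl, -⟩
    · exact mem_union_left _ (mem_sdiff.2 ⟨mem_opened.2 ⟨hxN, h1⟩, fun h => h2 ((hC x).1 h)⟩)
    · exact mem_union_right _ (hCA j ((hC j).2 hcl))
  refine ⟨card_pos.2 ⟨x₁ j₀, mem_opened.2 ⟨hg.lt, ?_⟩⟩, ?_, ?_⟩
  · have := hR.le_new j₀ hj₀N ((hC j₀).1 hjC)
    have := hg.ne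
    omega
  · have h1 := (card_le_card hsub).trans (card_union_le _ _)
    have h2 := card_sdiff_add_card_eq_card hCo
    have h3 := card_insert_le (x₁ j₀) A
    omega
  · have hrad : ∑ x ∈ range N, l * (R x - 1) ≤ ∑ x ∈ range N, l * (R₂ x - 1)
        + ∑ i ∈ insert (x₁ j₀) A, l * ((R₁ i - 1) + maxRad N R₂ x₁ i) := by
      -- A new facility has its old radius plus twice the radius of a closed `j`. One copy is
      -- bounded by `maxRad`; the other is charged to `j` itself, which is missing from the first
      -- summand.
      have hpt : ∀ x ∈ range N, R x - 1 ≤ (if x ∈ opened N R₂ \ C then R₂ x - 1 else 0)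
          + (if x ∈ insert (x₁ j₀) A then (R₁ x - 1) + maxRad N R₂ x₁ x else 0)
          + ∑ j ∈ C.filter (fun j => x₁ j = x), (R₂ j - 1) := by
        intro x hx
        have hxN := mem_range.1 hx
        by_cases hxR : R x = 0
        · omega
        rcases hR.eq x hxN hxR with ⟨h1, h2, h3⟩ | ⟨j, hj, hcl, rfl, h3⟩
        · rw [if_pos (mem_sdiff.2 ⟨mem_opened.2 ⟨hxN, h1⟩, fun h => h2 ((hC x).1 h)⟩), h3]
          omega
        · have hjC := (hC j).2 hcl
          rw [if_pos (hCA j hjC)]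
          have h4 : R₂ j - 1 ≤ maxRad N R₂ x₁ (x₁ j) :=
            le_sup (f := fun j => R₂ j - 1) (mem_filter.2 ⟨hCo hjC, rfl⟩)
          have h5 : R₂ j - 1 ≤ ∑ j' ∈ C.filter (fun j' => x₁ j' = x₁ j), (R₂ j' - 1) :=
            single_le_sum (f := fun j => R₂ j - 1) (fun _ _ => Nat.zero_le _)
              (mem_filter.2 ⟨hjC, rfl⟩)
          have h6 := (h₁ j hj).ne
          omega
      have hoN : opened N R₂ ⊆ range N := filter_subset _ _
      have hsum := sum_le_sum hpt
      rw [sum_add_distrib, sum_add_distrib, sum_ite_mem, sum_ite_mem,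
        inter_eq_right.2 (sdiff_subset.trans hoN),
        inter_eq_right.2 (insert_subset (mem_range.2 hg.lt) hAN),
        sum_fiberwise_of_maps_to (fun j hj => mem_range.2 (h₁ j (mem_opened.1 (hCo hj)).1).lt)]
        at hsum
      have e1 := sum_sdiff (f := fun j => R₂ j - 1) hCo
      have e2 := sum_opened (N := N) R₂ (fun j => R₂ j - 1) (fun x hx => by simp [hx])
      rw [← mul_sum, ← mul_sum, ← mul_sum, ← mul_add]
      exact Nat.mul_le_mul_left _ (by omega)
    have hnear : ∑ p ∈ P, near N D R p
        ≤ ∑ p ∈ P, near N D R₂ p + ∑ j ∈ C, closeCost P x₂ d₁ d₂ j := by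
      have hpt : ∀ p ∈ P, near N D R p ≤ near N D R₂ p + (if x₂ p ∈ C then d₁ p + d₂ p else 0) := by
        intro p hp
        have hpN := mem_range.1 (hP hp)
        have h3 := hR.near_le hD h₁ h₂ hpN
        rw [(h₂ p hpN).near_eq]
        split_ifs with hc
        · exact h3.2
        · exact h3.1 fun h => hc ((hC _).2 h)
      refine (sum_le_sum hpt).trans (le_of_eq ?_)
      rw [sum_add_distrib]
      congr 1
      unfold closeCost
      rw [← sum_filter, sum_fiberwise_eq_sum_filter]
    rw [sum_insert hjA] at hrad
    have hmax : l * maxRad N R₂ x₁ (x₁ j₀) ≤ ∑ x ∈ range N, l * (R₂ x - 1) := by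
      rw [← mul_sum, ← sum_opened (N := N) R₂ (fun j => R₂ j - 1) (fun x hx => by simp [hx])]
      refine Nat.mul_le_mul_left _ (Finset.sup_le fun j hj => ?_)
      exact single_le_sum (f := fun j => R₂ j - 1) (fun _ _ => Nat.zero_le _) (mem_filter.1 hj).1
    have hl : l * (R₁ (x₁ j₀) - 1) ≤ l * r := Nat.mul_le_mul_left _ (by have := hr _ hg.lt; omega)
    have hcost : cost N P D l R ≤ (2 * cost N P D l R₂ + l * r)
        + (∑ i ∈ A, l * ((R₁ i - 1) + maxRad N R₂ x₁ i) + ∑ j ∈ C, closeCost P x₂ d₁ d₂ j) := by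
      rw [mul_add] at hrad
      unfold cost
      omega
    calc _ ≤ (#(opened N R₂) - #(opened N R₁)) * ((2 * cost N P D l R₂ + l * r)
        + (∑ i ∈ A, l * ((R₁ i - 1) + maxRad N R₂ x₁ i) + ∑ j ∈ C, closeCost P x₂ d₁ d₂ j)) :=
          Nat.mul_le_mul_left _ hcost
      _ ≤ _ := by rw [mul_add]; omega

end Clustering

namespace Clustering

open Finset

/-! ### The arithmetic behind the factor 13. -/

/-- If the weight `(k₂ - k) / (k₂ - k₁)` of `C₁` is at least `1/4`, the bound `3 * U` on the
weighted mean gives `C₁ ≤ 12 * U`. Otherwise the coefficients of `C₁` and `C₂` in the bound for `C`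
are at most `10/3` times their weights in the mean, which gives `10 * U`, and `3 * L` makes it `13 *
U`. Errors are carried along. -/
theorem le_or_le_of_combination {k k₁ k₂ y hi lo U E C₁ C₂ C L N : ℕ}
    (h₁ : C₁ + 3 * hi * k₁ ≤ 3 * (U + hi * y) + E)
    (h₂ : C₂ + 3 * lo * k₂ ≤ 3 * (U + lo * y) + E) (hk₁ : k₁ ≤ k) (hk₂ : k < k₂) (hk₂N : k₂ ≤ N)
    (hy : y ≤ k) (hhi : hi ≤ lo + 1) (hL : L ≤ U)
    (hC : (k₂ - k₁) * C ≤ (k₂ - k₁) * (2 * C₂ + 3 * L) + 2 * (k₂ - k) * (C₁ + C₂)) :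
    C₁ ≤ 13 * U + 4 * E + 12 * N ∨ C ≤ 13 * U + 4 * E + 12 * N := by
  obtain ⟨a, rfl⟩ := Nat.exists_eq_add_of_lt hk₂
  obtain ⟨a', rfl⟩ := Nat.exists_eq_add_of_le hk₁
  have e1 : k₁ + a' + a + 1 - k₁ = a' + a + 1 := by omega
  have e2 : k₁ + a' + a + 1 - (k₁ + a') = a + 1 := by omega
  rw [e1, e2] at hC
  have h1' : C₁ ≤ 3 * U + E + 3 * hi * a' := by nlinarith
  have h2' : C₂ + 3 * lo * (a + 1) ≤ 3 * U + E := by nlinarith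
  -- Here `a + 1 = k₂ - k` and `a' = k - k₁`. With these weights the mean number of centers is `k`,
  -- so the multiplier terms cancel up to the difference `hi - lo ≤ 1`, which leaves the last
  -- summand.
  have key : (a + 1) * C₁ + a' * C₂ ≤ (a' + a + 1) * (3 * U + E) + 3 * (a + 1) * a' := by
    have : 3 * hi * a' * (a + 1) ≤ 3 * (lo + 1) * a' * (a + 1) := by gcongr
    nlinarith
  by_cases hc : a' + a + 1 ≤ 4 * (a + 1)
  · left
    have h3 : (a + 1) * C₁ ≤ (a + 1) * (4 * (3 * U + E) + 3 * a') := by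
      have := Nat.mul_le_mul_right (3 * U + E) hc
      nlinarith
    have := Nat.le_of_mul_le_mul_left h3 (by omega)
    omega
  · right
    push Not at hc
    have h3 : 3 * ((a' + a + 1) * C) ≤ 3 * ((a' + a + 1) * (13 * U + 4 * E + 12 * N)) := by
      -- This is where the threshold `1/4` is tight: the inequality amounts to `3 * (a + 1) ≤ a'`.
      have h4 : 3 * (2 * (a' + a + 1) + 2 * (a + 1)) ≤ 10 * a' := by omega
      have h5 := Nat.mul_le_mul_right C₂ h4
      have h6 : (a + 1) * a' ≤ (a' + a + 1) * N := by nlinarith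
      have h7 : (a' + a + 1) * L ≤ (a' + a + 1) * U := Nat.mul_le_mul_left _ hL
      have h8 : 0 ≤ (a + 1) * C₁ := Nat.zero_le _
      have h9 : 0 ≤ (a' + a + 1) * E := Nat.zero_le _
      have h10 : 0 ≤ (a' + a + 1) * N := Nat.zero_le _
      linarith
    have := Nat.le_of_mul_le_mul_left (Nat.le_of_mul_le_mul_left h3 (by omega)) (by omega : 0 < a' + a + 1)
    exact this

/-! #### The growth of the dual solution -/

/-- The value of the dual variable of `p` at time `t`, if the ball `b` is paid for at time `T b`. -/
def dual (N : ℕ) (D : ℕ → ℕ → ℕ) (T : ℕ → ℕ) (t p : ℕ) : ℕ :=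
  (range (N * N)).fold min t fun b => max (T b) (bdist N D p b)

/-- The amount paid for `b` at time `t`. -/
def load (N : ℕ) (P : Finset ℕ) (D : ℕ → ℕ → ℕ) (T : ℕ → ℕ) (t b : ℕ) : ℕ :=
  ∑ p ∈ P, (dual N D T t p - bdist N D p b)

section dual

variable {N : ℕ} {P : Finset ℕ} {D : ℕ → ℕ → ℕ} {T : ℕ → ℕ}

theorem le_dual {t p c : ℕ} : c ≤ dual N D T t p ↔
    c ≤ t ∧ ∀ b < N * N, c ≤ max (T b) (bdist N D p b) := by
  simp [dual, Finset.le_fold_min]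

theorem dual_le {t p c : ℕ} : dual N D T t p ≤ c ↔
    t ≤ c ∨ ∃ b < N * N, max (T b) (bdist N D p b) ≤ c := by
  simp [dual, Finset.fold_min_le]

/-- Up to its freezing time a dual variable equals the current time, so an earlier state is a
truncation of a later one. -/
theorem dual_min {s t : ℕ} (h : s ≤ t) (p : ℕ) :
    dual N D T s p = min s (dual N D T t p) := by
  refine eq_of_forall_le_iff fun c => ?_
  rw [le_min_iff, le_dual, le_dual]
  exact ⟨fun ⟨h1, h2⟩ => ⟨h1, h1.trans h, h2⟩, fun ⟨h1, _, h2⟩ => ⟨h1, h2⟩⟩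

theorem load_mono {s t : ℕ} (h : s ≤ t) (b : ℕ) : load N P D T s b ≤ load N P D T t b :=
  sum_le_sum fun p _ => Nat.sub_le_sub_right (by rw [dual_min h]; exact min_le_right _ _) _

theorem load_succ_le (hP : P ⊆ range N) (t b : ℕ) :
    load N P D T (t + 1) b ≤ load N P D T t b + N := by
  have h1 : load N P D T (t + 1) b ≤ ∑ p ∈ P, (dual N D T t p - bdist N D p b + 1) :=
    sum_le_sum fun p _ => by
      have h2 := dual_min (N := N) (D := D) (T := T) (Nat.le_succ t) p
      have h3 : dual N D T (t + 1) p ≤ t + 1 := (le_dual.1 le_rfl).1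
      have h4 : dual N D T (t + 1) p ≤ dual N D T t p + 1 := by
        rw [h2]; simp only [Nat.succ_eq_add_one]; omega
      omega
  rw [sum_add_distrib, sum_const, smul_eq_mul, mul_one] at h1
  have h5 : #P ≤ N := by simpa using card_le_card hP
  unfold load at *
  omega

/-- No dual variable exceeds `max (T b) (bdist N D p b)`, so a ball receives nothing after the time
at which it was paid. -/
theorem load_eq_of_le {W t b : ℕ} (hb : b < N * N) (hbt : T b ≤ t) (htW : t ≤ W) :
    ∑ p ∈ P, (dual N D T W p - bdist N D p b) = load N P D T t b := by
  refine sum_congr rfl fun p _ => ?_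
  have h1 := (le_dual.1 (le_refl (dual N D T W p))).2 b hb
  rw [dual_min htW]
  omega

/-- Payment times that are at least `t` have no influence on the state at time `t`. In particular
the dummy value `W` of unpaid balls may be lowered to the current time. -/
theorem dual_congr {T' : ℕ → ℕ} {t : ℕ} (h : ∀ b < N * N, T' b = T b ∨ (t ≤ T b ∧ t ≤ T' b))
    (p : ℕ) : dual N D T' t p = dual N D T t p := by
  refine eq_of_forall_le_iff fun c => ?_
  rw [le_dual, le_dual]
  refine and_congr_right fun hc => forall₂_congr fun b hb => ?_
  rcases h b hb with h | h
  · rw [h]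
  · simp only [le_max_iff]; exact ⟨fun _ => Or.inl (hc.trans h.1), fun _ => Or.inl (hc.trans h.2)⟩

theorem load_congr {T' : ℕ → ℕ} {t : ℕ} (h : ∀ b < N * N, T' b = T b ∨ (t ≤ T b ∧ t ≤ T' b))
    (b : ℕ) : load N P D T' t b = load N P D T t b :=
  sum_congr rfl fun p _ => by rw [dual_congr h]

end dual

/-- No unpaid ball is overpaid at time `t`. Unpaid balls have `T b = W`. -/
def FeasibleAt (N : ℕ) (P : Finset ℕ) (D : ℕ → ℕ → ℕ) (Bs : Finset ℕ) (f T : ℕ → ℕ)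
    (W t : ℕ) : Prop :=
  ∀ b ∈ Bs, T b = W → load N P D T t b ≤ f b

/-- The state of the dual solution at time `τ`. -/
structure DualInv (N : ℕ) (P : Finset ℕ) (D : ℕ → ℕ → ℕ) (Bs : Finset ℕ) (f T : ℕ → ℕ)
    (W τ : ℕ) : Prop where
  lt : τ < W
  not_mem : ∀ b < N * N, b ∉ Bs → T b = W
  le : ∀ b ∈ Bs, T b ≠ W → T b ≤ τ
  load_le : ∀ b ∈ Bs, T b ≠ W → load N P D T (T b) b ≤ f b
  le_load : ∀ b ∈ Bs, T b ≠ W → f b ≤ load N P D T (T b) b + N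
  feasible : FeasibleAt N P D Bs f T W τ

/-- The balls that are overpaid at time `τ + 1` are paid for at time `τ`. -/
def Step (N : ℕ) (P : Finset ℕ) (D : ℕ → ℕ → ℕ) (Bs : Finset ℕ) (f T : ℕ → ℕ) (W τ : ℕ)
    (T' : ℕ → ℕ) : Prop :=
  ∀ b < N * N, (b ∈ Bs ∧ T b = W ∧ f b < load N P D T (τ + 1) b → T' b = τ) ∧
    (¬(b ∈ Bs ∧ T b = W ∧ f b < load N P D T (τ + 1) b) → T' b = T b)

section step

variable {N : ℕ} {P : Finset ℕ} {D : ℕ → ℕ → ℕ} {Bs : Finset ℕ} {f T T' : ℕ → ℕ} {W τ τ' : ℕ}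

theorem DualInv.init (hBs : Bs ⊆ range (N * N)) (hW : 0 < W) (hT : ∀ b < N * N, T b = W) :
    DualInv N P D Bs f T W 0 where
  lt := hW
  not_mem b hb _ := hT b hb
  le b hb h := absurd (hT b (mem_range.1 (hBs hb))) h
  load_le b hb h := absurd (hT b (mem_range.1 (hBs hb))) h
  le_load b hb h := absurd (hT b (mem_range.1 (hBs hb))) h
  feasible b _ _ := by
    refine le_trans (le_of_eq (sum_eq_zero fun p _ => ?_)) (Nat.zero_le _)
    have : dual N D T 0 p ≤ 0 := (le_dual.1 le_rfl).1
    omega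

/-- Fixing new payment times at `τ'` does not change any load up to `τ'`. A ball overpaid at `τ' +
1` lacks at most `N` at `τ'`, because each of at most `N` points adds at most 1 per time unit. -/
theorem DualInv.step (h : DualInv N P D Bs f T W τ) (hP : P ⊆ range N) (hBs : Bs ⊆ range (N * N))
    (hτ' : τ' < W) (hf : FeasibleAt N P D Bs f T W τ')
    (hmax : τ' + 1 = W ∨ ¬FeasibleAt N P D Bs f T W (τ' + 1))
    (hT' : Step N P D Bs f T W τ' T') : DualInv N P D Bs f T' W τ' := by
  -- Loads are monotone in time, so feasibility at `τ` would contradict the failure at `τ' + 1` if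
  -- `τ' < τ`.
  have hττ : τ ≤ τ' := by
    rcases hmax with hmax | hmax
    · have := h.lt; omega
    · by_contra hcon
      exact hmax fun b hb hbW => (load_mono (by omega) b).trans (h.feasible b hb hbW)
  have hcongr : ∀ t ≤ τ', ∀ b < N * N, T' b = T b ∨ (t ≤ T b ∧ t ≤ T' b) := by
    intro t ht b hb
    by_cases hc : b ∈ Bs ∧ T b = W ∧ f b < load N P D T (τ' + 1) b
    · right; rw [(hT' b hb).1 hc, hc.2.1]; omega
    · exact Or.inl ((hT' b hb).2 hc)
  have hcase : ∀ b ∈ Bs, T' b ≠ W →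
      (T' b = T b ∧ T b ≠ W) ∨ (T' b = τ' ∧ T b = W ∧ f b < load N P D T (τ' + 1) b) := by
    intro b hb hbW
    have hbN := mem_range.1 (hBs hb)
    by_cases hc : b ∈ Bs ∧ T b = W ∧ f b < load N P D T (τ' + 1) b
    · exact Or.inr ⟨(hT' b hbN).1 hc, hc.2⟩
    · have := (hT' b hbN).2 hc
      exact Or.inl ⟨this, this ▸ hbW⟩
  refine ⟨hτ', fun b hb hbB => ?_, fun b hb hbW => ?_, fun b hb hbW => ?_, fun b hb hbW => ?_,
    fun b hb hbW => ?_⟩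
  · rw [(hT' b hb).2 fun hc => hbB hc.1, h.not_mem b hb hbB]
  · rcases hcase b hb hbW with ⟨h1, h2⟩ | ⟨h1, -, -⟩
    · rw [h1]; exact (h.le b hb h2).trans hττ
    · rw [h1]
  · rcases hcase b hb hbW with ⟨h1, h2⟩ | ⟨h1, h2, -⟩
    · rw [h1, load_congr (hcongr _ ((h.le b hb h2).trans hττ))]; exact h.load_le b hb h2
    · rw [h1, load_congr (hcongr _ le_rfl)]; exact hf b hb h2
  · rcases hcase b hb hbW with ⟨h1, h2⟩ | ⟨h1, h2, h3⟩
    · rw [h1, load_congr (hcongr _ ((h.le b hb h2).trans hττ))]; exact h.le_load b hb h2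
    · rw [h1, load_congr (hcongr _ le_rfl)]
      exact h3.le.trans (load_succ_le hP _ _)
  · rw [load_congr (hcongr _ le_rfl)]
    refine hf b hb ?_
    by_cases hc : b ∈ Bs ∧ T b = W ∧ f b < load N P D T (τ' + 1) b
    · exact hc.2.1
    · rw [← (hT' b (mem_range.1 (hBs hb))).2 hc, hbW]

/-- The number of unpaid balls. -/
def unpaid (Bs : Finset ℕ) (T : ℕ → ℕ) (W : ℕ) : ℕ := #(Bs.filter fun b => T b = W)

/-- This bounds the number of phases: unless no remaining ball is ever overpaid, the maximality of
`τ'` provides a ball that gets paid. -/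
theorem feasible_or_unpaid_lt (hBs : Bs ⊆ range (N * N)) (hτ' : τ' < W)
    (hmax : τ' + 1 = W ∨ ¬FeasibleAt N P D Bs f T W (τ' + 1))
    (hT' : Step N P D Bs f T W τ' T') :
    (FeasibleAt N P D Bs f T W W ∧ FeasibleAt N P D Bs f T' W W)
      ∨ unpaid Bs T' W + 1 ≤ unpaid Bs T W := by
  by_cases hf : FeasibleAt N P D Bs f T W (τ' + 1)
  · have hW : τ' + 1 = W := by tauto
    rw [hW] at hf
    refine Or.inl ⟨hf, fun b hb hbW => ?_⟩
    have heq : ∀ b < N * N, T' b = T b := fun b hb =>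
      (hT' b hb).2 fun hc => absurd (hf b hc.1 hc.2.1) (by rw [← hW]; omega)
    rw [load_congr (fun b hb => Or.inl (heq b hb))]
    exact hf b hb (heq b (mem_range.1 (hBs hb)) ▸ hbW)
  · right
    unfold FeasibleAt at hf
    push Not at hf
    obtain ⟨b, hb, hbW, hlt⟩ := hf
    refine card_lt_card ?_
    rw [ssubset_iff_of_subset]
    · refine ⟨b, mem_filter.2 ⟨hb, hbW⟩, fun h => ?_⟩
      have := (hT' b (mem_range.1 (hBs hb))).1 ⟨hb, hbW, hlt⟩
      have := (mem_filter.1 h).2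
      omega
    · intro c hc
      obtain ⟨h1, h2⟩ := mem_filter.1 hc
      refine mem_filter.2 ⟨h1, ?_⟩
      by_contra hcon
      rw [(hT' c (mem_range.1 (hBs h1))).2 fun h => hcon h.2.1] at h2
      exact hcon h2

theorem feasible_of_unpaid (h : unpaid Bs T W = 0) (t : ℕ) : FeasibleAt N P D Bs f T W t :=
  fun b hb hbW => by
    have : b ∈ Bs.filter fun b => T b = W := mem_filter.2 ⟨hb, hbW⟩
    rw [card_eq_zero.1 h] at this
    simp at this

theorem feasibleAt_stable (hBs : Bs ⊆ range (N * N)) (hτ' : τ' < W)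
    (hf : FeasibleAt N P D Bs f T W W) (hT' : Step N P D Bs f T W τ' T') :
    FeasibleAt N P D Bs f T' W W := by
  have heq : ∀ b < N * N, T' b = T b := fun b hb =>
    (hT' b hb).2 fun hc => absurd ((load_mono (by omega) b).trans (hf b hc.1 hc.2.1)) (not_le.2 hc.2.2)
  intro b hb hbW
  rw [load_congr (fun b hb => Or.inl (heq b hb))]
  exact hf b hb (heq b (mem_range.1 (hBs hb)) ▸ hbW)

end step

/-! #### The selection of balls -/

/-- A paid ball that can be added to the selection. -/
def Eligible (N : ℕ) (P : Finset ℕ) (D : ℕ → ℕ → ℕ) (paid : Finset ℕ) (A : ℕ → ℕ)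
    (sel : Finset ℕ) (b : ℕ) : Prop :=
  b ∈ paid ∧ b ∉ sel ∧ ∀ b' ∈ sel, ¬Conflict N P D A b b'

structure SelInv (N : ℕ) (P : Finset ℕ) (D : ℕ → ℕ → ℕ) (paid : Finset ℕ) (A : ℕ → ℕ)
    (sel : Finset ℕ) : Prop where
  subset : sel ⊆ paid
  indep : ∀ b ∈ sel, ∀ b' ∈ sel, b ≠ b' → ¬Conflict N P D A b b'
  dominated : ∀ b ∈ paid, ¬Eligible N P D paid A sel b →
    ∃ b' ∈ sel, brad N D b ≤ brad N D b' ∧ (b' = b ∨ Conflict N P D A b b')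

theorem Conflict.symm {N : ℕ} {P : Finset ℕ} {D : ℕ → ℕ → ℕ} {A : ℕ → ℕ} {b b' : ℕ}
    (h : Conflict N P D A b b') : Conflict N P D A b' b := by
  obtain ⟨p, hp, h1, h2⟩ := h
  exact ⟨p, hp, h2, h1⟩

section select

variable {N : ℕ} {P : Finset ℕ} {D : ℕ → ℕ → ℕ} {paid sel : Finset ℕ} {A : ℕ → ℕ}

theorem SelInv.init : SelInv N P D paid A ∅ :=
  ⟨empty_subset _, by simp, fun b hb h => absurd ⟨hb, by simp, by simp⟩ h⟩

/-- A ball that loses its eligibility is `c` itself or conflicts with `c`, and the choice of `c`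
makes its radius at most that of `c`. -/
theorem SelInv.insert (h : SelInv N P D paid A sel) {c : ℕ} (hc : Eligible N P D paid A sel c)
    (hmax : ∀ b, Eligible N P D paid A sel b → brad N D b ≤ brad N D c) :
    SelInv N P D paid A (insert c sel) := by
  refine ⟨insert_subset hc.1 h.subset, fun b hb b' hb' hne => ?_, fun b hb hbe => ?_⟩
  · rcases mem_insert.1 hb with hbc | hbs <;> rcases mem_insert.1 hb' with hbc' | hbs'
    · exact absurd (hbc.trans hbc'.symm) hne
    · exact hbc ▸ hc.2.2 b' hbs'
    · exact fun hcon => hc.2.2 b hbs (hbc' ▸ hcon.symm)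
    · exact h.indep b hbs b' hbs' hne
  · by_cases he : Eligible N P D paid A sel b
    · refine ⟨c, mem_insert_self _ _, hmax b he, ?_⟩
      by_contra hcon
      push Not at hcon
      refine hbe ⟨hb, ?_, fun b' hb' => ?_⟩
      · rw [mem_insert]; push Not; exact ⟨fun h => hcon.1 h.symm, he.2.1⟩
      · rcases mem_insert.1 hb' with rfl | hb'
        · exact hcon.2
        · exact he.2.2 b' hb'
    · obtain ⟨b', hb', h'⟩ := h.dominated b hb he
      exact ⟨b', mem_insert_of_mem hb', h'⟩

end select

/-- If `W` exceeds all prices and distances, growth stops before `W`: every point is frozen by a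
paid ball, and each paid ball is selected or dominated by a selected one. -/
theorem primalDual_of_inv {N : ℕ} {P : Finset ℕ} {D : ℕ → ℕ → ℕ} {Bs : Finset ℕ}
    {l lam W τ : ℕ} {T : ℕ → ℕ} {sel : Finset ℕ} (hBs : Bs ⊆ range (N * N)) (hne : Bs.Nonempty)
    (hW : ∀ b ∈ Bs, ∀ p ∈ P, lam + l * brad N D b + bdist N D p b < W)
    (hWd : ∀ b < N * N, ∀ p ∈ P, bdist N D p b < W)
    (hT : DualInv N P D Bs (fun b => lam + l * brad N D b) T W τ)
    (hf : FeasibleAt N P D Bs (fun b => lam + l * brad N D b) T W W)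
    (hsel : SelInv N P D (Bs.filter fun b => T b ≠ W) (dual N D T W) sel)
    (hall : ∀ b, ¬Eligible N P D (Bs.filter fun b => T b ≠ W) (dual N D T W) sel b) :
    PrimalDual N P D l lam Bs T (dual N D T W) sel := by
  -- A point still growing at time `W` has reached every ball but no paid one. It alone would
  -- overpay an unpaid ball, against feasibility.
  have hlt : ∀ p ∈ P, dual N D T W p < W := by
    intro p hp
    by_contra hcon
    push Not at hcon
    obtain ⟨b, hb⟩ := hne
    have hbN := mem_range.1 (hBs hb)
    have h1 := (le_dual.1 hcon).2 b hbN
    have h2 := hWd b hbN p hp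
    have h3 : T b = W := by
      by_contra hne
      have := hT.le b hb hne
      have := hT.lt
      omega
    have h4 := hf b hb h3
    have h5 : dual N D T W p - bdist N D p b ≤ load N P D T W b :=
      single_le_sum (f := fun p => dual N D T W p - bdist N D p b) (fun _ _ => Nat.zero_le _) hp
    have h6 := hW b hb p hp
    simp only at h4
    omega
  have hle : ∀ b ∈ Bs, T b ≤ W := fun b hb => by
    by_cases h : T b = W
    · exact h.le
    · have := hT.le b hb h; have := hT.lt; omega
  refine ⟨hsel.subset.trans (filter_subset _ _), fun b hb => ?_, fun b hb => ?_, hsel.indep,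
    fun b hb p hp hlt' => ?_, fun p hp => ?_⟩
  · by_cases h : T b = W
    · exact hf b hb h
    · rw [load_eq_of_le (mem_range.1 (hBs hb)) le_rfl (hle b hb)]
      exact hT.load_le b hb h
  · obtain ⟨hb1, hb2⟩ := mem_filter.1 (hsel.subset hb)
    rw [load_eq_of_le (mem_range.1 (hBs hb1)) le_rfl (hle b hb1)]
    exact hT.le_load b hb1 hb2
  · have := (le_dual.1 (le_refl (dual N D T W p))).2 b (mem_range.1 (hBs hb))
    omega
  · obtain h | ⟨b, hb, hmax⟩ := dual_le.1 (le_refl (dual N D T W p))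
    · exact absurd (hlt p hp) (not_lt.2 h)
    · have h1 := hlt p hp
      have hbW : T b ≠ W := by have := le_max_left (T b) (bdist N D p b); omega
      have hbB : b ∈ Bs := by
        by_contra hcon
        exact hbW (hT.not_mem b hb hcon)
      exact ⟨b, hbB, (le_max_left _ _).trans hmax, (le_max_right _ _).trans hmax,
        hsel.dominated b (mem_filter.2 ⟨hbB, hbW⟩) (hall b)⟩

end Clustering

namespace ArrayLang

/-! ### Evaluation of folds, and frame properties. -/

open RAM Finset

theorem iter_inv {α : Type*} {n : ℕ} {f : ℕ → α → α} {x : α} (I : ℕ → α → Prop) (h0 : I 0 x)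
    (h : ∀ i < n, ∀ y, I i y → I (i + 1) (f i y)) : I n (iter n f x) := by
  induction n with
  | zero => exact h0
  | succ n ih => exact h n (by omega) _ (ih fun i hi => h i (by omega))

theorem eval_sum (d : Range) (v : ℕ) (e : E) (ρ : ℕ → ℕ) (m : Mem) :
    (E.fold .sum d v (.num 0) e).eval ρ m
      = ∑ i ∈ range (d.val m), e.eval (Function.update ρ v i) m := by
  simp only [E.eval, Fold.eval]
  induction d.val m with
  | zero => simp
  | succ n ih => rw [iter_succ, ih, sum_range_succ]

theorem eval_min (d : Range) (v : ℕ) (x e : E) (ρ : ℕ → ℕ) (m : Mem) :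
    (E.fold .min d v x e).eval ρ m
      = (range (d.val m)).fold min (x.eval ρ m) fun i => e.eval (Function.update ρ v i) m := by
  simp only [E.eval, Fold.eval]
  induction d.val m with
  | zero => simp
  | succ n ih =>
    rw [iter_succ, ih, range_add_one, fold_insert (by simp)]
    omega

theorem eval_max (d : Range) (v : ℕ) (x e : E) (ρ : ℕ → ℕ) (m : Mem) :
    (E.fold .max d v x e).eval ρ m
      = (range (d.val m)).fold max (x.eval ρ m) fun i => e.eval (Function.update ρ v i) m := by
  simp only [E.eval, Fold.eval]
  induction d.val m with
  | zero => simp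
  | succ n ih =>
    rw [iter_succ, ih, range_add_one, fold_insert (by simp)]
    omega

/-- Whether the value of the expression may depend on the array `a`. -/
def E.reads (a : ℕ) : E → Bool
  | .num _ => false
  | .var _ => false
  | .get a' i => a == a' || i.reads a
  | .add x y => x.reads a || y.reads a
  | .sub x y => x.reads a || y.reads a
  | .div x y => x.reads a || y.reads a
  | .mul x a' i => a == a' || x.reads a || i.reads a
  | .ite c x y => c.reads a || x.reads a || y.reads a
  | .fold _ _ _ x e => a == 0 || x.reads a || e.reads a

theorem Range.val_congr {m m' : Mem} (h : m 0 = m' 0) (d : Range) : d.val m = d.val m' := by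
  cases d <;> simp [Range.val, h]

theorem E.eval_congr {e : E} {m m' : Mem} (h : ∀ a, e.reads a → m a = m' a) (ρ : ℕ → ℕ) :
    e.eval ρ m = e.eval ρ m' := by
  induction e generalizing ρ with
  | num n => rfl
  | var v => rfl
  | get a i ih =>
    simp only [E.eval]
    rw [h a (by simp [E.reads]), ih fun b hb => h b (by simp [E.reads, hb])]
  | add x y ihx ihy | sub x y ihx ihy | div x y ihx ihy =>
    simp only [E.eval]
    rw [ihx fun b hb => h b (by simp [E.reads, hb]), ihy fun b hb => h b (by simp [E.reads, hb])]
  | mul x a y ihx ihy =>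
    simp only [E.eval]
    rw [h a (by simp [E.reads]), ihx fun b hb => h b (by simp [E.reads, hb]),
      ihy fun b hb => h b (by simp [E.reads, hb])]
  | ite c x y ihc ihx ihy =>
    simp only [E.eval]
    rw [ihc fun b hb => h b (by simp [E.reads, hb]), ihx fun b hb => h b (by simp [E.reads, hb]),
      ihy fun b hb => h b (by simp [E.reads, hb])]
  | fold k d v x e ihx ihe =>
    simp only [E.eval]
    rw [ihx fun b hb => h b (by simp [E.reads, hb]),
      Range.val_congr (h 0 (by simp [E.reads]))]
    congr 1
    funext i acc
    rw [ihe fun b hb => h b (by simp [E.reads, hb])]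

/-- Whether the statement may change the array `a`. -/
def S.writes (a : ℕ) : S → Bool
  | .skip => false
  | .set a' _ _ => a == a'
  | .seq c d => c.writes a || d.writes a
  | .ite _ c d => c.writes a || d.writes a
  | .rep _ _ c => c.writes a
  | .bits _ _ c => c.writes a

theorem S.run_frame {p : S} {a : ℕ} (h : p.writes a = false) (ρ : ℕ → ℕ) (m : Mem) :
    p.run ρ m a = m a := by
  induction p generalizing ρ m with
  | skip => rfl
  | set a' i e => exact store_array _ _ _ (by simpa [S.writes] using h)
  | seq c d ihc ihd =>
    simp only [S.writes, Bool.or_eq_false_iff] at h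
    simp only [S.run, ihd h.2, ihc h.1]
  | ite e c d ihc ihd =>
    simp only [S.writes, Bool.or_eq_false_iff] at h
    simp only [S.run]
    split_ifs
    · exact ihc h.1 _ _
    · exact ihd h.2 _ _
  | rep d v c ih =>
    exact iter_inv (fun _ (m' : Mem) => m' a = m a) rfl fun i _ m' hm' => (ih h _ _).trans hm'
  | bits b v c ih =>
    exact iter_inv (fun _ (m' : Mem) => m' a = m a) rfl fun i _ m' hm' => (ih h _ _).trans hm'

/-- Fill the cells below `d` of the array `a` with the values of `e`. -/
def fill (d : Range) (a v : ℕ) (e : E) : S := .rep d v (.set a (.var v) e)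

/-- As `e` does not read `a`, the cells already overwritten do not affect the later values. -/
theorem run_fill {d : Range} {a v : ℕ} {e : E} (he : e.reads a = false) (ρ : ℕ → ℕ) (m : Mem) :
    (fill d a v e).run ρ m = Function.update m a
      (fun i => if i < d.val m then e.eval (Function.update ρ v i) m else m a i) := by
  refine iter_inv (fun n m' => m' = Function.update m a
      (fun i => if i < n then e.eval (Function.update ρ v i) m else m a i)) ?_ ?_
  · simp
  · rintro i - _ rfl
    simp only [S.run, E.eval, Function.update_self, store, Function.update_idem]
    rw [E.eval_congr (m' := m)]
    · congr 1
      funext j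
      by_cases hj : j = i
      · subst hj; simp
      · rw [Function.update_of_ne hj]
        have : j < i + 1 ↔ j < i := by omega
        simp only [this]
    · intro b hb
      rw [Function.update_of_ne]
      rintro rfl; simp [he] at hb

theorem run_seq (c d : S) (ρ : ℕ → ℕ) (m : Mem) : (S.seq c d).run ρ m = d.run ρ (c.run ρ m) := rfl

theorem run_set (a : ℕ) (i e : E) (ρ : ℕ → ℕ) (m : Mem) :
    (S.set a i e).run ρ m = store m a (i.eval ρ m) (e.eval ρ m) := rfl

theorem run_ite (e : E) (c d : S) (ρ : ℕ → ℕ) (m : Mem) :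
    (S.ite e c d).run ρ m = if e.eval ρ m ≠ 0 then c.run ρ m else d.run ρ m := rfl

/-- Composition of a list of statements. -/
def block : List S → S
  | [] => .skip
  | [c] => c
  | c :: l => .seq c (block l)

end ArrayLang

namespace Clustering

open ArrayLang Finset

/-! #### The program -/

/-- The cell `0` of the array `a`. -/
abbrev cell (a : ℕ) : E := .get a (.num 0)

/-- The cell of the array `a` whose number is the value of the variable `v`. -/
abbrev at' (a v : ℕ) : E := .get a (.var v)

abbrev setCell (a : ℕ) (e : E) : S := .set a (.num 0) e

/-- The entry of the array `8` for two numbers below `N`. -/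
abbrev distE (u v : E) : E := .get 8 (.add (.mul u 0 (.num 0)) v)

/-- The sum over the points. -/
def sumPts (v : ℕ) (e : E) : E := .fold .sum .n v (.num 0) (.ite (at' 1 v) e (.num 0))

/-- The distance from `p` to the ball `b`. -/
def bdistE (p b : E) : E :=
  .sub (.get 8 (.add (.mul p 0 (.num 0)) (.div b (cell 0)))) (.get 8 b)

def maxE (x y : E) : E := .add x (.sub y x)

def eqE (x y : E) : E := .ite (.sub x y) (.num 0) (.ite (.sub y x) (.num 0) (.num 1))

/-- The dual variable of `p` at time `t`; array `20` holds the times at which the balls are paid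
for. -/
def dualE (t p : E) : E := .fold .min .nn 1 t (maxE (at' 20 1) (bdistE p (.var 1)))

/-- Sets `26 b` to the amount by which the unpaid ball `b` is overpaid at the time in array `24`. -/
def overS : S := block
  [fill .n 25 0 (dualE (cell 24) (.var 0)),
   fill .nn 26 1 (.ite (.ite (.get 2 (.div (.var 1) (cell 0)))
       (.sub (.add (cell 13) (.num 1)) (at' 8 1)) (.num 0))
     (.ite (.sub (cell 10) (at' 20 1)) (.num 0)
       (.sub (sumPts 0 (.sub (at' 25 0) (bdistE (.var 0) (.var 1))))
         (.add (cell 18) (.mul (at' 8 1) 0 (.num 2))))) (.num 0))]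

/-- One step of a binary search for the last feasible time. -/
def searchS : S := block
  [setCell 24 (.div (.add (cell 22) (cell 23)) (.num 2)), overS,
   .ite (.fold .sum .nn 1 (.num 0) (at' 26 1)) (setCell 23 (cell 24)) (setCell 22 (cell 24))]

/-- Times have polynomially many bits but may be exponentially large, hence the binary search; array
`22` ends up with the last feasible time. The new payment times pass through array `21` because
`fill` must not read the array it writes. -/
def phaseS : S := block
  [setCell 22 (.num 0), setCell 23 (cell 10), .bits 10 51 searchS,
   setCell 24 (.add (cell 22) (.num 1)), overS,
   fill .nn 21 1 (.ite (at' 26 1) (cell 22) (at' 20 1)), fill .nn 20 1 (at' 21 1)]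

/-- The growth of the dual solution for the multiplier in array `18`. -/
def dualS : S := block [fill .nn 20 1 (cell 10), .rep .nn 50 phaseS]

def conflictE : E := sumPts 0
  (.ite (.sub (at' 25 0) (bdistE (.var 0) (.var 1)))
    (.ite (.sub (at' 25 0) (bdistE (.var 0) (.var 2))) (.num 1) (.num 0)) (.num 0))

def eligibleE : E := .ite (.sub (cell 10) (at' 20 1))
  (.ite (at' 27 1) (.num 0)
    (.ite (.fold .sum .nn 2 (.num 0) (.ite (at' 27 2) conflictE (.num 0))) (.num 0) (.num 1)))
  (.num 0)

/-- Array `29` holds the largest eligible radius plus 1, so that `0` means that nothing is eligible;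
array `30` holds the first ball attaining it, with `N * N` in the role of infinity. -/
def pickS : S := block
  [fill .nn 28 1 eligibleE,
   setCell 29 (.fold .max .nn 1 (.num 0) (.ite (at' 28 1) (.add (at' 8 1) (.num 1)) (.num 0))),
   .ite (cell 29) (block
     [setCell 30 (.fold .min .nn 1 (.mul (cell 0) 0 (.num 0))
       (.ite (at' 28 1) (.ite (.sub (cell 29) (.add (at' 8 1) (.num 1)))
         (.mul (cell 0) 0 (.num 0)) (.var 1)) (.mul (cell 0) 0 (.num 0)))),
      .set 27 (cell 30) (.num 1)]) .skip]

/-- The selection of balls, and the resulting solution in array `19`. -/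
def selectS : S := block
  [fill .n 25 0 (dualE (cell 10) (.var 0)), fill .nn 27 1 (.num 0), .rep .nn 50 pickS,
   fill .n 19 0 (.fold .max .n 1 (.num 0)
     (.ite (.get 27 (.add (.mul (.var 0) 0 (.num 0)) (.var 1)))
       (.add (.add (distE (.var 0) (.var 1)) (distE (.var 0) (.var 1)))
         (.add (distE (.var 0) (.var 1)) (.num 1))) (.num 0)))]

/-- The distance from the point in variable `0` to the ball of the solution `a` with the center in
variable `1`. -/
def openDistE (a : ℕ) : E := .sub (distE (.var 0) (.var 1)) (.sub (at' a 1) (.num 1))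

def nearE (a : ℕ) : E :=
  .fold .min .n 1 (cell 10) (.ite (at' a 1) (openDistE a) (cell 10))

/-- The number of the nearest ball; array `a'` holds the distance to it. -/
def nearestE (a a' : ℕ) : E :=
  .fold .min .n 1 (cell 0) (.ite (at' a 1) (.ite (.sub (openDistE a) (at' a' 0)) (cell 0) (.var 1))
    (cell 0))

def saveS : S := block [setCell 12 (.add (cell 32) (.num 1)), fill .n 11 0 (at' 19 0)]

/-- Stores the solution in array `19` in array `11` if it is better than the one there; array `12`
holds the cost plus `1`. -/
def considerS : S := block
  [fill .n 31 0 (nearE 19),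
   setCell 32 (.add (.fold .sum .n 1 (.num 0) (.mul (.sub (at' 19 1) (.num 1)) 0 (.num 2)))
     (sumPts 0 (at' 31 0))),
   setCell 29 (.fold .sum .n 1 (.num 0) (.ite (at' 19 1) (.num 1) (.num 0))),
   .ite (.fold .sum .n 1 (.num 0) (.ite (at' 19 1) (.ite (at' 2 1) (.num 0) (.num 1)) (.num 0)))
     .skip
     (.ite (cell 29) (.ite (.sub (.add (.get 0 (.num 1)) (.num 1)) (cell 29))
       (.ite (cell 12) (.ite (.sub (cell 12) (.add (cell 32) (.num 1))) saveS .skip) saveS)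
       .skip) .skip)]

/-- One step of the binary search for the multiplier. -/
def bisectS : S := block
  [setCell 18 (.div (.add (cell 14) (cell 15)) (.num 2)), dualS, selectS, considerS,
   .ite (.sub (.add (.get 0 (.num 1)) (.num 1)) (cell 29))
     (block [setCell 15 (cell 18), fill .n 16 0 (at' 19 0)])
     (block [setCell 14 (cell 18), fill .n 17 0 (at' 19 0)])]

/-- The product of the value of `x` and of the minimum of `N` and the value of `y`. -/
def prodE (x y : E) : E := .fold .sum .n 1 (.num 0) (.ite (.sub y (.var 1)) x (.num 0))

def savingE (i : E) : E := .sub (.get 38 i) (.num 1)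

/-- Ratios are compared by cross-multiplication. The second factor of each product is a saving,
hence at most `N`, so `prodE` is exact. -/
def beforeE (i g : E) : E :=
  .ite (.sub (prodE (.get 39 g) (savingE i)) (prodE (.get 39 i) (savingE g))) (.num 1)
    (.ite (eqE (prodE (.get 39 i) (savingE g)) (prodE (.get 39 g) (savingE i))) (.sub g i) (.num 0))

def closedE : E := .ite (at' 17 0)
  (.ite (.ite (savingE (at' 33 0)) (beforeE (at' 33 0) (cell 41)) (.num 0)) (.num 1)
    (.ite (eqE (at' 33 0) (cell 41))
      (.ite (.sub (at' 37 53) (at' 37 0)) (.num 1)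
        (.ite (eqE (at' 37 0) (at' 37 53)) (.ite (.sub (.var 0) (.var 53)) (.num 0) (.num 1))
          (.num 0))) (.num 0))) (.num 0)

/-- The array `19` after the facilities in array `40` have been closed. -/
def mergedS : S := fill .n 19 0 (.fold .max .n 1
  (.ite (at' 17 0) (.ite (at' 40 0) (.num 0) (at' 17 0)) (.num 0))
  (.ite (at' 40 1) (.ite (eqE (at' 33 1) (.var 0))
    (.add (at' 16 0) (.add (.sub (at' 17 1) (.num 1)) (.sub (at' 17 1) (.num 1)))) (.num 0))
    (.num 0)))

def mergeStepS : S := block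
  [setCell 41 (at' 33 53), fill .n 40 0 closedE, mergedS, considerS]

/-- The precomputation for combining the solutions in arrays `16` and `17`. -/
def prepareS : S := block
  [fill .n 34 0 (nearE 16), fill .n 33 0 (nearestE 16 34),
   fill .n 36 0 (nearE 17), fill .n 35 0 (nearestE 17 36),
   fill .n 37 0 (sumPts 1 (.ite (eqE (at' 35 1) (.var 0)) (.add (at' 34 1) (at' 36 1)) (.num 0))),
   fill .n 38 0 (.fold .sum .n 1 (.num 0) (.ite (at' 17 1) (eqE (at' 33 1) (.var 0)) (.num 0))),
   fill .n 39 0 (.add (.mul (.add (.sub (at' 16 0) (.num 1)) (.fold .max .n 1 (.num 0)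
       (.ite (at' 17 1) (.ite (eqE (at' 33 1) (.var 0)) (.sub (at' 17 1) (.num 1)) (.num 0))
         (.num 0)))) 0 (.num 2))
     (.fold .sum .n 1 (.num 0) (.ite (at' 17 1) (.ite (eqE (at' 33 1) (.var 0)) (at' 37 1) (.num 0))
         (.num 0))))]

/-- The search for the largest radius given by the variable `54`. -/
def guessS : S := block
  [setCell 13 (at' 8 54), setCell 14 (.num 0), setCell 15 (cell 9), .bits 9 52 bisectS,
   prepareS, .rep .n 53 mergeStepS]

/-- The radius and, inside `guessS`, the threshold facility are found by exhaustive search. Array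
`13` holds the guessed radius; `14`, `15`, `18` the lower, upper and current multiplier; `16` and
`17` the solutions for the upper and the lower one; `19` the current candidate; `11` and `12` the
best solution and its cost plus 1; `33` to `39` the data for merging. -/
def mainS : S := block
  [setCell 12 (.num 0), .rep .nn 54 guessS,
   fill .n 5 0 (.ite (at' 11 0) (.num 1) (.num 0)),
   fill .n 31 0 (nearE 11), fill .n 6 0 (nearestE 11 31)]

/-- The computation of integral distances in array `8`, and of upper bounds for the multiplier and
for the time in arrays `9` and `10`. -/
def setupS : S := block
  [setCell 7 (.num 100), .rep .nn 0 (setCell 7 (.mul (cell 7) 4 (.var 0))),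
   fill .nn 8 0 (.mul (.mul (.mul (.div (.mul (cell 7) 3 (.var 0)) (at' 4 0))
     0 (.num 0)) 0 (.num 0)) 0 (.num 0)),
   setCell 42 (.fold .sum .nn 0 (.num 0) (at' 8 0)),
   setCell 9 (.add (.mul (.add (cell 42) (.num 1)) 0 (.num 0)) (.num 2)),
   setCell 10 (.add (.add (cell 9) (.mul (cell 42) 0 (.num 2))) (.add (cell 42) (.num 1)))]

/-- The arrays that are read-only in `setupS`. -/
def roInput (a : ℕ) : Bool := decide (a < 5)

/-- The arrays that are read-only in `mainS`. -/
def roSetup (a : ℕ) : Bool := decide (a < 5) || (decide (7 ≤ a) && decide (a < 11))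

/-- Well-formedness is a Boolean computation. A separate set of read-only arrays is needed for
`mainS`, since its binary searches run over the bits of the bounds computed by `setupS`. -/
theorem setupS_wf : setupS.wf roInput [] = true := rfl

theorem mainS_wf : mainS.wf roSetup [] = true := rfl

end Clustering

namespace ArrayLang

open RAM

theorem S.writes_of_wf {ro : ℕ → Bool} {p : S} {sc : List ℕ} (h : p.wf ro sc) {a : ℕ}
    (ha : ro a) : p.writes a = false := by
  induction p generalizing sc with
  | skip => rfl
  | set a' i e =>
    simp only [S.wf, Bool.and_eq_true, Bool.not_eq_true'] at h
    have : a ≠ a' := by rintro rfl; simp [ha] at h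
    simpa [S.writes] using this
  | seq c d ihc ihd =>
    simp only [S.wf, Bool.and_eq_true] at h
    simp [S.writes, ihc h.1, ihd h.2]
  | ite e c d ihc ihd =>
    simp only [S.wf, Bool.and_eq_true] at h
    simp [S.writes, ihc h.1.2, ihd h.2]
  | rep d v c ih =>
    simp only [S.wf, Bool.and_eq_true] at h
    exact ih h.2
  | bits b v c ih =>
    simp only [S.wf, Bool.and_eq_true] at h
    exact ih h.2

theorem fill_apply {d : Range} {a v : ℕ} {e : E} (he : e.reads a = false) (ρ : ℕ → ℕ) {m : Mem}
    {i : ℕ} (hi : i < d.val m) :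
    (fill d a v e).run ρ m a i = e.eval (Function.update ρ v i) m := by
  rw [run_fill he, Function.update_self, if_pos hi]

theorem set_apply (a : ℕ) (e : E) (ρ : ℕ → ℕ) (m : Mem) :
    (S.set a (.num 0) e).run ρ m a 0 = e.eval ρ m := store_same _ _ _ _

end ArrayLang

namespace Clustering

/-! ### The program for the growth of the dual solution. -/

open ArrayLang Finset RAM

/-- The arrays that are read-only in the main part of the program agree with those of `μ`. -/
def Base (μ m : Mem) : Prop := ∀ a, roSetup a → m a = μ a

theorem Base.run {μ m : Mem} (h : Base μ m) {p : S} {sc : List ℕ} (hp : p.wf roSetup sc)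
    (ρ : ℕ → ℕ) : Base μ (p.run ρ m) := fun a ha => by
  rw [S.run_frame (S.writes_of_wf hp ha), h a ha]

abbrev pts (μ : Mem) : Finset ℕ := (range (μ 0 0)).filter fun p => μ 1 p ≠ 0

abbrev dst (μ : Mem) (u v : ℕ) : ℕ := μ 8 (u * μ 0 0 + v)

/-- The balls with centers in `F` and radius at most `r`. -/
def balls (μ : Mem) (r : ℕ) : Finset ℕ :=
  (range (μ 0 0 * μ 0 0)).filter fun b => μ 2 (b / μ 0 0) ≠ 0 ∧ μ 8 b ≤ r

theorem brad_dst (μ : Mem) (b : ℕ) : brad (μ 0 0) (dst μ) b = μ 8 b := by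
  unfold brad dst; rw [Nat.div_add_mod']

theorem bdist_dst (μ : Mem) (p b : ℕ) :
    bdist (μ 0 0) (dst μ) p b = μ 8 (p * μ 0 0 + b / μ 0 0) - μ 8 b := by
  unfold bdist dst; rw [Nat.div_add_mod']

section eval

variable {μ m : Mem} (hm : Base μ m)
include hm

theorem Base.n : m 0 = μ 0 := hm 0 rfl

theorem Base.val_n : Range.n.val m = μ 0 0 := by simp [Range.val, hm.n]

theorem Base.val_nn : Range.nn.val m = μ 0 0 * μ 0 0 := by simp [Range.val, hm.n]

theorem eval_bdistE (p b : E) (ρ : ℕ → ℕ) :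
    (bdistE p b).eval ρ m = bdist (μ 0 0) (dst μ) (p.eval ρ m) (b.eval ρ m) := by
  rw [bdist_dst]
  simp only [bdistE, E.eval, hm.n, hm 8 rfl]

theorem eval_sumPts (v : ℕ) (e : E) (ρ : ℕ → ℕ) :
    (sumPts v e).eval ρ m = ∑ p ∈ pts μ, e.eval (Function.update ρ v p) m := by
  unfold sumPts
  rw [eval_sum, sum_filter, hm.val_n]
  simp only [E.eval, hm 1 rfl, Function.update_self]

theorem eval_dualE (t : E) {p : E} {ρ : ℕ → ℕ}
    (hp : ∀ i, p.eval (Function.update ρ 1 i) m = p.eval ρ m) :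
    (dualE t p).eval ρ m = dual (μ 0 0) (dst μ) (m 20) (t.eval ρ m) (p.eval ρ m) := by
  unfold dualE dual
  rw [eval_min, hm.val_nn]
  refine fold_congr fun b _ => ?_
  simp only [maxE, E.eval, eval_bdistE hm, hp, Function.update_self]
  omega

end eval

/-- The cost of opening a ball, including the multiplier. -/
abbrev price (μ : Mem) (lam b : ℕ) : ℕ := lam + μ 0 2 * brad (μ 0 0) (dst μ) b

theorem overS_ne_zero {μ m : Mem} (hm : Base μ m) (ρ : ℕ → ℕ) {b : ℕ} (hb : b < μ 0 0 * μ 0 0) :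
    overS.run ρ m 26 b ≠ 0 ↔ b ∈ balls μ (m 13 0) ∧ μ 10 0 ≤ m 20 b ∧
      price μ (m 18 0) b < load (μ 0 0) (pts μ) (dst μ) (m 20) (m 24 0) b := by
  simp only [overS, block, run_seq]
  set m1 := (fill .n 25 0 (dualE (cell 24) (.var 0))).run ρ m with hm1
  have hb1 : Base μ m1 := hm.run (sc := []) rfl ρ
  have h25 : ∀ p < μ 0 0, m1 25 p = dual (μ 0 0) (dst μ) (m 20) (m 24 0) p := by
    intro p hp
    rw [hm1, fill_apply rfl _ (by rwa [hm.val_n]), eval_dualE hm _ (fun i => by simp [E.eval])]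
    simp [E.eval]
  have f13 : m1 13 = m 13 := S.run_frame rfl _ _
  have f18 : m1 18 = m 18 := S.run_frame rfl _ _
  have f20 : m1 20 = m 20 := S.run_frame rfl _ _
  rw [fill_apply rfl _ (by rwa [hb1.val_nn])]
  have hload : load (μ 0 0) (pts μ) (dst μ) (m 20) (m 24 0) b
      = ∑ p ∈ pts μ, (m1 25 p - bdist (μ 0 0) (dst μ) p b) :=
    sum_congr rfl fun p hp => by rw [h25 p (mem_range.1 (mem_filter.1 hp).1)]
  rw [hload, price, brad_dst, mul_comm (μ 0 2)]
  have hmem : b ∈ balls μ (m 13 0) ↔ μ 2 (b / μ 0 0) ≠ 0 ∧ μ 8 b ≤ m 13 0 := by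
    simp [balls, hb]
  rw [hmem]
  simp only [E.eval, eval_sumPts hb1, eval_bdistE hb1, Function.update_self, hb1.n, hb1 2 rfl,
    hb1 8 rfl, hb1 10 rfl, f13, f18, f20, Function.update_of_ne (show (1 : ℕ) ≠ 0 by decide)]
  split_ifs <;> omega

theorem half_le {lo hi j : ℕ} (h : lo < hi) (h2 : hi - lo ≤ 2 ^ (j + 1)) :
    lo ≤ (lo + hi) / 2 ∧ (lo + hi) / 2 < hi ∧ (lo + hi) / 2 - lo ≤ 2 ^ j ∧
      hi - (lo + hi) / 2 ≤ 2 ^ j := by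
  rw [pow_succ] at h2; omega

abbrev Feasible' (μ : Mem) (r lam : ℕ) (T : ℕ → ℕ) (t : ℕ) : Prop :=
  FeasibleAt (μ 0 0) (pts μ) (dst μ) (balls μ r) (price μ lam) T (μ 10 0) t

theorem balls_subset (μ : Mem) (r : ℕ) : balls μ r ⊆ range (μ 0 0 * μ 0 0) := filter_subset _ _

theorem pts_subset (μ : Mem) : pts μ ⊆ range (μ 0 0) := filter_subset _ _

theorem overS_sum_eq_zero {μ m : Mem} (hm : Base μ m)
    (hT : ∀ b < μ 0 0 * μ 0 0, m 20 b ≤ μ 10 0) (ρ : ℕ → ℕ) :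
    (E.fold .sum .nn 1 (.num 0) (at' 26 1)).eval ρ (overS.run ρ m) = 0
      ↔ Feasible' μ (m 13 0) (m 18 0) (m 20) (m 24 0) := by
  have hb1 : Base μ (overS.run ρ m) := hm.run (sc := []) rfl ρ
  rw [eval_sum, hb1.val_nn, sum_eq_zero_iff]
  simp only [E.eval, Function.update_self]
  constructor
  · intro h b hb hbW
    have hbN := balls_subset _ _ hb
    by_contra hcon
    exact (overS_ne_zero hm ρ (mem_range.1 hbN)).2 ⟨hb, hbW.ge, not_le.1 hcon⟩ (h b hbN)
  · intro h b hb
    by_contra hcon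
    obtain ⟨h1, h2, h3⟩ := (overS_ne_zero hm ρ (mem_range.1 hb)).1 hcon
    exact absurd (h b h1 (le_antisymm (hT b (mem_range.1 hb)) h2)) (not_le.2 h3)

/-- The search finds the last feasible time. -/
theorem search_spec {μ m : Mem} (hm : Base μ m)
    (hT : ∀ b < μ 0 0 * μ 0 0, m 20 b ≤ μ 10 0) (hW : 0 < μ 10 0)
    (h22 : m 22 0 = 0) (h23 : m 23 0 = μ 10 0)
    (h0 : Feasible' μ (m 13 0) (m 18 0) (m 20) 0) (ρ : ℕ → ℕ) :
    ∃ τ, (S.bits 10 51 searchS).run ρ m 22 0 = τ ∧ τ < μ 10 0 ∧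
      Feasible' μ (m 13 0) (m 18 0) (m 20) τ ∧
      (τ + 1 = μ 10 0 ∨ ¬Feasible' μ (m 13 0) (m 18 0) (m 20) (τ + 1)) := by
  set n := (m 10 0).size with hn
  -- Cell 22 is a feasible time, and cell 23 an infeasible one or `W`; their distance is halved in
  -- each round.
  let I : ℕ → Mem → Prop := fun j m' => Base μ m' ∧ m' 13 = m 13 ∧ m' 18 = m 18 ∧ m' 20 = m 20 ∧
    m' 22 0 < m' 23 0 ∧ m' 23 0 ≤ μ 10 0 ∧ Feasible' μ (m 13 0) (m 18 0) (m 20) (m' 22 0) ∧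
    (m' 23 0 = μ 10 0 ∨ ¬Feasible' μ (m 13 0) (m 18 0) (m 20) (m' 23 0)) ∧
    m' 23 0 - m' 22 0 ≤ 2 ^ (n - j)
  have key : I n ((S.bits 10 51 searchS).run ρ m) := by
    refine iter_inv I ?_ ?_
    · refine ⟨hm, rfl, rfl, rfl, by omega, by omega, by rwa [h22], Or.inl h23, ?_⟩
      have : m 10 0 < 2 ^ n := Nat.lt_size_self _
      rw [hm 10 rfl] at this
      simp only [Nat.sub_zero]
      omega
    · rintro j hj m' ⟨i1, i2, i3, i4, i5, i6, i7, i8, i9⟩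
      obtain ⟨p1, p2, p3, p4⟩ := half_le (j := n - (j + 1)) i5 (by
        rwa [show n - (j + 1) + 1 = n - j by omega])
      simp only [searchS, block, run_seq]
      set ρ' := Function.update ρ 51 (m 10 0 / 2 ^ j)
      set m1 := (setCell 24 (.div (.add (cell 22) (cell 23)) (.num 2))).run ρ' m' with hm1
      have b1 : Base μ m1 := i1.run (sc := []) rfl ρ'
      have f13 : m1 13 = m 13 := (S.run_frame rfl _ _).trans i2
      have f18 : m1 18 = m 18 := (S.run_frame rfl _ _).trans i3
      have f20 : m1 20 = m 20 := (S.run_frame rfl _ _).trans i4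
      have f24 : m1 24 0 = (m' 22 0 + m' 23 0) / 2 := set_apply _ _ _ _
      have hiff := overS_sum_eq_zero b1 (by rwa [f20]) ρ'
      rw [f13, f18, f20, f24] at hiff
      set m2 := overS.run ρ' m1 with hm2
      have b2 : Base μ m2 := b1.run (sc := []) rfl ρ'
      have g13 : m2 13 = m 13 := (S.run_frame rfl _ _).trans f13
      have g18 : m2 18 = m 18 := (S.run_frame rfl _ _).trans f18
      have g20 : m2 20 = m 20 := (S.run_frame rfl _ _).trans f20
      have g22 : m2 22 = m' 22 := (S.run_frame rfl _ _).trans (S.run_frame rfl _ _)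
      have g23 : m2 23 = m' 23 := (S.run_frame rfl _ _).trans (S.run_frame rfl _ _)
      have g24 : m2 24 = m1 24 := S.run_frame rfl _ _
      rw [run_ite]
      by_cases hf : Feasible' μ (m 13 0) (m 18 0) (m 20) ((m' 22 0 + m' 23 0) / 2)
      · rw [if_neg (not_not.2 (hiff.2 hf))]
        set m3 := (setCell 22 (cell 24)).run ρ' m2
        have e22 : m3 22 0 = (m' 22 0 + m' 23 0) / 2 :=
          (set_apply _ _ _ _).trans (by simp only [E.eval, g24, f24])
        have e23 : m3 23 = m' 23 := (S.run_frame rfl _ _).trans g23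
        refine ⟨b2.run (sc := []) rfl ρ', (S.run_frame rfl _ _).trans g13,
          (S.run_frame rfl _ _).trans g18, (S.run_frame rfl _ _).trans g20, ?_, ?_, ?_, ?_, ?_⟩
        · rw [e22, e23]; exact p2
        · rw [e23]; exact i6
        · rw [e22]; exact hf
        · rw [e23]; exact i8
        · rw [e22, e23]; exact p4
      · rw [if_pos (fun h => hf (hiff.1 h))]
        set m3 := (setCell 23 (cell 24)).run ρ' m2
        have e23 : m3 23 0 = (m' 22 0 + m' 23 0) / 2 :=
          (set_apply _ _ _ _).trans (by simp only [E.eval, g24, f24])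
        have e22 : m3 22 = m' 22 := (S.run_frame rfl _ _).trans g22
        refine ⟨b2.run (sc := []) rfl ρ', (S.run_frame rfl _ _).trans g13,
          (S.run_frame rfl _ _).trans g18, (S.run_frame rfl _ _).trans g20, ?_, ?_, ?_, ?_, ?_⟩
        · rw [e22, e23]
          refine lt_of_le_of_ne p1 fun h => hf ?_
          rw [← h]; exact i7
        · rw [e23]; omega
        · rw [e22]; exact i7
        · rw [e23]; exact Or.inr hf
        · rw [e22, e23]; exact p3
  obtain ⟨-, -, -, -, i5, i6, i7, i8, i9⟩ := key
  simp only [Nat.sub_self, pow_zero] at i9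
  have : (S.bits 10 51 searchS).run ρ m 22 0 + 1 = (S.bits 10 51 searchS).run ρ m 23 0 := by omega
  exact ⟨_, rfl, by omega, i7, by rw [this]; exact i8⟩

abbrev DualInv' (μ : Mem) (r lam : ℕ) (T : ℕ → ℕ) (τ : ℕ) : Prop :=
  DualInv (μ 0 0) (pts μ) (dst μ) (balls μ r) (price μ lam) T (μ 10 0) τ

theorem phase_spec {μ m : Mem} (hm : Base μ m) (hT : ∀ b < μ 0 0 * μ 0 0, m 20 b ≤ μ 10 0) {τ : ℕ}
    (hinv : DualInv' μ (m 13 0) (m 18 0) (m 20) τ) (ρ : ℕ → ℕ) :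
    (∀ b < μ 0 0 * μ 0 0, phaseS.run ρ m 20 b ≤ μ 10 0) ∧ ∃ τ', τ' < μ 10 0 ∧
      Feasible' μ (m 13 0) (m 18 0) (m 20) τ' ∧
      (τ' + 1 = μ 10 0 ∨ ¬Feasible' μ (m 13 0) (m 18 0) (m 20) (τ' + 1)) ∧
      Step (μ 0 0) (pts μ) (dst μ) (balls μ (m 13 0)) (price μ (m 18 0)) (m 20) (μ 10 0) τ'
        (phaseS.run ρ m 20) := by
  have hW : 0 < μ 10 0 := by have := hinv.lt; omega
  simp only [phaseS, block, run_seq]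
  set m1 := (setCell 22 (.num 0)).run ρ m
  have b1 : Base μ m1 := hm.run (sc := []) rfl ρ
  set m2 := (setCell 23 (cell 10)).run ρ m1
  have b2 : Base μ m2 := b1.run (sc := []) rfl ρ
  have f13 : m2 13 = m 13 := (S.run_frame rfl _ _).trans (S.run_frame rfl _ _)
  have f18 : m2 18 = m 18 := (S.run_frame rfl _ _).trans (S.run_frame rfl _ _)
  have f20 : m2 20 = m 20 := (S.run_frame rfl _ _).trans (S.run_frame rfl _ _)
  have f22 : m2 22 0 = 0 := (congrFun (S.run_frame rfl _ _) 0).trans (set_apply _ _ _ _)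
  have f23 : m2 23 0 = μ 10 0 := (set_apply _ _ _ _).trans (by simp only [E.eval, b1 10 rfl])
  obtain ⟨τ', h1, h2, h3, h4⟩ := search_spec b2 (by rwa [f20]) hW f22 f23
    (by rw [f13, f18, f20]
        exact fun b hb hbW => (load_mono (Nat.zero_le _) b).trans (hinv.feasible b hb hbW)) ρ
  rw [f13, f18, f20] at h3 h4
  set m3 := (S.bits 10 51 searchS).run ρ m2
  have b3 : Base μ m3 := b2.run (sc := []) rfl ρ
  set m4 := (setCell 24 (.add (cell 22) (.num 1))).run ρ m3
  have b4 : Base μ m4 := b3.run (sc := []) rfl ρ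
  have g13 : m4 13 = m 13 := ((S.run_frame rfl _ _).trans (S.run_frame rfl _ _)).trans f13
  have g18 : m4 18 = m 18 := ((S.run_frame rfl _ _).trans (S.run_frame rfl _ _)).trans f18
  have g20 : m4 20 = m 20 := ((S.run_frame rfl _ _).trans (S.run_frame rfl _ _)).trans f20
  have g22 : m4 22 = m3 22 := S.run_frame rfl _ _
  have g24 : m4 24 0 = τ' + 1 := (set_apply _ _ _ _).trans (by simp only [E.eval, h1])
  have hover : ∀ b < μ 0 0 * μ 0 0, _ := fun b hb => overS_ne_zero b4 ρ hb
  rw [g13, g18, g20, g24] at hover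
  set m5 := overS.run ρ m4
  have b5 : Base μ m5 := b4.run (sc := []) rfl ρ
  have k20 : m5 20 = m 20 := (S.run_frame rfl _ _).trans g20
  have k22 : m5 22 0 = τ' := (congrFun ((S.run_frame rfl _ _).trans g22) 0).trans h1
  set m6 := (fill .nn 21 1 (.ite (at' 26 1) (cell 22) (at' 20 1))).run ρ m5 with hm6
  have b6 : Base μ m6 := b5.run (sc := []) rfl ρ
  have l20 : m6 20 = m 20 := (S.run_frame rfl _ _).trans k20
  set m7 := (fill .nn 20 1 (at' 21 1)).run ρ m6 with hm7
  have hval : ∀ b < μ 0 0 * μ 0 0, m7 20 b = if m5 26 b ≠ 0 then τ' else m 20 b := by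
    intro b hb
    rw [hm7, fill_apply rfl _ (by rwa [b6.val_nn])]
    simp only [E.eval, Function.update_self]
    rw [hm6, fill_apply rfl _ (by rwa [b5.val_nn])]
    simp only [E.eval, Function.update_self, k20, k22]
  refine ⟨fun b hb => ?_, τ', h2, h3, h4, fun b hb => ?_⟩
  · rw [hval b hb]
    split_ifs
    · exact h2.le
    · exact hT b hb
  · have h5 : m 20 b = μ 10 0 ↔ μ 10 0 ≤ m 20 b := ⟨fun h => h.ge, fun h => le_antisymm (hT b hb) h⟩
    rw [h5, ← hover b hb, hval b hb]
    exact ⟨fun h => if_pos h, fun h => if_neg h⟩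

/-- Each of the `N * N` phases pays for a new ball unless the remaining ones stay feasible up to
`W`, and there are at most `N * N` balls. -/
theorem dual_spec {μ m : Mem} (hm : Base μ m) (hW : 0 < μ 10 0) (ρ : ℕ → ℕ) :
    ∃ τ, DualInv' μ (m 13 0) (m 18 0) (dualS.run ρ m 20) τ ∧
      Feasible' μ (m 13 0) (m 18 0) (dualS.run ρ m 20) (μ 10 0) := by
  simp only [dualS, block, run_seq]
  set m1 := (fill .nn 20 1 (cell 10)).run ρ m with hm1
  have b1 : Base μ m1 := hm.run (sc := []) rfl ρ
  have f13 : m1 13 = m 13 := S.run_frame rfl _ _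
  have f18 : m1 18 = m 18 := S.run_frame rfl _ _
  have f20 : ∀ b < μ 0 0 * μ 0 0, m1 20 b = μ 10 0 := fun b hb => by
    rw [hm1, fill_apply rfl _ (by rwa [hm.val_nn])]
    simp only [E.eval, hm 10 rfl]
  have hBs := balls_subset μ (m 13 0)
  let I : ℕ → Mem → Prop := fun j m' => Base μ m' ∧ m' 13 = m 13 ∧ m' 18 = m 18 ∧
    (∀ b < μ 0 0 * μ 0 0, m' 20 b ≤ μ 10 0) ∧
    (∃ τ, DualInv' μ (m 13 0) (m 18 0) (m' 20) τ) ∧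
    (Feasible' μ (m 13 0) (m 18 0) (m' 20) (μ 10 0) ∨
      unpaid (balls μ (m 13 0)) (m' 20) (μ 10 0) + j ≤ μ 0 0 * μ 0 0)
  have key : I (Range.nn.val m1) ((S.rep .nn 50 phaseS).run ρ m1) := by
    refine iter_inv I ?_ ?_
    · refine ⟨b1, f13, f18, fun b hb => (f20 b hb).le, ⟨0, DualInv.init hBs hW f20⟩, Or.inr ?_⟩
      have := card_le_card ((filter_subset (fun b => m1 20 b = μ 10 0) _).trans hBs)
      simpa [unpaid] using this
    · rintro j - m' ⟨i1, i2, i3, i4, ⟨τ, i5⟩, i6⟩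
      have h := phase_spec i1 i4 (by rwa [i2, i3]) (Function.update ρ 50 j)
      rw [i2, i3] at h
      obtain ⟨h1, τ', h2, h3, h4, h5⟩ := h
      refine ⟨i1.run (sc := []) rfl _, (S.run_frame rfl _ _).trans i2,
        (S.run_frame rfl _ _).trans i3, h1,
        ⟨τ', i5.step (pts_subset μ) hBs h2 h3 h4 h5⟩, ?_⟩
      rcases i6 with i6 | i6
      · exact Or.inl (feasibleAt_stable hBs h2 i6 h5)
      · rcases feasible_or_unpaid_lt hBs h2 h4 h5 with h | h
        · exact Or.inl h.2
        · exact Or.inr (by omega)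
  obtain ⟨-, -, -, -, ⟨τ, i5⟩, i6⟩ := key
  refine ⟨τ, i5, ?_⟩
  rcases i6 with i6 | i6
  · exact i6
  · rw [b1.val_nn] at i6
    exact feasible_of_unpaid (by omega) _

end Clustering

namespace Clustering

/-! ### The program for the selection of balls and for candidate solutions. -/

open ArrayLang Finset RAM

/-- The selected balls. -/
abbrev selected (μ m : Mem) : Finset ℕ := (range (μ 0 0 * μ 0 0)).filter fun b => m 27 b ≠ 0

abbrev Eligible' (μ : Mem) (paid : Finset ℕ) (A : ℕ → ℕ) (sel : Finset ℕ) (b : ℕ) : Prop :=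
  Eligible (μ 0 0) (pts μ) (dst μ) paid A sel b

theorem eligibleE_ne_zero {μ m : Mem} (hm : Base μ m) {paid : Finset ℕ} {A : ℕ → ℕ}
    (hA : ∀ p < μ 0 0, m 25 p = A p)
    (hpaid : ∀ b < μ 0 0 * μ 0 0, (m 20 b < μ 10 0 ↔ b ∈ paid)) (ρ : ℕ → ℕ) {b : ℕ}
    (hb : b < μ 0 0 * μ 0 0) :
    eligibleE.eval (Function.update ρ 1 b) m ≠ 0
      ↔ Eligible' μ paid A (selected μ m) b := by
  have hconf : ∀ b', conflictE.eval (Function.update (Function.update ρ 1 b) 2 b') m = 0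
      ↔ ¬Conflict (μ 0 0) (pts μ) (dst μ) A b b' := by
    intro b'
    unfold conflictE Conflict
    rw [eval_sumPts hm, sum_eq_zero_iff]
    push Not
    refine forall₂_congr fun p hp => ?_
    have hpN := mem_range.1 (pts_subset μ hp)
    simp only [E.eval, eval_bdistE hm, Function.update_self, hA p hpN, Function.update_apply]
    norm_num
    constructor
    · intro h h1
      have := h (by omega)
      omega
    · intro h h1
      have := h (by omega)
      omega
  simp only [Eligible', Eligible, ← hpaid b hb, mem_filter, mem_range]
  have hsum : (E.fold .sum .nn 2 (.num 0) (.ite (at' 27 2) conflictE (.num 0))).eval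
      (Function.update ρ 1 b) m = 0
      ↔ ∀ b', b' < μ 0 0 * μ 0 0 ∧ m 27 b' ≠ 0 → ¬Conflict (μ 0 0) (pts μ) (dst μ) A b b' := by
    rw [eval_sum, hm.val_nn, sum_eq_zero_iff]
    simp only [E.eval, Function.update_self, mem_range, ← hconf, and_imp]
    refine forall₂_congr fun b' _ => ?_
    by_cases h : m 27 b' = 0 <;> simp [h]
  have hunf : eligibleE.eval (Function.update ρ 1 b) m
      = if μ 10 0 - m 20 b ≠ 0 then (if m 27 b ≠ 0 then 0 else
        if (E.fold .sum .nn 2 (.num 0) (.ite (at' 27 2) conflictE (.num 0))).eval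
          (Function.update ρ 1 b) m ≠ 0 then 0 else 1) else 0 := by
    rw [eligibleE, E.eval.eq_8, E.eval.eq_8, E.eval.eq_8]
    simp only [E.eval.eq_1, E.eval.eq_2, E.eval.eq_3, E.eval.eq_5, Function.update_self, hm 10 rfl]
  rw [← hsum, hunf]
  split_ifs <;> omega

theorem pick_spec {μ m : Mem} (hm : Base μ m) {paid : Finset ℕ} {A : ℕ → ℕ}
    (hA : ∀ p < μ 0 0, m 25 p = A p)
    (hpaid : ∀ b < μ 0 0 * μ 0 0, (m 20 b < μ 10 0 ↔ b ∈ paid))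
    (hsub : paid ⊆ range (μ 0 0 * μ 0 0)) (ρ : ℕ → ℕ) :
    ((∀ b, ¬Eligible' μ paid A (selected μ m) b) ∧ selected μ (pickS.run ρ m) = selected μ m) ∨
    ∃ c, Eligible' μ paid A (selected μ m) c ∧
      (∀ b, Eligible' μ paid A (selected μ m) b →
        brad (μ 0 0) (dst μ) b ≤ brad (μ 0 0) (dst μ) c) ∧
      selected μ (pickS.run ρ m) = insert c (selected μ m) := by
  simp only [pickS, block, run_seq, brad_dst]
  set m1 := (fill .nn 28 1 eligibleE).run ρ m with hm1
  have b1 : Base μ m1 := hm.run (sc := []) rfl ρ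
  have h28 : ∀ b < μ 0 0 * μ 0 0, (m1 28 b ≠ 0 ↔ Eligible' μ paid A (selected μ m) b) := by
    intro b hb
    rw [hm1, fill_apply rfl _ (by rwa [hm.val_nn])]
    exact eligibleE_ne_zero hm hA hpaid ρ hb
  have hlt : ∀ b, Eligible' μ paid A (selected μ m) b → b < μ 0 0 * μ 0 0 := fun b hb =>
    mem_range.1 (hsub hb.1)
  set m2 := (setCell 29 (.fold .max .nn 1 (.num 0)
    (.ite (at' 28 1) (.add (at' 8 1) (.num 1)) (.num 0)))).run ρ m1 with hm2
  have b2 : Base μ m2 := b1.run (sc := []) rfl ρ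
  have f28 : m2 28 = m1 28 := S.run_frame rfl _ _
  have f27 : m2 27 = m 27 := (S.run_frame rfl _ _).trans (S.run_frame rfl _ _)
  have h29 : m2 29 0 = (range (μ 0 0 * μ 0 0)).fold max 0
      fun b => if m1 28 b ≠ 0 then μ 8 b + 1 else 0 := by
    refine (set_apply _ _ _ _).trans ?_
    rw [eval_max, b1.val_nn]
    simp only [E.eval, Function.update_self, b1 8 rfl]
  set M := m2 29 0 with hM
  have hMle : ∀ b, Eligible' μ paid A (selected μ m) b → μ 8 b + 1 ≤ M := by
    intro b hb
    have := (fold_max_le (s := range (μ 0 0 * μ 0 0)) (b := 0)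
      (f := fun b => if m1 28 b ≠ 0 then μ 8 b + 1 else 0) M).1 h29.ge
    have h3 := this.2 b (mem_range.2 (hlt b hb))
    simpa [(h28 b (hlt b hb)).2 hb] using h3
  rw [run_ite]
  by_cases hM0 : M = 0
  · left
    rw [if_neg (by simp [E.eval, ← hM, hM0])]
    refine ⟨fun b hb => ?_, ?_⟩
    · have := hMle b hb; omega
    · simp only [S.run, selected, f27]
  · right
    rw [if_pos (by simpa [E.eval] using hM0)]
    simp only [run_seq]
    set m3 := (setCell 30 (.fold .min .nn 1 (.mul (cell 0) 0 (.num 0))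
       (.ite (at' 28 1) (.ite (.sub (cell 29) (.add (at' 8 1) (.num 1)))
         (.mul (cell 0) 0 (.num 0)) (.var 1)) (.mul (cell 0) 0 (.num 0))))).run ρ m2 with hm3
    set g : ℕ → ℕ := fun b => if m1 28 b ≠ 0 then
      (if M - (μ 8 b + 1) ≠ 0 then μ 0 0 * μ 0 0 else b) else μ 0 0 * μ 0 0 with hg
    have h30 : m3 30 0 = (range (μ 0 0 * μ 0 0)).fold min (μ 0 0 * μ 0 0) g := by
      refine (set_apply _ _ _ _).trans ?_
      rw [eval_min, b2.val_nn]
      simp only [E.eval, Function.update_self, b2 8 rfl, b2 0 rfl, f28, ← hM, hg]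
    have f27' : m3 27 = m 27 := (S.run_frame rfl _ _).trans f27
    obtain h | ⟨b₀, hb₀, hb₀M⟩ := (le_fold_max (s := range (μ 0 0 * μ 0 0)) (b := 0)
      (f := fun b => if m1 28 b ≠ 0 then μ 8 b + 1 else 0) M).1 h29.le
    · omega
    have hb₀e : m1 28 b₀ ≠ 0 := by
      by_contra hcon; rw [if_neg (not_not.2 hcon)] at hb₀M; omega
    rw [if_pos hb₀e] at hb₀M
    have hgb₀ : g b₀ = b₀ := by
      simp only [hg]; rw [if_pos hb₀e, if_neg (by omega)]
    have hle := (le_fold_min (s := range (μ 0 0 * μ 0 0)) (b := μ 0 0 * μ 0 0)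
      (f := g) (m3 30 0)).1 h30.le
    have hlt₀ := mem_range.1 hb₀
    have h4 := hle.2 b₀ hb₀
    rw [hgb₀] at h4
    obtain h | ⟨c, hc, hcle⟩ := (fold_min_le (s := range (μ 0 0 * μ 0 0)) (b := μ 0 0 * μ 0 0)
      (f := g) (m3 30 0)).1 h30.ge
    · omega
    have h5 := hle.2 c hc
    have hcN := mem_range.1 hc
    have hc1 : m1 28 c ≠ 0 := by
      by_contra hcon
      simp only [hg] at hcle
      rw [if_neg (not_not.2 hcon)] at hcle
      omega
    have hc2 : ¬(M - (μ 8 c + 1) ≠ 0) := by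
      intro hcon
      simp only [hg] at hcle
      rw [if_pos hc1, if_pos hcon] at hcle
      omega
    have hgc : g c = c := by simp only [hg]; rw [if_pos hc1, if_neg hc2]
    rw [hgc] at h5 hcle
    have hidx : m3 30 0 = c := le_antisymm h5 hcle
    refine ⟨c, (h28 c hcN).1 hc1, fun b hb => ?_, ?_⟩
    · have := hMle b hb; omega
    · rw [run_set]
      simp only [E.eval, hidx]
      ext b
      simp only [selected, mem_filter, mem_insert, mem_range]
      by_cases hbc : b = c
      · subst hbc; simp [store_same, hcN]
      · rw [store_cell _ _ _ hbc, f27']; simp [hbc]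

/-- Every round selects a new ball as long as one is eligible, so `N * N` rounds exhaust the
eligible balls. -/
theorem select_spec {μ m : Mem} (hm : Base μ m) {paid : Finset ℕ}
    (hpaid : ∀ b < μ 0 0 * μ 0 0, (m 20 b < μ 10 0 ↔ b ∈ paid))
    (hsub : paid ⊆ range (μ 0 0 * μ 0 0)) (ρ : ℕ → ℕ) :
    ∃ sel, SelInv (μ 0 0) (pts μ) (dst μ) paid (dual (μ 0 0) (dst μ) (m 20) (μ 10 0)) sel ∧
      (∀ b, ¬Eligible' μ paid (dual (μ 0 0) (dst μ) (m 20) (μ 10 0)) sel b) ∧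
      Tripled (μ 0 0) (dst μ) sel (selectS.run ρ m 19) := by
  set A := dual (μ 0 0) (dst μ) (m 20) (μ 10 0) with hA
  simp only [selectS, block, run_seq]
  set m1 := (fill .n 25 0 (dualE (cell 10) (.var 0))).run ρ m with hm1
  have b1 : Base μ m1 := hm.run (sc := []) rfl ρ
  have h25 : ∀ p < μ 0 0, m1 25 p = A p := by
    intro p hp
    rw [hm1, fill_apply rfl _ (by rwa [hm.val_n]), eval_dualE hm _ (fun i => by simp [E.eval])]
    simp [E.eval, hm 10 rfl, hA]
  set m2 := (fill .nn 27 1 (.num 0)).run ρ m1 with hm2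
  have b2 : Base μ m2 := b1.run (sc := []) rfl ρ
  have f20 : m2 20 = m 20 := (S.run_frame rfl _ _).trans (S.run_frame rfl _ _)
  have f25 : m2 25 = m1 25 := S.run_frame rfl _ _
  have h27 : selected μ m2 = ∅ := by
    refine filter_eq_empty_iff.2 fun b hb => ?_
    rw [hm2, fill_apply rfl _ (by rw [b1.val_nn]; exact mem_range.1 hb)]
    simp [E.eval]
  let I : ℕ → Mem → Prop := fun j m' => Base μ m' ∧ m' 20 = m 20 ∧ m' 25 = m1 25 ∧
    SelInv (μ 0 0) (pts μ) (dst μ) paid A (selected μ m') ∧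
    ((∀ b, ¬Eligible' μ paid A (selected μ m') b) ∨ j ≤ #(selected μ m'))
  have key : I (Range.nn.val m2) ((S.rep .nn 50 pickS).run ρ m2) := by
    refine iter_inv I ?_ ?_
    · exact ⟨b2, f20, f25, by rw [h27]; exact SelInv.init, Or.inr (Nat.zero_le _)⟩
    · rintro j - m' ⟨i1, i2, i3, i4, i5⟩
      have h := pick_spec i1 (A := A) (by rw [i3]; exact h25) (by rw [i2]; exact hpaid) hsub
        (Function.update ρ 50 j)
      refine ⟨i1.run (sc := []) rfl _, (S.run_frame rfl _ _).trans i2,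
        (S.run_frame rfl _ _).trans i3, ?_⟩
      rcases h with ⟨h1, h2⟩ | ⟨c, h1, h2, h3⟩
      · rw [h2]; exact ⟨i4, Or.inl h1⟩
      · rw [h3]
        refine ⟨i4.insert h1 h2, Or.inr ?_⟩
        rw [card_insert_of_notMem h1.2.1]
        rcases i5 with i5 | i5
        · exact absurd h1 (i5 c)
        · omega
  set m3 := (S.rep .nn 50 pickS).run ρ m2 with hm3
  obtain ⟨b3, i2, i3, i4, i5⟩ := key
  refine ⟨selected μ m3, i4, ?_, ?_⟩
  · rcases i5 with i5 | i5
    · exact i5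
    -- If every round selected a ball, all `N * N` numbers are selected and nothing is left to be
    -- eligible.
    · intro b hb
      rw [b2.val_nn] at i5
      have h1 : selected μ m3 = range (μ 0 0 * μ 0 0) :=
        eq_of_subset_of_card_le (filter_subset _ _) (by simpa using i5)
      exact hb.2.1 (h1 ▸ hsub hb.1)
  · have h19 : ∀ x < μ 0 0, (fill .n 19 0 (.fold .max .n 1 (.num 0)
        (.ite (.get 27 (.add (.mul (.var 0) 0 (.num 0)) (.var 1)))
        (.add (.add (distE (.var 0) (.var 1)) (distE (.var 0) (.var 1)))
          (.add (distE (.var 0) (.var 1)) (.num 1))) (.num 0)))).run ρ m3 19 x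
        = (range (μ 0 0)).fold max 0 fun v => if m3 27 (x * μ 0 0 + v) ≠ 0 then
          3 * μ 8 (x * μ 0 0 + v) + 1 else 0 := by
      intro x hx
      rw [fill_apply rfl _ (by rwa [b3.val_n]), eval_max, b3.val_n]
      simp only [E.eval, Function.update_self, b3 8 rfl, b3 0 rfl,
        Function.update_of_ne (show (0 : ℕ) ≠ 1 by decide)]
      refine fold_congr fun v _ => ?_
      split_ifs <;> omega
    refine ⟨fun b hb => ?_, fun x hx hR => ?_⟩
    · obtain ⟨hb1, hb2⟩ := mem_filter.1 hb
      have hbN := mem_range.1 hb1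
      have hN : 0 < μ 0 0 := by
        by_contra hcon
        rw [Nat.le_zero.1 (not_lt.1 hcon)] at hbN; omega
      rw [h19 _ (Nat.div_lt_of_lt_mul hbN), le_fold_max]
      refine Or.inr ⟨b % μ 0 0, mem_range.2 (Nat.mod_lt _ hN), ?_⟩
      rw [Nat.div_add_mod', if_pos hb2, brad_dst]
    · rw [h19 x hx] at hR ⊢
      set g := fun v => if m3 27 (x * μ 0 0 + v) ≠ 0 then
          3 * μ 8 (x * μ 0 0 + v) + 1 else 0 with hg
      obtain h | ⟨v, hv, hle⟩ := (le_fold_max (s := range (μ 0 0)) (b := 0) (f := g) _).1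
        (le_refl ((range (μ 0 0)).fold max 0 g))
      · omega
      have hle' := ((fold_max_le (s := range (μ 0 0)) (b := 0) (f := g) _).1
        (le_refl ((range (μ 0 0)).fold max 0 g))).2 v hv
      have heq : (range (μ 0 0)).fold max 0 g = g v := le_antisymm hle hle'
      rw [heq] at hR ⊢
      have hv' := mem_range.1 hv
      have hne : m3 27 (x * μ 0 0 + v) ≠ 0 := by
        by_contra hcon; exact hR (if_neg (not_not.2 hcon))
      refine ⟨x * μ 0 0 + v, mem_filter.2 ⟨mem_range.2 ?_, hne⟩, ?_, ?_⟩
      · calc x * μ 0 0 + v < (x + 1) * μ 0 0 := by rw [add_mul]; omega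
          _ ≤ μ 0 0 * μ 0 0 := Nat.mul_le_mul_right _ hx
      · rw [add_comm, Nat.add_mul_div_right _ _ (by omega), Nat.div_eq_of_lt hv', zero_add]
      · rw [brad_dst]; exact if_pos hne

/-! #### Keeping the best solution -/

noncomputable abbrev cost' (μ : Mem) (R : ℕ → ℕ) : ℕ := cost (μ 0 0) (pts μ) (dst μ) (μ 0 2) R

/-- At least one facility and at most `k` facilities are open. -/
structure Feas (μ : Mem) (R : ℕ → ℕ) : Prop where
  pos : 1 ≤ #(opened (μ 0 0) R)
  le : #(opened (μ 0 0) R) ≤ μ 0 1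
  mem : ∀ x < μ 0 0, R x ≠ 0 → μ 2 x ≠ 0

/-- The array `11` holds a solution whose cost plus `1` is in array `12`. -/
def BestInv (μ m : Mem) : Prop :=
  m 12 0 = 0 ∨ (Feas μ (m 11) ∧ m 12 0 = cost' μ (m 11) + 1)

/-- A solution of cost at most `c` has been found. -/
def Seen (m : Mem) (c : ℕ) : Prop := m 12 0 ≠ 0 ∧ m 12 0 ≤ c + 1

theorem opened_congr {N : ℕ} {R R' : ℕ → ℕ} (h : ∀ x < N, R x = R' x) :
    opened N R = opened N R' :=
  filter_congr fun x hx => by rw [h x (mem_range.1 hx)]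

theorem near_congr {N : ℕ} {D : ℕ → ℕ → ℕ} {R R' : ℕ → ℕ} (h : ∀ x < N, R x = R' x) (v : ℕ) :
    near N D R v = near N D R' v := by
  unfold near
  congr 1
  ext d
  simp only [Set.mem_ofPred_eq]
  refine exists_congr fun y => and_congr_right fun hy => ?_
  rw [h y hy]

theorem cost_congr {N : ℕ} {P : Finset ℕ} {D : ℕ → ℕ → ℕ} {l : ℕ} {R R' : ℕ → ℕ}
    (h : ∀ x < N, R x = R' x) : cost N P D l R = cost N P D l R' := by
  unfold cost
  congr 1
  · exact sum_congr rfl fun x hx => by rw [h x (mem_range.1 hx)]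
  · exact sum_congr rfl fun p _ => near_congr h p

theorem Feas.congr {μ : Mem} {R R' : ℕ → ℕ} (hF : Feas μ R) (h : ∀ x < μ 0 0, R x = R' x) :
    Feas μ R' :=
  ⟨opened_congr h ▸ hF.pos, opened_congr h ▸ hF.le, fun x hx hR => hF.mem x hx (h x hx ▸ hR)⟩

theorem eval_openDistE {μ m : Mem} (hm : Base μ m) (a v x : ℕ) (ρ : ℕ → ℕ) :
    (openDistE a).eval (Function.update (Function.update ρ 0 v) 1 x) m
      = dst μ v x - (m a x - 1) := by
  simp only [openDistE, E.eval, Function.update_self, hm 8 rfl, hm 0 rfl,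
    Function.update_of_ne (show (0 : ℕ) ≠ 1 by decide)]

theorem eval_nearE {μ m : Mem} (hm : Base μ m) {a : ℕ} (v : ℕ) (ρ : ℕ → ℕ)
    (hW : ∀ x < μ 0 0, dst μ v x ≤ μ 10 0) {y : ℕ} (hy : y < μ 0 0) (hR : m a y ≠ 0) :
    (nearE a).eval (Function.update ρ 0 v) m = near (μ 0 0) (dst μ) (m a) v := by
  unfold nearE
  rw [eval_min, hm.val_n]
  simp only [E.eval, Function.update_self, eval_openDistE hm, hm 10 rfl]
  set g := fun x => if m a x ≠ 0 then dst μ v x - (m a x - 1) else μ 10 0 with hg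
  obtain ⟨x, hx⟩ := exists_isNear (dst μ) v hy hR
  refine le_antisymm ?_ ?_
  · rw [fold_min_le]
    refine Or.inr ⟨x, mem_range.2 hx.lt, ?_⟩
    simp only [hg]
    rw [if_pos hx.ne, hx.eq]
  · have h1 : near (μ 0 0) (dst μ) (m a) v ≤ μ 10 0 := by
      rw [← hx.eq]; exact (Nat.sub_le _ _).trans (hW x hx.lt)
    rw [le_fold_min]
    refine ⟨h1, fun z hz => ?_⟩
    simp only [hg]
    split_ifs with h
    · exact near_le (mem_range.1 hz) h
    · exact h1

theorem eval_nearestE {μ m : Mem} (hm : Base μ m) {a a' : ℕ} (v : ℕ) (ρ : ℕ → ℕ)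
    {y : ℕ} (hy : y < μ 0 0) (hR : m a y ≠ 0) (ha' : m a' v = near (μ 0 0) (dst μ) (m a) v) :
    IsNear (μ 0 0) (dst μ) (m a) v ((nearestE a a').eval (Function.update ρ 0 v) m)
      (near (μ 0 0) (dst μ) (m a) v) := by
  unfold nearestE
  rw [eval_min, hm.val_n]
  simp only [E.eval, Function.update_self, eval_openDistE hm, hm 0 rfl,
    Function.update_of_ne (show (0 : ℕ) ≠ 1 by decide), ha']
  set g := fun x => if m a x ≠ 0 then
    (if dst μ v x - (m a x - 1) - near (μ 0 0) (dst μ) (m a) v ≠ 0 then μ 0 0 else x) else μ 0 0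
    with hg
  obtain ⟨x, hx⟩ := exists_isNear (dst μ) v hy hR
  have hgx : g x = x := by
    simp only [hg]
    rw [if_pos hx.ne, if_neg]
    rw [hx.eq]; simp
  have hle := (le_fold_min (s := range (μ 0 0)) (b := μ 0 0) (f := g) _).1
    (le_refl ((range (μ 0 0)).fold min (μ 0 0) g))
  have h1 := hle.2 x (mem_range.2 hx.lt)
  have hxN := hx.lt
  rw [hgx] at h1
  obtain h | ⟨c, hc, hcle⟩ := (fold_min_le (s := range (μ 0 0)) (b := μ 0 0) (f := g) _).1
    (le_refl ((range (μ 0 0)).fold min (μ 0 0) g))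
  · omega
  have hcg := hle.2 c hc
  have hcN := mem_range.1 hc
  have hc1 : m a c ≠ 0 := by
    by_contra hcon
    simp only [hg] at hcle
    rw [if_neg (not_not.2 hcon)] at hcle
    simp only [hg] at h1
    omega
  have hc2 : ¬(dst μ v c - (m a c - 1) - near (μ 0 0) (dst μ) (m a) v ≠ 0) := by
    intro hcon
    simp only [hg] at hcle
    rw [if_pos hc1, if_pos hcon] at hcle
    simp only [hg] at h1
    omega
  have hgc : g c = c := by simp only [hg]; rw [if_pos hc1, if_neg hc2]
  have hfin : (range (μ 0 0)).fold min (μ 0 0) g = c := by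
    rw [hgc] at hcle hcg; exact le_antisymm hcg hcle
  rw [hfin]
  refine ⟨hcN, hc1, ?_, fun z hz hRz => near_le hz hRz⟩
  have := near_le (D := dst μ) (v := v) hcN hc1
  omega

theorem saveS_spec {μ m : Mem} (hm : Base μ m) (hF : Feas μ (m 19))
    (h32 : m 32 0 = cost' μ (m 19)) (ρ : ℕ → ℕ) :
    BestInv μ (saveS.run ρ m) ∧ saveS.run ρ m 12 0 = cost' μ (m 19) + 1 := by
  simp only [saveS, block, run_seq]
  set m1 := (setCell 12 (.add (cell 32) (.num 1))).run ρ m with hm1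
  have b1 : Base μ m1 := hm.run (sc := []) rfl ρ
  have h12 : m1 12 0 = cost' μ (m 19) + 1 :=
    (set_apply _ _ _ _).trans (by simp only [E.eval, h32])
  have f19 : m1 19 = m 19 := S.run_frame rfl _ _
  set m2 := (fill .n 11 0 (at' 19 0)).run ρ m1 with hm2
  have f12 : m2 12 = m1 12 := S.run_frame rfl _ _
  have h11 : ∀ x < μ 0 0, m 19 x = m2 11 x := fun x hx => by
    rw [hm2, fill_apply rfl _ (by rwa [b1.val_n])]
    simp only [E.eval, Function.update_self, f19]
  rw [f12]
  refine ⟨Or.inr ⟨hF.congr h11, ?_⟩, h12⟩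
  rw [f12, h12, cost', cost_congr h11]

/-- A candidate that opens no facility, too many of them, or one outside `F` is ignored, but the
number of open facilities is recorded in any case, as the bisection branches on it. -/
theorem consider_spec {μ m : Mem} (hm : Base μ m)
    (hW : ∀ v < μ 0 0, ∀ x < μ 0 0, dst μ v x ≤ μ 10 0) (hbest : BestInv μ m) (ρ : ℕ → ℕ) :
    BestInv μ (considerS.run ρ m) ∧ (∀ c, Seen m c → Seen (considerS.run ρ m) c) ∧
      (Feas μ (m 19) → Seen (considerS.run ρ m) (cost' μ (m 19))) ∧
      considerS.run ρ m 29 0 = #(opened (μ 0 0) (m 19)) := by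
  simp only [considerS, block, run_seq]
  set m1 := (fill .n 31 0 (nearE 19)).run ρ m with hm1
  have b1 : Base μ m1 := hm.run (sc := []) rfl ρ
  set m2 := (setCell 32 (.add (.fold .sum .n 1 (.num 0)
    (.mul (.sub (at' 19 1) (.num 1)) 0 (.num 2))) (sumPts 0 (at' 31 0)))).run ρ m1 with hm2
  have b2 : Base μ m2 := b1.run (sc := []) rfl ρ
  set m3 := (setCell 29 (.fold .sum .n 1 (.num 0)
    (.ite (at' 19 1) (.num 1) (.num 0)))).run ρ m2 with hm3
  have b3 : Base μ m3 := b2.run (sc := []) rfl ρ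
  have f19 : m2 19 = m 19 := (S.run_frame rfl _ _).trans (S.run_frame rfl _ _)
  have g19 : m3 19 = m 19 := (S.run_frame rfl _ _).trans f19
  have g12 : m3 12 = m 12 :=
    ((S.run_frame rfl _ _).trans (S.run_frame rfl _ _)).trans (S.run_frame rfl _ _)
  have g11 : m3 11 = m 11 :=
    ((S.run_frame rfl _ _).trans (S.run_frame rfl _ _)).trans (S.run_frame rfl _ _)
  have g32 : m3 32 = m2 32 := S.run_frame rfl _ _
  have h29 : m3 29 0 = #(opened (μ 0 0) (m 19)) := by
    refine (set_apply _ _ _ _).trans ?_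
    rw [eval_sum, b2.val_n]
    simp only [E.eval, Function.update_self, f19]
    rw [opened, card_filter]
  have h32 : 1 ≤ #(opened (μ 0 0) (m 19)) → m3 32 0 = cost' μ (m 19) := by
    intro hpos
    obtain ⟨y, hy⟩ := card_pos.1 hpos
    obtain ⟨hyN, hyR⟩ := mem_opened.1 hy
    rw [g32]
    refine (set_apply _ _ _ _).trans ?_
    simp only [E.eval.eq_4, eval_sum, b1.val_n, eval_sumPts b1]
    unfold cost' cost
    congr 1
    · refine sum_congr rfl fun x _ => ?_
      have : m1 19 = m 19 := S.run_frame rfl _ _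
      simp only [E.eval, Function.update_self, this, b1 0 rfl]
      rw [mul_comm]
    · refine sum_congr rfl fun p hp => ?_
      have hpN := mem_range.1 (pts_subset μ hp)
      simp only [E.eval, Function.update_self]
      rw [hm1, fill_apply rfl _ (by rwa [hm.val_n]), eval_nearE hm p ρ (hW p hpN) hyN hyR]
  have hbest3 : BestInv μ m3 := by unfold BestInv; rw [g12, g11]; exact hbest
  have hseen3 : ∀ c, Seen m c → Seen m3 c := fun c h => by unfold Seen; rw [g12]; exact h
  have hF : Feas μ (m 19) ↔ (E.fold .sum .n 1 (.num 0)
      (.ite (at' 19 1) (.ite (at' 2 1) (.num 0) (.num 1)) (.num 0))).eval ρ m3 = 0 ∧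
      (cell 29).eval ρ m3 ≠ 0 ∧ (E.sub (.add (.get 0 (.num 1)) (.num 1)) (cell 29)).eval ρ m3 ≠ 0 := by
    rw [eval_sum, b3.val_n, sum_eq_zero_iff]
    simp only [E.eval, Function.update_self, g19, b3 2 rfl, b3 0 rfl, h29]
    constructor
    · rintro ⟨h1, h2, h3⟩
      refine ⟨fun x hx => ?_, by omega, by omega⟩
      have := h3 x (mem_range.1 hx)
      by_cases h : m 19 x = 0 <;> simp_all
    · rintro ⟨h1, h2, h3⟩
      refine ⟨by omega, by omega, fun x hx hR => ?_⟩
      have := h1 x (mem_range.2 hx)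
      intro h; simp [h, hR] at this
  have hskip : ∀ m', m' = m3 → ¬Feas μ (m 19) → BestInv μ m' ∧ (∀ c, Seen m c → Seen m' c) ∧
      (Feas μ (m 19) → Seen m' (cost' μ (m 19))) ∧ m' 29 0 = #(opened (μ 0 0) (m 19)) := by
    rintro _ rfl h
    exact ⟨hbest3, hseen3, fun h' => absurd h' h, h29⟩
  by_cases hFe : Feas μ (m 19)
  · obtain ⟨e1, e2, e3⟩ := hF.1 hFe
    have h32' := h32 hFe.pos
    have hsave := saveS_spec b3 (by rwa [g19]) (by rw [g19]; exact h32') ρ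
    rw [g19] at hsave
    have s29 : saveS.run ρ m3 29 = m3 29 := S.run_frame rfl _ _
    rw [run_ite, if_neg (not_not.2 e1), run_ite, if_pos e2, run_ite, if_pos e3, run_ite]
    have e12 : (cell 12).eval ρ m3 = m 12 0 := by simp only [E.eval, g12]
    have e12' : (E.sub (cell 12) (.add (cell 32) (.num 1))).eval ρ m3
        = m 12 0 - (cost' μ (m 19) + 1) := by simp only [E.eval, g12, h32']
    rw [e12, run_ite, e12']
    split_ifs with c1 c2
    · refine ⟨hsave.1, fun c hc => ⟨by omega, ?_⟩, fun _ => ⟨by omega, by omega⟩, by rw [s29, h29]⟩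
      have := hc.2; omega
    · refine ⟨hbest3, hseen3, fun _ => ?_, h29⟩
      unfold Seen S.run
      rw [g12]; exact ⟨c1, by omega⟩
    · refine ⟨hsave.1, fun c hc => absurd hc.1 c1, fun _ => ⟨by omega, by omega⟩, by rw [s29, h29]⟩
  · by_cases c1 : (E.fold .sum .n 1 (.num 0)
        (.ite (at' 19 1) (.ite (at' 2 1) (.num 0) (.num 1)) (.num 0))).eval ρ m3 = 0
    · rw [run_ite, if_neg (not_not.2 c1)]
      by_cases c2 : (cell 29).eval ρ m3 = 0
      · rw [run_ite, if_neg (not_not.2 c2)]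
        exact hskip _ rfl hFe
      · rw [run_ite, if_pos c2, run_ite, if_neg fun c3 => hFe (hF.2 ⟨c1, c2, c3⟩)]
        exact hskip _ rfl hFe
    · rw [run_ite, if_pos c1]
      exact hskip _ rfl hFe

end Clustering

namespace Clustering

/-! ### The bisection for the multiplier. -/

open ArrayLang Finset RAM

/-- The statement does not lose the best solution found so far. -/
def Keeps (μ : Mem) (p : S) : Prop := ∀ m ρ, Base μ m → BestInv μ m →
  Base μ (p.run ρ m) ∧ BestInv μ (p.run ρ m) ∧ ∀ c, Seen m c → Seen (p.run ρ m) c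

theorem Keeps.of_writes {μ : Mem} {p : S} {sc : List ℕ} (hp : p.wf roSetup sc)
    (h11 : p.writes 11 = false) (h12 : p.writes 12 = false) : Keeps μ p := by
  intro m ρ hm hb
  refine ⟨hm.run hp ρ, ?_, fun c hc => ?_⟩
  · unfold BestInv; rwa [S.run_frame h11, S.run_frame h12]
  · unfold Seen; rwa [S.run_frame h12]

theorem Keeps.seq {μ : Mem} {p q : S} (hp : Keeps μ p) (hq : Keeps μ q) : Keeps μ (.seq p q) := by
  intro m ρ hm hb
  obtain ⟨h1, h2, h3⟩ := hp m ρ hm hb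
  obtain ⟨h4, h5, h6⟩ := hq _ ρ h1 h2
  exact ⟨h4, h5, fun c hc => h6 c (h3 c hc)⟩

theorem Keeps.iter {μ : Mem} {p : S} (hp : Keeps μ p) (n : ℕ) (f : ℕ → ℕ → ℕ) {m : Mem}
    (hm : Base μ m) (hb : BestInv μ m) :
    Base μ (iter n (fun i m => p.run (f i) m) m) ∧
      BestInv μ (ArrayLang.iter n (fun i m => p.run (f i) m) m) ∧
      ∀ c, Seen m c → Seen (ArrayLang.iter n (fun i m => p.run (f i) m) m) c := by
  refine iter_inv (fun _ m' => Base μ m' ∧ BestInv μ m' ∧ ∀ c, Seen m c → Seen m' c)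
    ⟨hm, hb, fun _ h => h⟩ ?_
  rintro i - m' ⟨h1, h2, h3⟩
  obtain ⟨h4, h5, h6⟩ := hp m' (f i) h1 h2
  exact ⟨h4, h5, fun c hc => h6 c (h3 c hc)⟩

theorem Keeps.rep {μ : Mem} {p : S} (hp : Keeps μ p) (d : Range) (v : ℕ) : Keeps μ (.rep d v p) :=
  fun m ρ hm hb => hp.iter (d.val m) (fun i => Function.update ρ v i) hm hb

theorem Keeps.bits {μ : Mem} {p : S} (hp : Keeps μ p) (a v : ℕ) : Keeps μ (.bits a v p) :=
  fun m ρ hm hb => hp.iter _ (fun i => Function.update ρ v (m a 0 / 2 ^ i)) hm hb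

/-- The properties of the result of `setupS` that are needed. -/
structure Ready (μ : Mem) : Prop where
  isDist : IsDist (μ 0 0) (dst μ)
  nonempty : (pts μ).Nonempty
  bound : ∃ Q, (∀ u < μ 0 0, ∀ v < μ 0 0, dst μ u v ≤ Q) ∧ μ 0 0 * Q + μ 0 0 + 1 < μ 9 0 ∧
    μ 9 0 + μ 0 2 * Q + Q < μ 10 0

theorem Ready.dst_le {μ : Mem} (h : Ready μ) : ∀ v < μ 0 0, ∀ x < μ 0 0, dst μ v x ≤ μ 10 0 := by
  obtain ⟨Q, h1, h2, h3⟩ := h.bound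
  intro v hv x hx
  have := h1 v hv x hx
  omega

theorem keeps_considerS {μ : Mem} (h : Ready μ) : Keeps μ considerS := fun _ ρ hm hb =>
  ⟨hm.run (sc := []) rfl ρ, (consider_spec hm h.dst_le hb ρ).1, (consider_spec hm h.dst_le hb ρ).2.1⟩

theorem keeps_bisectS {μ : Mem} (h : Ready μ) : Keeps μ bisectS :=
  .seq (.of_writes (sc := []) rfl rfl rfl) <| .seq (.of_writes (sc := []) rfl rfl rfl) <|
    .seq (.of_writes (sc := []) rfl rfl rfl) <| .seq (keeps_considerS h) <|
    .of_writes (sc := []) rfl rfl rfl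

theorem keeps_mergeStepS {μ : Mem} (h : Ready μ) : Keeps μ mergeStepS :=
  .seq (.of_writes (sc := [53]) rfl rfl rfl) <| .seq (.of_writes (sc := [53]) rfl rfl rfl) <|
    .seq (.of_writes (sc := []) rfl rfl rfl) (keeps_considerS h)

theorem keeps_guessS {μ : Mem} (h : Ready μ) : Keeps μ guessS :=
  .seq (.of_writes (sc := [54]) rfl rfl rfl) <| .seq (.of_writes (sc := []) rfl rfl rfl) <|
    .seq (.of_writes (sc := []) rfl rfl rfl) <| .seq ((keeps_bisectS h).bits _ _) <|
    .seq (.of_writes (sc := []) rfl rfl rfl) ((keeps_mergeStepS h).rep _ _)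

/-- A solution with the set `Y` of centers, the assignment `σ` and the radii `r`. -/
structure Target (μ : Mem) (Y : Finset ℕ) (σ r : ℕ → ℕ) : Prop where
  lt : ∀ x ∈ Y, x < μ 0 0
  mem : ∀ x ∈ Y, μ 2 x ≠ 0
  maps : ∀ p ∈ pts μ, σ p ∈ Y
  rad : ∀ x ∈ Y, ∃ v < μ 0 0, r x = dst μ x v
  le : #Y ≤ μ 0 1

/-- The cost of such a solution. -/
abbrev targetCost (μ : Mem) (Y : Finset ℕ) (σ r : ℕ → ℕ) : ℕ :=
  ∑ x ∈ Y, μ 0 2 * r x + ∑ p ∈ pts μ, (dst μ p (σ p) - r (σ p))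

/-- `R` is a good solution for the multiplier `lam`, compared with a solution of cost `U` with `y`
centers. -/
structure Good (μ : Mem) (U y r lam : ℕ) (R : ℕ → ℕ) : Prop where
  cost_le : cost' μ R + 3 * lam * #(opened (μ 0 0) R)
    ≤ 3 * (U + lam * y) + 3 * μ 0 0 * (μ 0 0 * μ 0 0)
  mem : ∀ x < μ 0 0, R x ≠ 0 → μ 2 x ≠ 0
  rad : ∀ x < μ 0 0, R x ≤ 3 * r + 1
  pos : 1 ≤ #(opened (μ 0 0) R)
  le_one : μ 9 0 ≤ lam + 1 → #(opened (μ 0 0) R) ≤ 1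

theorem round_spec {μ m : Mem} (hm : Base μ m) (h : Ready μ) (hbs : (balls μ (m 13 0)).Nonempty)
    (hlam : m 18 0 ≤ μ 9 0) (ρ : ℕ → ℕ) :
    ∃ T A sel, PrimalDual (μ 0 0) (pts μ) (dst μ) (μ 0 2) (m 18 0) (balls μ (m 13 0)) T A sel ∧
      Tripled (μ 0 0) (dst μ) sel (selectS.run ρ (dualS.run ρ m) 19) := by
  obtain ⟨Q, q1, q2, q3⟩ := h.bound
  obtain ⟨τ, hinv, hfeas⟩ := dual_spec hm (by omega) ρ
  set m1 := dualS.run ρ m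
  have b1 : Base μ m1 := hm.run (sc := []) rfl ρ
  have hsub := balls_subset μ (m 13 0)
  have hdiv : ∀ {b}, b < μ 0 0 * μ 0 0 → b / μ 0 0 < μ 0 0 ∧ b % μ 0 0 < μ 0 0 := fun {b} hb => by
    have hN : 0 < μ 0 0 := Nat.pos_of_ne_zero fun h0 => by rw [h0] at hb; omega
    exact ⟨Nat.div_lt_of_lt_mul hb, Nat.mod_lt _ hN⟩
  have hbd : ∀ b < μ 0 0 * μ 0 0, ∀ p ∈ pts μ, bdist (μ 0 0) (dst μ) p b ≤ Q := fun b hb p hp =>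
    (Nat.sub_le _ _).trans (q1 _ (mem_range.1 (pts_subset μ hp)) _ (hdiv hb).1)
  obtain ⟨sel, s1, s2, s3⟩ := select_spec b1
    (paid := (balls μ (m 13 0)).filter fun b => m1 20 b ≠ μ 10 0) (fun b hb => by
      rw [mem_filter]
      refine ⟨fun hlt => ⟨?_, hlt.ne⟩, fun hb' => ?_⟩
      · by_contra hcon
        exact hlt.ne (hinv.not_mem b hb hcon)
      · exact (hinv.le b hb'.1 hb'.2).trans_lt hinv.lt) ((filter_subset _ _).trans hsub) ρ
  refine ⟨_, _, sel, primalDual_of_inv hsub hbs (fun b hb p hp => ?_) (fun b hb p hp => ?_) hinv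
    hfeas s1 s2, s3⟩
  · have hb' := mem_range.1 (hsub hb)
    have h1 := hbd b hb' p hp
    have h2 : brad (μ 0 0) (dst μ) b ≤ Q := q1 _ (hdiv hb').1 _ (hdiv hb').2
    have h3 := Nat.mul_le_mul_left (μ 0 2) h2
    omega
  · have := hbd b hb p hp
    omega

/-- With the radius guessed correctly, all balls of the target are candidates, so the dual solution
is feasible for them and weak duality compares the two costs. -/
theorem good_of_round {μ m : Mem} (hm : Base μ m) (h : Ready μ) {Y : Finset ℕ} {σ r : ℕ → ℕ}
    (ht : Target μ Y σ r) (hr : m 13 0 = Y.sup r) (hlam : m 18 0 ≤ μ 9 0) (ρ : ℕ → ℕ) :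
    Good μ (targetCost μ Y σ r) #Y (Y.sup r) (m 18 0) (selectS.run ρ (dualS.run ρ m) 19) := by
  have hball : ∀ x ∈ Y, ∃ b ∈ balls μ (m 13 0), b / μ 0 0 = x ∧ brad (μ 0 0) (dst μ) b = r x := by
    intro x hx
    obtain ⟨v, hv, hrx⟩ := ht.rad x hx
    have hxN := ht.lt x hx
    have hdiv : (x * μ 0 0 + v) / μ 0 0 = x := by
      rw [add_comm, Nat.add_mul_div_right _ _ (by omega), Nat.div_eq_of_lt hv, zero_add]
    -- The ball with center `x` and radius the distance from `x` to `v` has the number `x * N + v`.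
    refine ⟨x * μ 0 0 + v, mem_filter.2 ⟨mem_range.2 ?_, ?_, ?_⟩, hdiv, ?_⟩
    · calc x * μ 0 0 + v < (x + 1) * μ 0 0 := by rw [add_mul]; omega
        _ ≤ μ 0 0 * μ 0 0 := Nat.mul_le_mul_right _ hxN
    · rw [hdiv]; exact ht.mem x hx
    · rw [hr, ← show r x = μ 8 (x * μ 0 0 + v) from hrx]; exact le_sup hx
    · rw [brad_dst]; exact hrx.symm
  obtain ⟨p₀, hp₀⟩ := h.nonempty
  obtain ⟨b₀, hb₀, -⟩ := hball _ (ht.maps p₀ hp₀)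
  obtain ⟨T, A, sel, hpd, htr⟩ := round_spec hm h ⟨b₀, hb₀⟩ hlam ρ
  set R := selectS.run ρ (dualS.run ρ m) 19
  have hsub := balls_subset μ (m 13 0)
  have h1 := hpd.cost_le h.isDist (pts_subset μ) hsub htr
  have h2 := sum_le_of_dual_feasible (D := dst μ) (l := μ 0 2) (lam := m 18 0) (r := r) (A := A)
    ht.maps fun x hx => by
      obtain ⟨b, hb, hbx, hbr⟩ := hball x hx
      have := hpd.feasible b hb
      rw [hbr] at this
      refine le_trans (le_of_eq (sum_congr rfl fun p _ => ?_)) this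
      rw [← hbr, ← hbx]; rfl
  refine ⟨?_, fun x hx hR => ?_, fun x hx => ?_, ?_, fun hle => ?_⟩
  · unfold targetCost cost'; omega
  · obtain ⟨b, hb, hbx, -⟩ := htr.eq x hx hR
    rw [← hbx]; exact (mem_filter.1 (hpd.subset hb)).2.1
  · by_cases hR : R x = 0
    · omega
    · obtain ⟨b, hb, -, hRx⟩ := htr.eq x hx hR
      have h3 := (mem_filter.1 (hpd.subset hb)).2.2
      rw [brad_dst] at hRx
      omega
  · obtain ⟨b, -, -, -, b', hb', -⟩ := hpd.dominated p₀ hp₀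
    refine card_pos.2 ⟨b' / μ 0 0, mem_opened.2 ⟨?_, ?_⟩⟩
    · exact Nat.div_lt_of_lt_mul (mem_range.1 (hsub (hpd.subset hb')))
    · have := htr.le b' hb'; omega
  · obtain ⟨Q, q1, q2, -⟩ := h.bound
    exact hpd.card_opened_le_one (pts_subset μ) hsub q1 (by omega) htr

theorem Good.congr {μ : Mem} {U y r lam : ℕ} {R R' : ℕ → ℕ} (h : Good μ U y r lam R)
    (hR : ∀ x < μ 0 0, R x = R' x) : Good μ U y r lam R' := by
  have h1 := opened_congr hR
  refine ⟨?_, fun x hx hx' => h.mem x hx (by rwa [hR x hx]), fun x hx => hR x hx ▸ h.rad x hx,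
    h1 ▸ h.pos, h1 ▸ h.le_one⟩
  have := h.cost_le
  rwa [cost', cost_congr hR, h1] at this

/-- The state of the search for the multiplier. -/
structure BisectInv (μ : Mem) (U y r n : ℕ) (m : Mem) : Prop where
  base : Base μ m
  best : BestInv μ m
  rad : m 13 0 = r
  le : m 14 0 ≤ m 15 0
  le_top : m 15 0 ≤ μ 9 0
  gap : m 15 0 - m 14 0 ≤ 2 ^ n
  hi : m 15 0 = μ 9 0 ∨ (Good μ U y r (m 15 0) (m 16) ∧ #(opened (μ 0 0) (m 16)) ≤ μ 0 1 ∧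
    Seen m (cost' μ (m 16)))
  lo : m 14 0 = 0 ∨ (Good μ U y r (m 14 0) (m 17) ∧ μ 0 1 < #(opened (μ 0 0) (m 17)))

/-- A round with at most `k` facilities lowers the upper multiplier and is kept as a candidate; one
with more raises the lower multiplier. The extreme values `0` and `μ 9 0` are never tried out, so
they may come without a solution. -/
theorem BisectInv.step {μ m : Mem} (h : Ready μ) {Y : Finset ℕ} {σ r : ℕ → ℕ}
    (ht : Target μ Y σ r) {n : ℕ}
    (hi : BisectInv μ (targetCost μ Y σ r) #Y (Y.sup r) (n + 1) m) (ρ : ℕ → ℕ) :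
    BisectInv μ (targetCost μ Y σ r) #Y (Y.sup r) n (bisectS.run ρ m) := by
  obtain ⟨base, best, rad, le, le_top, gap, ihi, ilo⟩ := hi
  have hkeep := keeps_bisectS h m ρ base best
  have g13 : bisectS.run ρ m 13 = m 13 := S.run_frame rfl _ _
  revert hkeep g13
  simp only [bisectS, block, run_seq]
  set m1 := (setCell 18 (.div (.add (cell 14) (cell 15)) (.num 2))).run ρ m
  have b1 : Base μ m1 := base.run (sc := []) rfl ρ
  have h18 : m1 18 0 = (m 14 0 + m 15 0) / 2 := set_apply _ _ _ _
  have f13 : m1 13 = m 13 := S.run_frame rfl _ _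
  have hgood := good_of_round b1 h ht (by rw [f13, rad]) (by omega) ρ
  rw [h18] at hgood
  set lam := (m 14 0 + m 15 0) / 2 with hlam
  set m2 := dualS.run ρ m1
  have b2 : Base μ m2 := b1.run (sc := []) rfl ρ
  set m3 := selectS.run ρ m2
  have b3 : Base μ m3 := b2.run (sc := []) rfl ρ
  have best3 : BestInv μ m3 := by
    unfold BestInv
    rw [show m3 11 = m 11 from
        ((S.run_frame rfl _ _).trans (S.run_frame rfl _ _)).trans (S.run_frame rfl _ _),
      show m3 12 = m 12 from
        ((S.run_frame rfl _ _).trans (S.run_frame rfl _ _)).trans (S.run_frame rfl _ _)]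
    exact best
  obtain ⟨-, -, c3, c4⟩ := consider_spec b3 h.dst_le best3 ρ
  set m4 := considerS.run ρ m3
  have b4 : Base μ m4 := b3.run (sc := []) rfl ρ
  have frame : ∀ a, considerS.writes a = false → selectS.writes a = false →
      dualS.writes a = false → a ≠ 18 → m4 a = m a := fun a e1 e2 e3 e4 =>
    (((S.run_frame e1 _ _).trans (S.run_frame e2 _ _)).trans (S.run_frame e3 _ _)).trans
      (S.run_frame (by simpa [S.writes] using e4) _ _)
  have f14 : m4 14 = m 14 := frame 14 rfl rfl rfl (by decide)
  have f15 : m4 15 = m 15 := frame 15 rfl rfl rfl (by decide)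
  have f16 : m4 16 = m 16 := frame 16 rfl rfl rfl (by decide)
  have f17 : m4 17 = m 17 := frame 17 rfl rfl rfl (by decide)
  have f19 : m4 19 = m3 19 := S.run_frame rfl _ _
  have f18 : m4 18 0 = lam := by
    rw [← h18]
    exact congrFun (((S.run_frame rfl _ _).trans (S.run_frame rfl _ _)).trans
      (S.run_frame rfl _ _)) 0
  rw [run_ite]
  have hc : (E.sub (.add (.get 0 (.num 1)) (.num 1)) (cell 29)).eval ρ m4
      = μ 0 1 + 1 - #(opened (μ 0 0) (m3 19)) := by
    simp only [E.eval, c4, b4 0 rfl]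
  rw [hc]
  have hpow : 2 ^ (n + 1) = 2 * 2 ^ n := by ring
  split_ifs with hk
  · have hk' : #(opened (μ 0 0) (m3 19)) ≤ μ 0 1 := by omega
    simp only [run_seq]
    set m5 := (setCell 15 (cell 18)).run ρ m4
    have b5 : Base μ m5 := b4.run (sc := []) rfl ρ
    have e15 : m5 15 0 = lam := (set_apply _ _ _ _).trans f18
    have e19 : m5 19 = m3 19 := (S.run_frame rfl _ _).trans f19
    set m6 := (fill .n 16 0 (at' 19 0)).run ρ m5 with hm6
    have g14 : m6 14 = m 14 := ((S.run_frame rfl _ _).trans (S.run_frame rfl _ _)).trans f14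
    have g17 : m6 17 = m 17 := ((S.run_frame rfl _ _).trans (S.run_frame rfl _ _)).trans f17
    have g12 : m6 12 = m4 12 := (S.run_frame rfl _ _).trans (S.run_frame rfl _ _)
    have g15 : m6 15 0 = lam := (congrFun (S.run_frame rfl _ _) 0).trans e15
    have g16 : ∀ x < μ 0 0, m3 19 x = m6 16 x := fun x hx => by
      rw [hm6, fill_apply rfl _ (by rwa [b5.val_n])]
      simp only [E.eval, Function.update_self, e19]
    intro ⟨k1, k2, k3⟩ k13
    refine ⟨k1, k2, by rw [k13, rad], by rw [g14, g15]; omega, by rw [g15]; omega,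
      by rw [g14, g15]; omega, Or.inr ?_, by rw [g14, g17]; exact ilo⟩
    rw [g15]
    refine ⟨hgood.congr g16, by rwa [← opened_congr g16], ?_⟩
    rw [cost', ← cost_congr g16]
    unfold Seen
    rw [g12]
    exact c3 ⟨hgood.pos, hk', hgood.mem⟩
  · have hk' : μ 0 1 < #(opened (μ 0 0) (m3 19)) := by omega
    simp only [run_seq]
    set m5 := (setCell 14 (cell 18)).run ρ m4
    have b5 : Base μ m5 := b4.run (sc := []) rfl ρ
    have e14 : m5 14 0 = lam := (set_apply _ _ _ _).trans f18
    have e19 : m5 19 = m3 19 := (S.run_frame rfl _ _).trans f19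
    set m6 := (fill .n 17 0 (at' 19 0)).run ρ m5 with hm6
    have g15 : m6 15 = m 15 := ((S.run_frame rfl _ _).trans (S.run_frame rfl _ _)).trans f15
    have g16 : m6 16 = m 16 := ((S.run_frame rfl _ _).trans (S.run_frame rfl _ _)).trans f16
    have g14 : m6 14 0 = lam := (congrFun (S.run_frame rfl _ _) 0).trans e14
    have g17 : ∀ x < μ 0 0, m3 19 x = m6 17 x := fun x hx => by
      rw [hm6, fill_apply rfl _ (by rwa [b5.val_n])]
      simp only [E.eval, Function.update_self, e19]
    intro ⟨k1, k2, k3⟩ k13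
    refine ⟨k1, k2, by rw [k13, rad], by rw [g14, g15]; omega, by rw [g15]; omega,
      by rw [g14, g15]; omega, ?_, Or.inr ?_⟩
    · rw [g15, g16]
      exact ihi.imp id fun ⟨i1, i2, i3⟩ => ⟨i1, i2, k3 _ i3⟩
    · rw [g14]
      exact ⟨hgood.congr g17, by rwa [← opened_congr g17]⟩

theorem bisect_spec {μ m : Mem} (h : Ready μ) {Y : Finset ℕ} {σ r : ℕ → ℕ} (ht : Target μ Y σ r)
    (hm : Base μ m) (hb : BestInv μ m) (hr : m 13 0 = Y.sup r) (h14 : m 14 0 = 0)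
    (h15 : m 15 0 = μ 9 0) (ρ : ℕ → ℕ) :
    BisectInv μ (targetCost μ Y σ r) #Y (Y.sup r) 0 ((S.bits 9 52 bisectS).run ρ m) := by
  set n := (m 9 0).size with hn
  let I : ℕ → Mem → Prop := fun j m' => BisectInv μ (targetCost μ Y σ r) #Y (Y.sup r) (n - j) m'
  have key : I n ((S.bits 9 52 bisectS).run ρ m) := by
    refine iter_inv I ?_ ?_
    · refine ⟨hm, hb, hr, by omega, h15.le, ?_, Or.inl h15, Or.inl h14⟩
      have : m 9 0 < 2 ^ n := Nat.lt_size_self _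
      rw [hm 9 rfl] at this
      rw [Nat.sub_zero]; omega
    · intro j hj m' hi
      change BisectInv _ _ _ _ (n - j) m' at hi
      rw [show n - j = n - (j + 1) + 1 by omega] at hi
      exact hi.step h ht _
  change BisectInv _ _ _ _ (n - n) _ at key
  rwa [Nat.sub_self] at key

end Clustering

namespace Clustering

/-! ### The program for merging two solutions. -/

open ArrayLang Finset RAM

/-- The result of `prepareS`. -/
structure Prepared (μ m : Mem) : Prop where
  base : Base μ m
  near₁ : ∀ v < μ 0 0, IsNear (μ 0 0) (dst μ) (m 16) v (m 33 v) (m 34 v)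
  near₂ : ∀ v < μ 0 0, IsNear (μ 0 0) (dst μ) (m 17) v (m 35 v) (m 36 v)
  close : ∀ j < μ 0 0, m 37 j = closeCost (pts μ) (m 35) (m 34) (m 36) j
  size : ∀ i < μ 0 0, m 38 i = #(group (μ 0 0) (m 17) (m 33) i)
  weight : ∀ i < μ 0 0, m 39 i = mergeCost (μ 0 0) (μ 0 2) (m 16) (m 17) (m 33)
    (closeCost (pts μ) (m 35) (m 34) (m 36)) i

theorem eval_eqE (x y : E) (ρ : ℕ → ℕ) (m : Mem) :
    (eqE x y).eval ρ m = if x.eval ρ m = y.eval ρ m then 1 else 0 := by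
  change (if x.eval ρ m - y.eval ρ m ≠ 0 then 0 else
    if y.eval ρ m - x.eval ρ m ≠ 0 then 0 else 1) = _
  rcases lt_trichotomy (x.eval ρ m) (y.eval ρ m) with h | h | h
  · rw [if_neg (by omega), if_pos (by omega), if_neg (by omega)]
  · rw [if_neg (by omega), if_neg (by omega), if_pos h]
  · rw [if_pos (by omega), if_neg (by omega)]

theorem near_fill_spec {μ m : Mem} (hm : Base μ m) (h : Ready μ) {a a' : ℕ}
    (ha : (nearE a).reads a' = false) {y : ℕ} (hy : y < μ 0 0) (hR : m a y ≠ 0) (ρ : ℕ → ℕ) :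
    ∀ v < μ 0 0, (fill .n a' 0 (nearE a)).run ρ m a' v = near (μ 0 0) (dst μ) (m a) v :=
  fun v hv => by
    rw [fill_apply ha _ (by rwa [hm.val_n]), eval_nearE hm v ρ (h.dst_le v hv) hy hR]

theorem nearest_fill_spec {μ m : Mem} (hm : Base μ m) {a a' b : ℕ}
    (ha : (nearestE a a').reads b = false) {y : ℕ} (hy : y < μ 0 0) (hR : m a y ≠ 0)
    (hn : ∀ v < μ 0 0, m a' v = near (μ 0 0) (dst μ) (m a) v) (ρ : ℕ → ℕ) :
    ∀ v < μ 0 0, IsNear (μ 0 0) (dst μ) (m a) v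
      ((fill .n b 0 (nearestE a a')).run ρ m b v) (m a' v) := fun v hv => by
  rw [fill_apply ha _ (by rwa [hm.val_n]), hn v hv]
  exact eval_nearestE hm v ρ hy hR (hn v hv)

theorem prepare_spec {μ m : Mem} (hm : Base μ m) (h : Ready μ) {y₁ y₂ : ℕ} (hy₁ : y₁ < μ 0 0)
    (hR₁ : m 16 y₁ ≠ 0) (hy₂ : y₂ < μ 0 0) (hR₂ : m 17 y₂ ≠ 0) (ρ : ℕ → ℕ) :
    Prepared μ (prepareS.run ρ m) := by
  have f16 : prepareS.run ρ m 16 = m 16 := S.run_frame rfl _ _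
  have f17 : prepareS.run ρ m 17 = m 17 := S.run_frame rfl _ _
  have b : Base μ (prepareS.run ρ m) := hm.run (sc := []) rfl ρ
  revert f16 f17 b
  simp only [prepareS, block, run_seq]
  have n34 := near_fill_spec hm h (a := 16) (a' := 34) rfl hy₁ hR₁ ρ
  set m1 := (fill .n 34 0 (nearE 16)).run ρ m
  have b1 : Base μ m1 := hm.run (sc := []) rfl ρ
  have e1 : m1 16 = m 16 := S.run_frame rfl _ _
  have n33 := nearest_fill_spec b1 (a := 16) (a' := 34) (b := 33) rfl hy₁ (by rwa [e1])
    (by rwa [e1]) ρ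
  set m2 := (fill .n 33 0 (nearestE 16 34)).run ρ m1
  have b2 : Base μ m2 := b1.run (sc := []) rfl ρ
  have e2 : m2 17 = m 17 := (S.run_frame rfl _ _).trans (S.run_frame rfl _ _)
  have n36 := near_fill_spec b2 h (a := 17) (a' := 36) rfl hy₂ (by rwa [e2]) ρ
  set m3 := (fill .n 36 0 (nearE 17)).run ρ m2
  have b3 : Base μ m3 := b2.run (sc := []) rfl ρ
  have e3 : m3 17 = m2 17 := S.run_frame rfl _ _
  have n35 := nearest_fill_spec b3 (a := 17) (a' := 36) (b := 35) rfl hy₂ (by rwa [e3, e2])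
    (by rwa [e3]) ρ
  set m4 := (fill .n 35 0 (nearestE 17 36)).run ρ m3
  have b4 : Base μ m4 := b3.run (sc := []) rfl ρ
  set m5 := (fill .n 37 0 (sumPts 1 (.ite (eqE (at' 35 1) (.var 0)) (.add (at' 34 1) (at' 36 1))
    (.num 0)))).run ρ m4 with hm5
  have b5 : Base μ m5 := b4.run (sc := []) rfl ρ
  have n37 : ∀ j < μ 0 0, m5 37 j = closeCost (pts μ) (m4 35) (m4 34) (m4 36) j := fun j hj => by
    rw [hm5, fill_apply rfl _ (by rwa [b4.val_n]), eval_sumPts b4, closeCost,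
      sum_filter (s := pts μ)]
    refine sum_congr rfl fun p _ => ?_
    simp only [E.eval, eval_eqE, Function.update_self,
      Function.update_of_ne (show (0 : ℕ) ≠ 1 by decide)]
    split_ifs <;> simp_all
  set m6 := (fill .n 38 0 (.fold .sum .n 1 (.num 0) (.ite (at' 17 1) (eqE (at' 33 1) (.var 0))
    (.num 0)))).run ρ m5 with hm6
  have b6 : Base μ m6 := b5.run (sc := []) rfl ρ
  have n38 : ∀ i < μ 0 0, m6 38 i = #(group (μ 0 0) (m5 17) (m5 33) i) := fun i hi => by
    rw [hm6, fill_apply rfl _ (by rwa [b5.val_n]), eval_sum, b5.val_n, group, opened,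
      filter_filter, card_filter]
    refine sum_congr rfl fun j _ => ?_
    simp only [E.eval, eval_eqE, Function.update_self,
      Function.update_of_ne (show (0 : ℕ) ≠ 1 by decide)]
    split_ifs <;> simp_all
  set m7 := (fill .n 39 0 (.add (.mul (.add (.sub (at' 16 0) (.num 1)) (.fold .max .n 1 (.num 0)
       (.ite (at' 17 1) (.ite (eqE (at' 33 1) (.var 0)) (.sub (at' 17 1) (.num 1)) (.num 0))
         (.num 0)))) 0 (.num 2))
     (.fold .sum .n 1 (.num 0) (.ite (at' 17 1) (.ite (eqE (at' 33 1) (.var 0)) (at' 37 1) (.num 0))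
         (.num 0))))).run ρ m6 with hm7
  have k37 : m6 37 = m5 37 := S.run_frame rfl _ _
  have n39 : ∀ i < μ 0 0, m7 39 i = mergeCost (μ 0 0) (μ 0 2) (m6 16) (m6 17) (m6 33)
      (closeCost (pts μ) (m4 35) (m4 34) (m4 36)) i := fun i hi => by
    rw [hm7, fill_apply rfl _ (by rwa [b6.val_n])]
    rw [E.eval.eq_4, E.eval.eq_7, E.eval.eq_4, eval_sum, eval_max, b6.val_n, mergeCost]
    congr 1
    · simp only [E.eval, eval_eqE, Function.update_self, b6 0 rfl,
        Function.update_of_ne (show (0 : ℕ) ≠ 1 by decide)]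
      rw [mul_comm]
      congr 2
      refine eq_of_forall_ge_iff fun c => ?_
      rw [fold_max_le, maxRad, Finset.sup_le_iff]
      simp only [group, opened, mem_filter, mem_range, and_imp]
      constructor
      · rintro ⟨-, h1⟩ j hj hRj hxj
        have := h1 j hj
        rwa [if_pos hRj, if_pos (by simp [hxj])] at this
      · refine fun h1 => ⟨Nat.zero_le _, fun j hj => ?_⟩
        have := h1 j hj
        split_ifs with c1 c2 c2 <;> simp_all
    · rw [group, opened, filter_filter, sum_filter]
      refine sum_congr rfl fun j hj => ?_
      simp only [E.eval, eval_eqE, Function.update_self,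
        Function.update_of_ne (show (0 : ℕ) ≠ 1 by decide), k37]
      have := n37 j (mem_range.1 hj)
      split_ifs <;> simp_all
  intro f16 f17 b
  have a33 : m7 33 = m2 33 :=
    (S.run_frame rfl _ _).trans <| (S.run_frame rfl _ _).trans <| (S.run_frame rfl _ _).trans <|
    (S.run_frame rfl _ _).trans <| S.run_frame rfl _ _
  have a34 : m7 34 = m1 34 :=
    (S.run_frame rfl _ _).trans <| (S.run_frame rfl _ _).trans <| (S.run_frame rfl _ _).trans <|
    (S.run_frame rfl _ _).trans <| (S.run_frame rfl _ _).trans <| S.run_frame rfl _ _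
  have a35 : m7 35 = m4 35 :=
    (S.run_frame rfl _ _).trans <| (S.run_frame rfl _ _).trans <| S.run_frame rfl _ _
  have a36 : m7 36 = m3 36 :=
    (S.run_frame rfl _ _).trans <| (S.run_frame rfl _ _).trans <| (S.run_frame rfl _ _).trans <|
    S.run_frame rfl _ _
  have a37 : m7 37 = m5 37 := (S.run_frame rfl _ _).trans <| S.run_frame rfl _ _
  have a38 : m7 38 = m6 38 := S.run_frame rfl _ _
  have c34 : m7 34 = m4 34 :=
    (S.run_frame rfl _ _).trans <| (S.run_frame rfl _ _).trans <| S.run_frame rfl _ _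
  have c36 : m7 36 = m4 36 :=
    (S.run_frame rfl _ _).trans <| (S.run_frame rfl _ _).trans <| S.run_frame rfl _ _
  have c17 : m7 17 = m5 17 := (S.run_frame rfl _ _).trans <| S.run_frame rfl _ _
  have c33 : m7 33 = m5 33 := (S.run_frame rfl _ _).trans <| S.run_frame rfl _ _
  have d16 : m7 16 = m6 16 := S.run_frame rfl _ _
  have d17 : m7 17 = m6 17 := S.run_frame rfl _ _
  have d33 : m7 33 = m6 33 := S.run_frame rfl _ _
  have u34 : m2 34 = m1 34 := S.run_frame rfl _ _
  have u36 : m4 36 = m3 36 := S.run_frame rfl _ _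
  rw [← c34, ← c36, ← a35] at n37 n39
  rw [← c17, ← c33] at n38
  rw [← d16, ← d17, ← d33] at n39
  refine ⟨b, ?_, ?_, ?_, ?_, n39⟩
  · rw [f16, ← e1, a33, a34]; exact n33
  · rw [f17, ← e2, ← e3, a35, a36]; exact n35
  · rw [a37]; exact n37
  · rw [a38]; exact n38

/-- The product is a sum of copies of `x`, one for each `i < y`; since `y` is at most the loop bound
`N`, no copy is lost. -/
theorem eval_prodE {μ m : Mem} (hm : Base μ m) (x y : E) {ρ : ℕ → ℕ}
    (hx : ∀ i, x.eval (Function.update ρ 1 i) m = x.eval ρ m)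
    (hy : ∀ i, y.eval (Function.update ρ 1 i) m = y.eval ρ m) (hyN : y.eval ρ m ≤ μ 0 0) :
    (prodE x y).eval ρ m = x.eval ρ m * y.eval ρ m := by
  rw [prodE, eval_sum, hm.val_n]
  have h1 : ∀ i, (E.ite (.sub y (.var 1)) x (.num 0)).eval (Function.update ρ 1 i) m
      = if i < y.eval ρ m then x.eval ρ m else 0 := by
    intro i
    have : (E.ite (.sub y (.var 1)) x (.num 0)).eval (Function.update ρ 1 i) m
      = if y.eval (Function.update ρ 1 i) m - Function.update ρ 1 i 1 ≠ 0 then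
        x.eval (Function.update ρ 1 i) m else 0 := rfl
    rw [this, hx, hy, Function.update_self]
    exact if_congr (by omega) rfl rfl
  rw [sum_congr rfl fun i _ => h1 i, ← sum_filter, sum_const, smul_eq_mul, mul_comm]
  congr 1
  rw [show (range (μ 0 0)).filter (fun i => i < y.eval ρ m) = range (y.eval ρ m) by
    ext i; simp only [mem_filter, mem_range]; omega, card_range]

theorem eval_beforeE {μ m : Mem} (hm : Base μ m) {w s : ℕ → ℕ} {i g : E} {ρ : ℕ → ℕ}
    (hi : ∀ z, i.eval (Function.update ρ 1 z) m = i.eval ρ m)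
    (hg : ∀ z, g.eval (Function.update ρ 1 z) m = g.eval ρ m)
    (hiw : m 39 (i.eval ρ m) = w (i.eval ρ m)) (hgw : m 39 (g.eval ρ m) = w (g.eval ρ m))
    (his : m 38 (i.eval ρ m) - 1 = s (i.eval ρ m)) (hgs : m 38 (g.eval ρ m) - 1 = s (g.eval ρ m))
    (hiN : s (i.eval ρ m) ≤ μ 0 0) (hgN : s (g.eval ρ m) ≤ μ 0 0) :
    (beforeE i g).eval ρ m ≠ 0 ↔ Before w s (i.eval ρ m) (g.eval ρ m) := by
  have e1 : (prodE (.get 39 g) (savingE i)).eval ρ m = w (g.eval ρ m) * s (i.eval ρ m) := by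
    rw [eval_prodE hm] <;> simp only [savingE, E.eval, hi, hg, hgw, his, implies_true, hiN]
  have e2 : (prodE (.get 39 i) (savingE g)).eval ρ m = w (i.eval ρ m) * s (g.eval ρ m) := by
    rw [eval_prodE hm] <;> simp only [savingE, E.eval, hi, hg, hiw, hgs, implies_true, hgN]
  have e3 : (beforeE i g).eval ρ m = if (prodE (.get 39 g) (savingE i)).eval ρ m
      - (prodE (.get 39 i) (savingE g)).eval ρ m ≠ 0 then 1 else
      if (eqE (prodE (.get 39 i) (savingE g)) (prodE (.get 39 g) (savingE i))).eval ρ m ≠ 0 then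
        g.eval ρ m - i.eval ρ m else 0 := rfl
  rw [e3, eval_eqE, e1, e2, Before]
  split_ifs <;> simp_all <;> omega

theorem saving_le (N : ℕ) (R x : ℕ → ℕ) (i : ℕ) : saving N R x i ≤ N := by
  have := card_le_card ((filter_subset (fun j => x j = i) (opened N R)).trans (filter_subset _ _))
  rw [card_range] at this
  exact (Nat.sub_le _ _).trans this

abbrev Closed' (μ m : Mem) (j₀ : ℕ) : ℕ → Prop :=
  Closed (μ 0 0) (μ 0 2) (m 16) (m 17) (m 33) (closeCost (pts μ) (m 35) (m 34) (m 36)) j₀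

theorem closedE_eq (ρ : ℕ → ℕ) (m : Mem) : closedE.eval ρ m = if m 17 (ρ 0) ≠ 0 then
    (if (if m 38 (m 33 (ρ 0)) - 1 ≠ 0 then (beforeE (at' 33 0) (cell 41)).eval ρ m else 0) ≠ 0
      then 1 else
      if (eqE (at' 33 0) (cell 41)).eval ρ m ≠ 0 then
        (if m 37 (ρ 53) - m 37 (ρ 0) ≠ 0 then 1 else
          if (eqE (at' 37 0) (at' 37 53)).eval ρ m ≠ 0 then
            (if ρ 0 - ρ 53 ≠ 0 then 0 else 1) else 0) else 0) else 0 := rfl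

/-- Stated for arbitrary numbers, so that the case analysis is separate from the evaluation of the
program. -/
theorem closed_ite_ne_zero (R s B x x₀ e e₀ j j₀ : ℕ) :
    (if R ≠ 0 then (if (if s - 1 ≠ 0 then B else 0) ≠ 0 then 1 else
      if (if x = x₀ then 1 else 0) ≠ 0 then (if e₀ - e ≠ 0 then 1 else
        if (if e = e₀ then 1 else 0) ≠ 0 then (if j - j₀ ≠ 0 then 0 else 1) else 0) else 0) else 0)
      ≠ 0 ↔ R ≠ 0 ∧ ((2 ≤ s ∧ B ≠ 0) ∨ (x = x₀ ∧ (e < e₀ ∨ (e = e₀ ∧ j ≤ j₀)))) := by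
  have t : ∀ (p : Prop) [Decidable p], ((if p then 1 else 0 : ℕ) ≠ 0) = p := fun p _ => by
    by_cases hp : p <;> simp [hp]
  have ts : ((if s - 1 ≠ 0 then B else 0) ≠ 0) = (2 ≤ s ∧ B ≠ 0) := by
    by_cases hs : s - 1 = 0
    · rw [if_neg (not_not.2 hs)]; simp; omega
    · rw [if_pos hs]; simp; omega
  simp only [t, ts]
  by_cases h1 : 2 ≤ s ∧ B ≠ 0
  · rw [if_pos h1]; simp [h1]
  · rw [if_neg h1]; split_ifs <;> omega

theorem eval_closedE {μ m : Mem} (hp : Prepared μ m) {ρ : ℕ → ℕ} {j₀ j : ℕ} (hj₀ : j₀ < μ 0 0)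
    (hj : j < μ 0 0) (r0 : ρ 0 = j) (r53 : ρ 53 = j₀) (h41 : m 41 0 = m 33 j₀) :
    closedE.eval ρ m ≠ 0 ↔ Closed' μ m j₀ j := by
  have hxj := (hp.near₁ j hj).lt
  have hxj₀ := (hp.near₁ j₀ hj₀).lt
  have hs : ∀ i < μ 0 0, m 38 i - 1 = saving (μ 0 0) (m 17) (m 33) i := fun i hi => by
    rw [hp.size i hi, saving]
  have hb := eval_beforeE hp.base (i := at' 33 0) (g := cell 41) (ρ := ρ)
    (w := mergeCost (μ 0 0) (μ 0 2) (m 16) (m 17) (m 33)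
      (closeCost (pts μ) (m 35) (m 34) (m 36))) (s := saving (μ 0 0) (m 17) (m 33))
    (fun z => by simp [E.eval]) (fun z => by simp [E.eval])
  have ei : (at' 33 0).eval ρ m = m 33 j := by simp only [E.eval, r0]
  have eg : (cell 41).eval ρ m = m 33 j₀ := by simp only [E.eval, h41]
  rw [ei, eg] at hb
  have hb := hb (hp.weight _ hxj) (hp.weight _ hxj₀) (hs _ hxj) (hs _ hxj₀) (saving_le _ _ _ _)
    (saving_le _ _ _ _)
  have e37 : (at' 37 0).eval ρ m = m 37 j := by simp only [E.eval, r0]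
  have e37' : (at' 37 53).eval ρ m = m 37 j₀ := by simp only [E.eval, r53]
  rw [closedE_eq, eval_eqE, eval_eqE, ei, eg, e37, e37', r0, r53, closed_ite_ne_zero,
    hp.size _ hxj, hp.close _ hj, hp.close _ hj₀, hb, Closed', Closed, mem_opened]
  simp only [hj, true_and]

theorem merged_spec {μ m : Mem} (hp : Prepared μ m) {cl : ℕ → Prop}
    (hcl : ∀ j < μ 0 0, (m 40 j ≠ 0 ↔ cl j)) (ρ : ℕ → ℕ) :
    Merged (μ 0 0) (m 16) (m 17) (m 33) cl (mergedS.run ρ m 19) := by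
  have h19 : ∀ x < μ 0 0, mergedS.run ρ m 19 x = (range (μ 0 0)).fold max
      (if m 17 x ≠ 0 then (if m 40 x ≠ 0 then 0 else m 17 x) else 0)
      fun j => if m 40 j ≠ 0 then (if m 33 j = x then m 16 x + 2 * (m 17 j - 1) else 0) else 0 := by
    intro x hx
    rw [mergedS, fill_apply rfl _ (by rwa [hp.base.val_n]), eval_max, hp.base.val_n]
    simp only [E.eval, eval_eqE, Function.update_self,
      Function.update_of_ne (show (0 : ℕ) ≠ 1 by decide)]
    refine fold_congr fun j _ => ?_
    split_ifs <;> omega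
  have hle := fun x (hx : x < μ 0 0) => (fold_max_le _).1 (h19 x hx).ge
  refine ⟨fun j hj hR hc => ?_, fun j hj hc => ?_, fun x hx hR => ?_⟩
  · have h1 := (hle j hj).1
    rwa [if_pos hR, if_neg fun h => hc ((hcl j hj).1 h)] at h1
  · have h1 := (hle _ (hp.near₁ j hj).lt).2 j (mem_range.2 hj)
    rwa [if_pos ((hcl j hj).2 hc), if_pos rfl] at h1
  · rcases (le_fold_max _).1 (h19 x hx).le with h | ⟨j, hj, h⟩
    · left
      have h1 := (hle x hx).1
      split_ifs at h with c1 c2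
      · omega
      · rw [if_pos c1, if_neg c2] at h1
        exact ⟨c1, fun hc => c2 ((hcl x hx).2 hc), le_antisymm h h1⟩
      · omega
    · right
      have h1 := (hle x hx).2 j hj
      have hj' := mem_range.1 hj
      split_ifs at h with c1 c2
      · rw [if_pos c1, if_pos c2] at h1
        exact ⟨j, hj', (hcl j hj').1 c1, c2, le_antisymm h h1⟩
      · omega
      · omega

end Clustering

namespace Clustering

/-! ### Trying all thresholds and all radii. -/

open ArrayLang Finset RAM

theorem mergeStep_spec {μ m : Mem} (hp : Prepared μ m) (h : Ready μ) (hb : BestInv μ m)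
    {ρ : ℕ → ℕ} {j₀ : ℕ} (hj₀ : j₀ < μ 0 0) (hρ : ρ 53 = j₀) :
    ∃ R, Merged (μ 0 0) (m 16) (m 17) (m 33) (Closed' μ m j₀) R ∧
      (Feas μ R → Seen (mergeStepS.run ρ m) (cost' μ R)) := by
  simp only [mergeStepS, block, run_seq]
  set m1 := (setCell 41 (at' 33 53)).run ρ m
  have b1 : Base μ m1 := hp.base.run (sc := [53]) rfl ρ
  have h41 : m1 41 0 = m 33 j₀ := (set_apply _ _ _ _).trans (by simp only [E.eval, hρ])
  have f : ∀ a, a ≠ 41 → m1 a = m a := fun a ha => S.run_frame (by simpa [S.writes] using ha) _ _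
  have hp1 : Prepared μ m1 := by
    refine ⟨b1, ?_, ?_, ?_, ?_, ?_⟩
    · rw [f 16 (by decide), f 33 (by decide), f 34 (by decide)]; exact hp.near₁
    · rw [f 17 (by decide), f 35 (by decide), f 36 (by decide)]; exact hp.near₂
    · rw [f 37 (by decide), f 34 (by decide), f 35 (by decide), f 36 (by decide)]; exact hp.close
    · rw [f 38 (by decide), f 17 (by decide), f 33 (by decide)]; exact hp.size
    · rw [f 39 (by decide), f 16 (by decide), f 17 (by decide), f 33 (by decide),
        f 34 (by decide), f 35 (by decide), f 36 (by decide)]; exact hp.weight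
  set m2 := (fill .n 40 0 closedE).run ρ m1 with hm2
  have b2 : Base μ m2 := b1.run (sc := [53]) rfl ρ
  have g : ∀ a, a ≠ 40 → m2 a = m1 a := fun a ha => S.run_frame (by simpa [S.writes, fill] using ha) _ _
  have h40 : ∀ j < μ 0 0, (m2 40 j ≠ 0 ↔ Closed' μ m2 j₀ j) := fun j hj => by
    rw [hm2, fill_apply rfl _ (by rwa [b1.val_n]), ← hm2, Closed', g 16 (by decide),
      g 17 (by decide), g 33 (by decide), g 34 (by decide), g 35 (by decide), g 36 (by decide)]
    exact eval_closedE hp1 hj₀ hj (Function.update_self ..) hρ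
      (by rw [h41, f 33 (by decide)])
  have hp2 : Prepared μ m2 := by
    refine ⟨b2, ?_, ?_, ?_, ?_, ?_⟩
    · rw [g 16 (by decide), g 33 (by decide), g 34 (by decide)]; exact hp1.near₁
    · rw [g 17 (by decide), g 35 (by decide), g 36 (by decide)]; exact hp1.near₂
    · rw [g 37 (by decide), g 34 (by decide), g 35 (by decide), g 36 (by decide)]; exact hp1.close
    · rw [g 38 (by decide), g 17 (by decide), g 33 (by decide)]; exact hp1.size
    · rw [g 39 (by decide), g 16 (by decide), g 17 (by decide), g 33 (by decide),
        g 34 (by decide), g 35 (by decide), g 36 (by decide)]; exact hp1.weight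
  have hmer := merged_spec hp2 h40 ρ
  have e : ∀ a, a ≠ 40 → a ≠ 41 → m2 a = m a := fun a h1 h2 => (g a h1).trans (f a h2)
  rw [Closed', e 16 (by decide) (by decide), e 17 (by decide) (by decide),
    e 33 (by decide) (by decide), e 34 (by decide) (by decide), e 35 (by decide) (by decide),
    e 36 (by decide) (by decide)] at hmer
  refine ⟨_, hmer, ?_⟩
  have b3 : Base μ (mergedS.run ρ m2) := b2.run (sc := []) rfl ρ
  refine (consider_spec b3 h.dst_le ?_ ρ).2.2.1
  unfold BestInv
  rwa [show mergedS.run ρ m2 11 = m 11 from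
      (S.run_frame rfl _ _).trans (e 11 (by decide) (by decide)),
    show mergedS.run ρ m2 12 = m 12 from
      (S.run_frame rfl _ _).trans (e 12 (by decide) (by decide))]

theorem Prepared.run {μ m : Mem} (h : Prepared μ m) {p : S} {sc : List ℕ} (hp : p.wf roSetup sc)
    (h16 : p.writes 16 = false) (h17 : p.writes 17 = false) (h33 : p.writes 33 = false)
    (h34 : p.writes 34 = false) (h35 : p.writes 35 = false) (h36 : p.writes 36 = false)
    (h37 : p.writes 37 = false) (h38 : p.writes 38 = false) (h39 : p.writes 39 = false)
    (ρ : ℕ → ℕ) : Prepared μ (p.run ρ m) := by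
  refine ⟨h.base.run hp ρ, ?_, ?_, ?_, ?_, ?_⟩
  · rw [S.run_frame h16, S.run_frame h33, S.run_frame h34]; exact h.near₁
  · rw [S.run_frame h17, S.run_frame h35, S.run_frame h36]; exact h.near₂
  · rw [S.run_frame h37, S.run_frame h34, S.run_frame h35, S.run_frame h36]; exact h.close
  · rw [S.run_frame h38, S.run_frame h17, S.run_frame h33]; exact h.size
  · rw [S.run_frame h39, S.run_frame h16, S.run_frame h17, S.run_frame h33, S.run_frame h34,
      S.run_frame h35, S.run_frame h36]; exact h.weight

/-- The right threshold is only known to exist, so all are tried. The merged solution for each `j₀`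
is considered in its round, and later rounds do not lose what has been seen. -/
theorem mergeLoop_spec {μ m : Mem} (hp : Prepared μ m) (h : Ready μ) (hb : BestInv μ m)
    {j₀ : ℕ} (hj₀ : j₀ < μ 0 0) (ρ : ℕ → ℕ) :
    ∃ R, Merged (μ 0 0) (m 16) (m 17) (m 33) (Closed' μ m j₀) R ∧
      (Feas μ R → Seen ((S.rep .n 53 mergeStepS).run ρ m) (cost' μ R)) := by
  let I : ℕ → Mem → Prop := fun i m' => Prepared μ m' ∧ BestInv μ m' ∧ m' 16 = m 16 ∧
    m' 17 = m 17 ∧ m' 33 = m 33 ∧ m' 34 = m 34 ∧ m' 35 = m 35 ∧ m' 36 = m 36 ∧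
    (j₀ < i → ∃ R, Merged (μ 0 0) (m 16) (m 17) (m 33) (Closed' μ m j₀) R ∧
      (Feas μ R → Seen m' (cost' μ R)))
  have key : I (Range.n.val m) ((S.rep .n 53 mergeStepS).run ρ m) := by
    refine iter_inv I ⟨hp, hb, rfl, rfl, rfl, rfl, rfl, rfl, fun h => by omega⟩ ?_
    rintro i - m' ⟨i1, i2, i3, i4, i5, i6, i7, i8, i9⟩
    set ρ' := Function.update ρ 53 i
    obtain ⟨k1, k2, k3⟩ := keeps_mergeStepS h m' ρ' i1.base i2
    refine ⟨i1.run (sc := [53]) rfl rfl rfl rfl rfl rfl rfl rfl rfl rfl ρ', k2,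
      (S.run_frame rfl _ _).trans i3, (S.run_frame rfl _ _).trans i4,
      (S.run_frame rfl _ _).trans i5, (S.run_frame rfl _ _).trans i6,
      (S.run_frame rfl _ _).trans i7, (S.run_frame rfl _ _).trans i8, fun hlt => ?_⟩
    by_cases hi : j₀ < i
    · obtain ⟨R, h1, h2⟩ := i9 hi
      exact ⟨R, h1, fun hF => k3 _ (h2 hF)⟩
    · obtain ⟨R, h1, h2⟩ := mergeStep_spec i1 h i2 hj₀ (ρ := ρ')
        ((Function.update_self ..).trans (by omega))
      rw [Closed', i3, i4, i5, i6, i7, i8] at h1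
      exact ⟨R, h1, h2⟩
  obtain ⟨-, -, -, -, -, -, -, -, h9⟩ := key
  exact h9 (by rwa [hp.base.val_n])

theorem Seen.mono {m : Mem} {c c' : ℕ} (h : Seen m c) (hc : c ≤ c') : Seen m c' :=
  ⟨h.1, h.2.trans (by omega)⟩

/-- The upper bound for the cost of the solution found. -/
abbrev costBound (μ : Mem) (U : ℕ) : ℕ := 13 * U + 4 * (3 * μ 0 0 * (μ 0 0 * μ 0 0)) + 12 * μ 0 0

/-- For the right radius, the solution for the upper multiplier or one of the merged solutions meets
the bound. -/
theorem guess_spec {μ m : Mem} (h : Ready μ) {Y : Finset ℕ} {σ r : ℕ → ℕ} (ht : Target μ Y σ r)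
    (hm : Base μ m) (hb : BestInv μ m) {ρ : ℕ → ℕ} (hρ : μ 8 (ρ 54) = Y.sup r) :
    Seen (guessS.run ρ m) (costBound μ (targetCost μ Y σ r)) := by
  simp only [guessS, block, run_seq]
  set m1 := (setCell 13 (at' 8 54)).run ρ m
  set m2 := (setCell 14 (.num 0)).run ρ m1
  set m3 := (setCell 15 (cell 9)).run ρ m2
  have b1 : Base μ m1 := hm.run (sc := [54]) rfl ρ
  have b2 : Base μ m2 := b1.run (sc := []) rfl ρ
  have b3 : Base μ m3 := b2.run (sc := []) rfl ρ
  have e13 : m3 13 0 = Y.sup r := by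
    rw [show m3 13 = m1 13 from (S.run_frame rfl _ _).trans (S.run_frame rfl _ _), ← hρ]
    exact (set_apply _ _ _ _).trans (by simp only [E.eval, hm 8 rfl])
  have e14 : m3 14 0 = 0 := (congrFun (S.run_frame rfl _ _) 0).trans (set_apply _ _ _ _)
  have e15 : m3 15 0 = μ 9 0 := (set_apply _ _ _ _).trans (by simp only [E.eval, b2 9 rfl])
  have hb3 : BestInv μ m3 := by
    unfold BestInv
    rwa [show m3 11 = m 11 from
        ((S.run_frame rfl _ _).trans (S.run_frame rfl _ _)).trans (S.run_frame rfl _ _),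
      show m3 12 = m 12 from
        ((S.run_frame rfl _ _).trans (S.run_frame rfl _ _)).trans (S.run_frame rfl _ _)]
  have hinv := bisect_spec h ht b3 hb3 e13 e14 e15 ρ
  set m4 := (S.bits 9 52 bisectS).run ρ m3
  obtain ⟨b4, hb4, -, le, -, gap, hi, lo⟩ := hinv
  obtain ⟨b5, hb5, seen5⟩ : Base μ (prepareS.run ρ m4) ∧ BestInv μ (prepareS.run ρ m4) ∧
      ∀ c, Seen m4 c → Seen (prepareS.run ρ m4) c :=
    Keeps.of_writes (sc := []) rfl rfl rfl m4 ρ b4 hb4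
  obtain ⟨-, -, seen6⟩ := (keeps_mergeStepS h).rep .n 53 _ ρ b5 hb5
  obtain ⟨p₀, hp₀⟩ := h.nonempty
  have hYne : Y.Nonempty := ⟨_, ht.maps p₀ hp₀⟩
  have hYpos := hYne.card_pos
  have hYk := ht.le
  have hYN : #Y ≤ μ 0 0 := by
    simpa using card_le_card (fun x hx => mem_range.2 (ht.lt x hx) : Y ⊆ range (μ 0 0))
  obtain ⟨Q, -, q2, -⟩ := h.bound
  -- Near the top value a solution has at most one facility, which is not more than `k`. So the
  -- lower multiplier stays below, and the upper one has moved away from the initial value and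
  -- carries a solution.
  have hlo' : ¬(μ 9 0 ≤ m4 14 0 + 1) := by
    intro hle
    rcases lo with lo | ⟨lo1, lo2⟩
    · omega
    · have := lo1.le_one hle; omega
  rw [pow_zero] at gap
  rcases hi with hi | ⟨hi1, hi2, hi3⟩
  · omega
  set U := targetCost μ Y σ r with hU
  have c1 := hi1.cost_le
  rcases lo with lo | ⟨lo1, lo2⟩
  -- If the lower multiplier is still `0`, the upper one is at most 1, and its term `3 * lam * y` is
  -- at most `3 * N`: no merging is needed.
  · refine seen6 _ (seen5 _ (hi3.mono ?_))
    have : m4 15 0 * #Y ≤ 1 * μ 0 0 := Nat.mul_le_mul (by omega) hYN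
    unfold costBound
    omega
  have c2 := lo1.cost_le
  obtain ⟨y₁, hy₁⟩ := card_pos.1 hi1.pos
  obtain ⟨y₂, hy₂⟩ := card_pos.1 lo1.pos
  have hprep := prepare_spec b4 h (mem_opened.1 hy₁).1 (mem_opened.1 hy₁).2 (mem_opened.1 hy₂).1
    (mem_opened.1 hy₂).2 ρ
  have f16 : prepareS.run ρ m4 16 = m4 16 := S.run_frame rfl _ _
  have f17 : prepareS.run ρ m4 17 = m4 17 := S.run_frame rfl _ _
  set m5 := prepareS.run ρ m4
  rw [← f16] at hi1 hi2 hi3 c1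
  rw [← f17] at lo1 lo2 c2
  obtain ⟨j₀, hj₀, hmerge⟩ := exists_merge h.isDist (pts_subset μ) (μ 0 2) (μ 0 1) hprep.near₁
    hprep.near₂ hi2 lo2 hi1.rad
  obtain ⟨R, hR, hseen⟩ := mergeLoop_spec hprep h hb5 hj₀ ρ
  obtain ⟨r1, r2, r3⟩ := hmerge R hR
  have hF : Feas μ R := by
    refine ⟨r1, r2, fun x hx hRx => ?_⟩
    rcases hR.eq x hx hRx with ⟨h1, -, -⟩ | ⟨j, hj, -, hjx, -⟩
    · exact lo1.mem x hx h1
    · have := (hprep.near₁ j hj).ne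
      rw [hjx] at this
      exact hi1.mem x hx this
  obtain ⟨x₀, hx₀, hmax⟩ := exists_mem_eq_sup Y hYne r
  -- The largest radius belongs to a center of the target, whose cost includes `ℓ` times this
  -- radius.
  have hL : μ 0 2 * Y.sup r ≤ U := by
    rw [hmax, hU]
    exact (single_le_sum (f := fun x => μ 0 2 * r x) (fun _ _ => Nat.zero_le _) hx₀).trans
      (Nat.le_add_right _ _)
  have hk₂N : #(opened (μ 0 0) (m5 17)) ≤ μ 0 0 := by
    refine (card_le_card (filter_subset _ _ : opened (μ 0 0) (m5 17) ⊆ range (μ 0 0))).trans ?_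
    rw [card_range]
  rw [show μ 0 2 * (3 * Y.sup r) = 3 * (μ 0 2 * Y.sup r) by ring] at r3
  rcases le_or_le_of_combination c1 c2 hi2 lo2 hk₂N hYk (by omega) hL r3 with hc | hc
  · exact seen6 _ (seen5 _ (hi3.mono hc))
  · exact (hseen hF).mono hc

/-- The largest radius of any target is a distance `x * N + v` and is therefore guessed in one of
the `N * N` rounds; the best solution over all rounds meets the bound for every target
simultaneously. -/
theorem main_spec {μ m : Mem} (hm : Base μ m) (h : Ready μ) (hex : ∃ Y σ r, Target μ Y σ r)
    (ρ : ℕ → ℕ) :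
    ∃ R d : ℕ → ℕ, Feas μ R ∧ (∀ Y σ r, Target μ Y σ r → cost' μ R ≤ costBound μ (targetCost μ Y σ r)) ∧
      (∀ v < μ 0 0, mainS.run ρ m 5 v = if R v ≠ 0 then 1 else 0) ∧
      ∀ v < μ 0 0, IsNear (μ 0 0) (dst μ) R v (mainS.run ρ m 6 v) (d v) := by
  simp only [mainS, block, run_seq]
  set m1 := (setCell 12 (.num 0)).run ρ m
  have b1 : Base μ m1 := hm.run (sc := []) rfl ρ
  have hb1 : BestInv μ m1 := Or.inl (set_apply _ _ _ _)
  obtain ⟨b2, hb2, -⟩ := (keeps_guessS h).rep .nn 54 _ ρ b1 hb1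
  have hseen : ∀ Y σ r, Target μ Y σ r → Seen ((S.rep .nn 54 guessS).run ρ m1)
      (costBound μ (targetCost μ Y σ r)) := by
    intro Y σ r ht
    obtain ⟨p₀, hp₀⟩ := h.nonempty
    obtain ⟨x, hx, hmax⟩ := exists_mem_eq_sup Y ⟨_, ht.maps p₀ hp₀⟩ r
    obtain ⟨v, hv, hrx⟩ := ht.rad x hx
    have hbN : x * μ 0 0 + v < μ 0 0 * μ 0 0 :=
      calc x * μ 0 0 + v < (x + 1) * μ 0 0 := by rw [add_mul]; omega
        _ ≤ μ 0 0 * μ 0 0 := Nat.mul_le_mul_right _ (ht.lt x hx)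
    let I : ℕ → Mem → Prop := fun i m' => Base μ m' ∧ BestInv μ m' ∧
      (x * μ 0 0 + v < i → Seen m' (costBound μ (targetCost μ Y σ r)))
    have key : I (Range.nn.val m1) ((S.rep .nn 54 guessS).run ρ m1) := by
      refine iter_inv I ⟨b1, hb1, fun h => by omega⟩ ?_
      rintro i - m' ⟨i1, i2, i3⟩
      obtain ⟨k1, k2, k3⟩ := keeps_guessS h m' (Function.update ρ 54 i) i1 i2
      refine ⟨k1, k2, fun hlt => ?_⟩
      by_cases hi : x * μ 0 0 + v < i
      · exact k3 _ (i3 hi)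
      · refine guess_spec h ht i1 i2 ?_
        rw [Function.update_self, hmax, hrx, show i = x * μ 0 0 + v by omega]
    exact key.2.2 (by rwa [b1.val_nn])
  set m2 := (S.rep .nn 54 guessS).run ρ m1
  set m3 := (fill .n 5 0 (.ite (at' 11 0) (.num 1) (.num 0))).run ρ m2 with hm3
  have b3 : Base μ m3 := b2.run (sc := []) rfl ρ
  have f11 : m3 11 = m2 11 := S.run_frame rfl _ _
  obtain ⟨Y₀, σ₀, r₀, ht₀⟩ := hex
  obtain hb2 | ⟨hF, hc⟩ := hb2
  · exact absurd hb2 (hseen _ _ _ ht₀).1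
  obtain ⟨y, hy⟩ := card_pos.1 hF.pos
  obtain ⟨hyN, hyR⟩ := mem_opened.1 hy
  have n31 := near_fill_spec b3 h (a := 11) (a' := 31) rfl hyN (by rwa [f11]) ρ
  set m4 := (fill .n 31 0 (nearE 11)).run ρ m3
  have b4 : Base μ m4 := b3.run (sc := []) rfl ρ
  have g11 : m4 11 = m3 11 := S.run_frame rfl _ _
  have n6 := nearest_fill_spec b4 (a := 11) (a' := 31) (b := 6) rfl hyN (by rwa [g11, f11])
    (by rwa [g11]) ρ
  rw [g11, f11] at n6
  refine ⟨m2 11, m4 31, hF, fun Y σ r ht => ?_, fun v hv => ?_, n6⟩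
  · have := (hseen Y σ r ht).2
    omega
  · rw [show (fill .n 6 0 (nearestE 11 31)).run ρ m4 5 = m3 5 from
      (S.run_frame rfl _ _).trans (S.run_frame rfl _ _), hm3,
      fill_apply rfl _ (by rwa [b2.val_n])]
    simp only [E.eval, Function.update_self]

end Clustering

namespace NestedNorm

/-! ### The norm `top_ℓ` as a minimum over thresholds. -/

open Finset

/-- Each of the at most `ℓ` entries taken is at most `r` plus its excess over `r`, and the other
excesses are nonnegative. -/
theorem topNorm_le (ℓ : ℕ) {ι : Type*} [Fintype ι] (x : ι → ℝ) {r : ℝ} (hr : 0 ≤ r) :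
    topNorm ℓ x ≤ ℓ * r + ∑ i, max (x i - r) 0 := by
  set L := (univ.val.map x).sort (· ≥ ·) with hL
  have hsum : ∑ i, max (x i - r) 0 = (L.map fun a => max (a - r) 0).sum := by
    have h1 : ((L : Multiset ℝ).map fun a => max (a - r) 0).sum
        = ((univ.val.map x).map fun a => max (a - r) 0).sum := by rw [hL, Multiset.sort_eq]
    rw [Multiset.map_coe, Multiset.sum_coe, Multiset.map_map] at h1
    exact h1.symm
  have h2 : ∀ l : List ℝ, l.sum ≤ l.length * r + (l.map fun a => max (a - r) 0).sum := by
    intro l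
    induction l with
    | nil => simp
    | cons a l ih =>
      simp only [List.sum_cons, List.length_cons, List.map_cons, Nat.cast_add, Nat.cast_one]
      have := le_max_left (a - r) 0
      linarith
  rw [hsum, topNorm, ← hL, ← List.take_append_drop ℓ L, List.map_append, List.sum_append,
    List.take_append_drop]
  have h3 : 0 ≤ ((L.drop ℓ).map fun a => max (a - r) 0).sum :=
    List.sum_nonneg (by simp only [List.mem_map]; rintro _ ⟨a, -, rfl⟩; exact le_max_right _ _)
  have h4 : ((L.take ℓ).length : ℝ) * r ≤ ℓ * r := by
    gcongr
    exact List.length_take_le _ _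
  have := h2 (L.take ℓ)
  linarith

/-- Take the `ℓ`-th largest entry as the threshold: the entries taken are at least the threshold,
and the others have no excess. -/
theorem exists_topNorm_eq {ℓ : ℕ} {ι : Type*} [Fintype ι] (x : ι → ℝ) (h1 : 1 ≤ ℓ)
    (h2 : ℓ ≤ Fintype.card ι) : ∃ i, topNorm ℓ x = ℓ * x i + ∑ j, max (x j - x i) 0 := by
  set L := (univ.val.map x).sort (· ≥ ·) with hL
  have hlen : L.length = Fintype.card ι := by simp [hL]
  have hsorted : L.Pairwise (· ≥ ·) := Multiset.pairwise_sort _ _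
  have hmem : L[ℓ - 1]'(by omega) ∈ L := List.getElem_mem _
  obtain ⟨i, -, hi⟩ := Multiset.mem_map.1 ((Multiset.mem_sort _).1 hmem)
  refine ⟨i, ?_⟩
  set r := x i with hr
  have hr' : L[ℓ - 1]'(by omega) = r := hi.symm
  have hsum : ∑ j, max (x j - r) 0 = (L.map fun a => max (a - r) 0).sum := by
    have h1 : ((L : Multiset ℝ).map fun a => max (a - r) 0).sum
        = ((univ.val.map x).map fun a => max (a - r) 0).sum := by rw [hL, Multiset.sort_eq]
    rw [Multiset.map_coe, Multiset.sum_coe, Multiset.map_map] at h1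
    exact h1.symm
  have htake : ∀ a ∈ L.take ℓ, r ≤ a := by
    intro a ha
    obtain ⟨j, hj, rfl⟩ := List.mem_iff_getElem.1 ha
    rw [List.getElem_take, ← hr']
    rw [List.length_take] at hj
    rcases Nat.lt_or_ge j (ℓ - 1) with h | h
    · exact List.pairwise_iff_getElem.1 hsorted j (ℓ - 1) (by omega) (by omega) h
    · have : j = ℓ - 1 := by omega
      subst this; exact le_rfl
  have hdrop : ∀ a ∈ L.drop ℓ, a ≤ r := by
    intro a ha
    obtain ⟨j, hj, rfl⟩ := List.mem_iff_getElem.1 ha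
    rw [List.getElem_drop, ← hr']
    rw [List.length_drop] at hj
    exact List.pairwise_iff_getElem.1 hsorted (ℓ - 1) (ℓ + j) (by omega) (by omega) (by omega)
  have e1 : ∀ l : List ℝ, (∀ a ∈ l, r ≤ a) →
      l.sum = l.length * r + (l.map fun a => max (a - r) 0).sum := by
    intro l hl
    induction l with
    | nil => simp
    | cons a l ih =>
      simp only [List.sum_cons, List.length_cons, List.map_cons, Nat.cast_add, Nat.cast_one]
      rw [ih fun b hb => hl b (List.mem_cons_of_mem _ hb),
        max_eq_left (sub_nonneg.2 (hl a List.mem_cons_self))]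
      ring
  have e2 : ((L.drop ℓ).map fun a => max (a - r) 0).sum = 0 := by
    refine List.sum_eq_zero ?_
    simp only [List.mem_map]
    rintro _ ⟨a, ha, rfl⟩
    exact max_eq_right (sub_nonpos.2 (hdrop a ha))
  rw [hsum, topNorm, ← hL]
  nth_rw 2 [← List.take_append_drop ℓ L]
  rw [List.map_append, List.sum_append, e2, add_zero, e1 _ htake, List.length_take,
    min_eq_left (by omega)]

section objective

variable {I : TopInstance} (S : Solution I.toSpace)

/-- A point has a nonzero entry only in its own cluster, and a zero entry has no excess over a
nonnegative threshold. -/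
theorem sum_clusterVec {r : {x // x ∈ S.X} → ℝ} (hr : ∀ x, 0 ≤ r x) :
    ∑ x, (I.ℓ * r x + ∑ p, max (clusterVec S x p - r x) 0)
      = ∑ x, I.ℓ * r x + ∑ p, max ((I.δ p.1 (S.σ p).1 : ℝ) - r (S.σ p)) 0 := by
  rw [sum_add_distrib, sum_comm]
  congr 1
  refine sum_congr rfl fun p _ => ?_
  rw [sum_eq_single (S.σ p)]
  · simp [clusterVec]
  · intro x _ hx
    simp [clusterVec, hx, hr x]
  · simp

theorem topNorm_nonneg (ℓ : ℕ) {ι : Type*} [Fintype ι] {x : ι → ℝ} (hx : ∀ i, 0 ≤ x i) :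
    0 ≤ topNorm ℓ x := by
  refine List.sum_nonneg fun a ha => ?_
  have := List.mem_of_mem_take ha
  rw [Multiset.mem_sort, Multiset.mem_map] at this
  obtain ⟨i, -, rfl⟩ := this
  exact hx i

theorem clusterVec_nonneg (x : {x // x ∈ S.X}) (p : {p // p ∈ I.P}) : 0 ≤ clusterVec S x p := by
  unfold clusterVec
  split_ifs
  · positivity
  · exact le_rfl

theorem objective_eq : I.objective S = ∑ x, topNorm I.ℓ (clusterVec S x) :=
  sum_congr rfl fun x _ => abs_of_nonneg (topNorm_nonneg _ (clusterVec_nonneg S x))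

theorem objective_le {r : {x // x ∈ S.X} → ℝ} (hr : ∀ x, 0 ≤ r x) :
    I.objective S ≤ ∑ x, I.ℓ * r x + ∑ p, max ((I.δ p.1 (S.σ p).1 : ℝ) - r (S.σ p)) 0 := by
  rw [objective_eq, ← sum_clusterVec S hr]
  exact sum_le_sum fun x _ => topNorm_le _ _ (hr x)

/-- The optimal threshold is an entry of the cluster vector: the distance from the center to a
point, or `0`, which is the distance from the center to itself. So the radii range over distances
from the center. -/
theorem exists_objective_eq : ∃ v : {x // x ∈ S.X} → Fin I.N,
    I.objective S = ∑ x, I.ℓ * (I.δ x.1 (v x) : ℝ)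
      + ∑ p, max ((I.δ p.1 (S.σ p).1 : ℝ) - I.δ (S.σ p).1 (v (S.σ p))) 0 := by
  have h : ∀ x, ∃ v : Fin I.N, topNorm I.ℓ (clusterVec S x)
      = I.ℓ * (I.δ x.1 v : ℝ) + ∑ p, max (clusterVec S x p - I.δ x.1 v) 0 := by
    intro x
    obtain ⟨p, hp⟩ := exists_topNorm_eq (clusterVec S x) I.one_le (by simpa using I.le_card)
    by_cases hx : x = S.σ p
    · refine ⟨p.1, ?_⟩
      rwa [show clusterVec S x p = (I.δ x.1 p.1 : ℝ) by rw [clusterVec, if_pos hx, I.symm]] at hp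
    · refine ⟨x.1, ?_⟩
      rwa [show clusterVec S x p = (I.δ x.1 x.1 : ℝ) by
        rw [clusterVec, if_neg hx, (I.eq_iff _ _).2 rfl]; simp] at hp
  choose v hv using h
  refine ⟨v, ?_⟩
  rw [objective_eq, ← sum_clusterVec S (r := fun x => (I.δ x.1 (v x) : ℝ)) fun x => by positivity]
  exact sum_congr rfl fun x _ => hv x

end objective

end NestedNorm

namespace Clustering

/-! ### Reading and scaling the input. -/

open ArrayLang Finset RAM NestedNorm

section input

variable (I : TopInstance)

theorem input_one (p : Fin I.N) : I.input 1 p ≠ 0 ↔ p ∈ I.P := by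
  simp [TopInstance.input]

theorem input_two (p : Fin I.N) : I.input 2 p ≠ 0 ↔ p ∈ I.F := by
  simp [TopInstance.input]

theorem cell_lt {N : ℕ} (u v : Fin N) : (u * N + v : ℕ) < N * N :=
  calc (u * N + v : ℕ) < (u + 1) * N := by rw [add_mul]; have := v.2; omega
    _ ≤ N * N := Nat.mul_le_mul_right _ u.2

theorem divNat_cell {N : ℕ} (u v : Fin N) : Fin.divNat ⟨u * N + v, cell_lt u v⟩ = u := by
  have := v.2
  ext
  simp only [Fin.divNat]
  rw [add_comm, Nat.add_mul_div_right _ _ (by omega), Nat.div_eq_of_lt v.2, zero_add]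

theorem modNat_cell {N : ℕ} (u v : Fin N) : Fin.modNat ⟨u * N + v, cell_lt u v⟩ = v := by
  ext
  simp only [Fin.modNat]
  rw [add_comm, Nat.add_mul_mod_self_right, Nat.mod_eq_of_lt v.2]

theorem input_three (u v : Fin I.N) : I.input 3 (u * I.N + v) = (I.δ u v).num := by
  have h : I.input 3 (u * I.N + v) = if h : u * I.N + v < I.N * I.N then
      (I.δ (Fin.divNat ⟨u * I.N + v, h⟩) (Fin.modNat ⟨u * I.N + v, h⟩)).num else 0 := rfl
  rw [h, dif_pos (cell_lt u v), divNat_cell, modNat_cell]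

theorem input_four (u v : Fin I.N) : I.input 4 (u * I.N + v) = (I.δ u v).den := by
  have h : I.input 4 (u * I.N + v) = if h : u * I.N + v < I.N * I.N then
      (I.δ (Fin.divNat ⟨u * I.N + v, h⟩) (Fin.modNat ⟨u * I.N + v, h⟩)).den else 0 := rfl
  rw [h, dif_pos (cell_lt u v), divNat_cell, modNat_cell]

theorem input_four_ne {i : ℕ} (hi : i < I.N * I.N) : I.input 4 i ≠ 0 := by
  have h : I.input 4 i = if h : i < I.N * I.N then
      (I.δ (Fin.divNat ⟨i, h⟩) (Fin.modNat ⟨i, h⟩)).den else 0 := rfl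
  rw [h, dif_pos hi]
  exact NNRat.den_ne_zero _

theorem bdd_input : Bdd I.input I.bits := by
  have hδ : ∀ u v : Fin I.N, (I.δ u v).num.size + (I.δ u v).den.size
      ≤ ∑ u, ∑ v, ((I.δ u v).num.size + (I.δ u v).den.size) := fun u v =>
    (single_le_sum (f := fun v => (I.δ u v).num.size + (I.δ u v).den.size)
      (fun _ _ => Nat.zero_le _) (mem_univ v)).trans
      (single_le_sum (f := fun u => ∑ v, ((I.δ u v).num.size + (I.δ u v).den.size))
        (fun _ _ => Nat.zero_le _) (mem_univ u))
  intro a i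
  unfold TopInstance.bits
  unfold TopInstance.input
  split
  · omega
  · omega
  · omega
  · split_ifs with h1 h2
    · rw [Nat.size_one]; omega
    · simp
    · simp
  · split_ifs with h1 h2
    · rw [Nat.size_one]; omega
    · simp
    · simp
  · split_ifs with h1
    · have := hδ (Fin.divNat ⟨i, h1⟩) (Fin.modNat ⟨i, h1⟩); omega
    · simp
  · split_ifs with h1
    · have := hδ (Fin.divNat ⟨i, h1⟩) (Fin.modNat ⟨i, h1⟩); omega
    · simp
  · simp

end input

/-- The memory `μ` holds the instance `I`, with integral distances scaled by the factor `c`. -/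
structure Scaled (I : TopInstance) (c : ℕ) (μ : Mem) : Prop where
  n : μ 0 0 = I.N
  k : μ 0 1 = I.k
  l : μ 0 2 = I.ℓ
  point : ∀ p : Fin I.N, μ 1 p ≠ 0 ↔ p ∈ I.P
  facility : ∀ p : Fin I.N, μ 2 p ≠ 0 ↔ p ∈ I.F
  pos : 0 < c
  dst_eq : ∀ u v : Fin I.N, (dst μ u v : ℝ) = c * I.δ u v
  dvd : ∀ u v : Fin I.N, 100 * I.N ^ 3 ∣ dst μ u v
  bound : ∃ Q, (∀ u v : Fin I.N, dst μ u v ≤ Q) ∧ μ 0 0 * Q + μ 0 0 + 1 < μ 9 0 ∧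
    μ 9 0 + μ 0 2 * Q + Q < μ 10 0

/-- The scaling factor is `100 * N ^ 3` times the product of all denominators: the product makes the
distances integral, and the rest makes rounding errors small against one unit of cost. The sum of
all distances serves as `Q` in the bounds for multipliers and times. -/
theorem setup_spec (I : TopInstance) (ρ : ℕ → ℕ) :
    ∃ c, Scaled I c (setupS.run ρ I.input) := by
  have f : ∀ a, roInput a → setupS.run ρ I.input a = I.input a := fun a ha =>
    S.run_frame (S.writes_of_wf setupS_wf ha) _ _
  have hN : 0 < I.N := by
    obtain ⟨p, -⟩ := card_pos.1 (lt_of_lt_of_le I.one_le I.le_card)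
    exact p.pos
  have f0 : setupS.run ρ I.input 0 = I.input 0 := f 0 rfl
  have f1 : setupS.run ρ I.input 1 = I.input 1 := f 1 rfl
  have f2 : setupS.run ρ I.input 2 = I.input 2 := f 2 rfl
  revert f0 f1 f2
  clear f
  simp only [setupS, block, run_seq]
  set m1 := (setCell 7 (.num 100)).run ρ I.input
  have a1 : m1 7 0 = 100 := set_apply _ _ _ _
  have g1 : ∀ a, a ≠ 7 → m1 a = I.input a := fun a ha =>
    S.run_frame (by simpa [S.writes] using ha) _ _
  set m2 := (S.rep .nn 0 (setCell 7 (.mul (cell 7) 4 (.var 0)))).run ρ m1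
  have g2 : ∀ a, a ≠ 7 → m2 a = I.input a := fun a ha =>
    (S.run_frame (by simpa [S.writes] using ha) _ _).trans (g1 a ha)
  have v1 : Range.nn.val m1 = I.N * I.N := by
    simp only [Range.val, g1 0 (by decide)]; rfl
  have a2 : m2 7 0 = 100 * ∏ i ∈ range (I.N * I.N), I.input 4 i := by
    let J : ℕ → Mem → Prop := fun i m => m 4 = I.input 4 ∧ m 7 0 = 100 * ∏ i ∈ range i, I.input 4 i
    have key : J (Range.nn.val m1) m2 := by
      refine iter_inv J ⟨g1 4 (by decide), by simpa using a1⟩ ?_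
      rintro i - m ⟨h1, h2⟩
      refine ⟨(S.run_frame rfl _ _).trans h1, (set_apply _ _ _ _).trans ?_⟩
      simp only [E.eval, Function.update_self, h1, h2]
      rw [prod_range_succ, mul_assoc]
    rw [← v1]; exact key.2
  set D := ∏ i ∈ range (I.N * I.N), I.input 4 i with hD
  have v2 : Range.nn.val m2 = I.N * I.N := by
    simp only [Range.val, g2 0 (by decide)]; rfl
  set m3 := (fill .nn 8 0 (.mul (.mul (.mul (.div (.mul (cell 7) 3 (.var 0)) (at' 4 0))
     0 (.num 0)) 0 (.num 0)) 0 (.num 0))).run ρ m2 with hm3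
  have a3 : ∀ i < I.N * I.N, m3 8 i = 100 * D * I.input 3 i / I.input 4 i * I.N * I.N * I.N :=
    fun i hi => by
      rw [hm3, fill_apply rfl _ (by rwa [v2])]
      simp only [E.eval, Function.update_self, g2 0 (by decide), g2 3 (by decide),
        g2 4 (by decide), a2]
      rfl
  have g3 : m3 0 = I.input 0 := (S.run_frame rfl _ _).trans (g2 0 (by decide))
  have v3 : Range.nn.val m3 = I.N * I.N := by
    simp only [Range.val, g3]; rfl
  set m4 := (setCell 42 (.fold .sum .nn 0 (.num 0) (at' 8 0))).run ρ m3
  have a4 : m4 42 0 = ∑ i ∈ range (I.N * I.N), m3 8 i := by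
    refine (set_apply _ _ _ _).trans ?_
    rw [eval_sum, v3]
    simp only [E.eval, Function.update_self]
  have g4 : m4 0 = I.input 0 := (S.run_frame rfl _ _).trans g3
  set m5 := (setCell 9 (.add (.mul (.add (cell 42) (.num 1)) 0 (.num 0)) (.num 2))).run ρ m4
  have g5 : m5 0 = I.input 0 := (S.run_frame rfl _ _).trans g4
  have a5 : m5 9 0 = (m4 42 0 + 1) * I.N + 2 := by
    refine (set_apply _ _ _ _).trans ?_
    simp only [E.eval, g4]; rfl
  have b5 : m5 42 = m4 42 := S.run_frame rfl _ _
  set m6 := (setCell 10 (.add (.add (cell 9) (.mul (cell 42) 0 (.num 2)))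
    (.add (cell 42) (.num 1)))).run ρ m5
  have a6 : m6 10 0 = m5 9 0 + m4 42 0 * I.ℓ + (m4 42 0 + 1) := by
    refine (set_apply _ _ _ _).trans ?_
    simp only [E.eval, g5, b5]; rfl
  have b6 : m6 9 = m5 9 := S.run_frame rfl _ _
  have c6 : m6 8 = m3 8 :=
    (S.run_frame rfl _ _).trans ((S.run_frame rfl _ _).trans (S.run_frame rfl _ _))
  intro f0 f1 f2
  have n6 : m6 0 0 = I.N := by rw [f0]; rfl
  have l6 : m6 0 2 = I.ℓ := by rw [f0]; rfl
  have hpos : 0 < D := prod_pos fun i hi => Nat.pos_of_ne_zero (input_four_ne I (mem_range.1 hi))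
  have hdst : ∀ u v : Fin I.N, dst m6 u v = m3 8 (u * I.N + v) := fun u v => by
    rw [dst, n6, c6]
  have hval : ∀ u v : Fin I.N, ∃ e, D = (I.δ u v).den * e ∧
      dst m6 u v = 100 * I.N ^ 3 * (e * (I.δ u v).num) := by
    intro u v
    -- Each denominator divides the product of all, so the rounding division in the program is
    -- exact.
    obtain ⟨e, he⟩ := dvd_prod_of_mem (I.input 4) (mem_range.2 (cell_lt u v))
    rw [input_four] at he
    refine ⟨e, he, ?_⟩
    rw [hdst, a3 _ (cell_lt u v), input_three, input_four, hD, he,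
      show 100 * ((I.δ u v).den * e) * (I.δ u v).num
        = (I.δ u v).den * (100 * e * (I.δ u v).num) by ring,
      Nat.mul_div_cancel_left _ (I.δ u v).den_pos]
    ring
  refine ⟨100 * I.N ^ 3 * D, n6, by rw [f0]; rfl, l6, fun p => by rw [f1]; exact input_one I p,
    fun p => by rw [f2]; exact input_two I p, by positivity, fun u v => ?_, fun u v => ?_,
    m4 42 0, fun u v => ?_, ?_, ?_⟩
  · obtain ⟨e, he, h⟩ := hval u v
    rw [h, he]
    have h1 : ((I.δ u v : ℚ≥0) : ℝ) = (I.δ u v).num / (I.δ u v).den := by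
      conv_lhs => rw [← NNRat.num_div_den (I.δ u v)]
      push_cast; rfl
    have h2 : ((I.δ u v).den : ℝ) ≠ 0 := by exact_mod_cast (I.δ u v).den_ne_zero
    rw [h1]
    push_cast
    field_simp
  · obtain ⟨e, -, h⟩ := hval u v
    rw [h]; exact dvd_mul_right _ _
  · rw [a4, hdst]
    exact single_le_sum (f := fun i => m3 8 i) (fun _ _ => Nat.zero_le _)
      (mem_range.2 (cell_lt u v))
  · rw [n6, b6, a5, add_mul, mul_comm]; omega
  · rw [l6, b6, a6, mul_comm]; omega

theorem natCast_sub_eq_max (a b : ℕ) : ((a - b : ℕ) : ℝ) = max ((a : ℝ) - b) 0 := by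
  rcases le_total b a with hab | hab
  · rw [Nat.cast_sub hab, max_eq_left (by simpa using hab)]
  · rw [Nat.sub_eq_zero_of_le hab, max_eq_right (by simpa using hab), Nat.cast_zero]

section scaled

variable {I : TopInstance} {c : ℕ} {μ : Mem} (h : Scaled I c μ)
include h

theorem Scaled.pts_eq : pts μ = I.P.map Fin.valEmbedding := by
  ext p
  simp only [pts, mem_filter, mem_range, mem_map, Fin.valEmbedding_apply, h.n]
  constructor
  · rintro ⟨h1, h2⟩
    exact ⟨⟨p, h1⟩, (h.point ⟨p, h1⟩).1 h2, rfl⟩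
  · rintro ⟨q, hq, rfl⟩
    exact ⟨q.2, (h.point q).2 hq⟩

theorem Scaled.sum_pts (g : ℕ → ℕ) : ∑ p ∈ pts μ, g p = ∑ p : {p // p ∈ I.P}, g p.1 := by
  rw [h.pts_eq, sum_map, ← sum_coe_sort]; rfl

theorem Scaled.ready : Ready μ where
  isDist := by
    have hc : (0 : ℝ) < c := by exact_mod_cast h.pos
    have hd : ∀ u (hu : u < μ 0 0) v (hv : v < μ 0 0), (dst μ u v : ℝ)
        = c * I.δ ⟨u, h.n ▸ hu⟩ ⟨v, h.n ▸ hv⟩ := fun u hu v hv =>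
      h.dst_eq ⟨u, h.n ▸ hu⟩ ⟨v, h.n ▸ hv⟩
    refine ⟨fun u hu => ?_, fun u hu v hv => ?_, fun u hu v hv w hw => ?_⟩
    · have := hd u hu u hu
      rw [(I.eq_iff _ _).2 rfl] at this
      simpa using this
    · have h1 := hd u hu v hv
      rw [I.symm, ← hd v hv u hu] at h1
      exact_mod_cast h1
    · have h1 : ((I.δ ⟨u, h.n ▸ hu⟩ ⟨w, h.n ▸ hw⟩ : ℚ≥0) : ℝ)
          ≤ I.δ ⟨u, h.n ▸ hu⟩ ⟨v, h.n ▸ hv⟩ + I.δ ⟨v, h.n ▸ hv⟩ ⟨w, h.n ▸ hw⟩ := by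
        exact_mod_cast I.triangle _ _ _
      have h2 := mul_le_mul_of_nonneg_left h1 hc.le
      rw [mul_add, ← hd u hu w hw, ← hd u hu v hv, ← hd v hv w hw] at h2
      exact_mod_cast h2
  nonempty := by
    rw [h.pts_eq, map_nonempty]
    exact card_pos.1 (lt_of_lt_of_le I.one_le I.le_card)
  bound := by
    obtain ⟨Q, h1, h2, h3⟩ := h.bound
    exact ⟨Q, fun u hu v hv => h1 ⟨u, h.n ▸ hu⟩ ⟨v, h.n ▸ hv⟩, h2, h3⟩

end scaled

end Clustering

namespace Clustering

/-! ### Translation of solutions, and the final estimate. -/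

open ArrayLang Finset RAM NestedNorm

/-- Every solution, with the radii that attain its `top_ℓ` norms, is a target of exactly the scaled
cost. This cost is built from distances by sums, multiples and truncated differences, so it inherits
their divisor `100 * N ^ 3`. -/
theorem Scaled.exists_target {I : TopInstance} {c : ℕ} {μ : Mem} (h : Scaled I c μ)
    (S : Solution I.toSpace) : ∃ (Y : Finset ℕ) (σ r : ℕ → ℕ), Target μ Y σ r ∧
      (targetCost μ Y σ r : ℝ) = c * I.objective S ∧ 100 * I.N ^ 3 ∣ targetCost μ Y σ r := by
  obtain ⟨v, hv⟩ := exists_objective_eq S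
  have hσi : Function.Injective fun p : {p // p ∈ I.P} => (p.1 : ℕ) :=
    fun a b hab => Subtype.ext (Fin.ext hab)
  have hvi : Function.Injective fun x : {x // x ∈ S.X} => (x.1 : ℕ) :=
    fun a b hab => Subtype.ext (Fin.ext hab)
  obtain ⟨σ, hσ⟩ : ∃ σ : ℕ → ℕ, ∀ p : {p // p ∈ I.P}, σ p.1 = (S.σ p).1 :=
    ⟨Function.extend _ (fun p => ((S.σ p).1 : ℕ)) 0, hσi.extend_apply _ _⟩
  obtain ⟨w, hw⟩ : ∃ w : ℕ → ℕ, ∀ x : {x // x ∈ S.X}, w x.1 = v x :=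
    ⟨Function.extend _ (fun x => (v x : ℕ)) 0, hvi.extend_apply _ _⟩
  have hY : ∀ g : ℕ → ℕ, ∑ x ∈ S.X.map Fin.valEmbedding, g x = ∑ x : {x // x ∈ S.X}, g x.1 :=
    fun g => by rw [sum_map, ← sum_coe_sort]; rfl
  have hmem : ∀ x ∈ S.X.map Fin.valEmbedding, ∃ z : {x // x ∈ S.X}, (z.1 : ℕ) = x := by
    intro x hx
    obtain ⟨z, hz, rfl⟩ := mem_map.1 hx
    exact ⟨⟨z, hz⟩, rfl⟩
  have hcost : targetCost μ (S.X.map Fin.valEmbedding) σ (fun x => dst μ x (w x))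
      = ∑ x : {x // x ∈ S.X}, I.ℓ * dst μ x.1 (v x)
        + ∑ p : {p // p ∈ I.P}, (dst μ p.1 (S.σ p).1 - dst μ (S.σ p).1 (v (S.σ p))) := by
    rw [targetCost, hY, h.sum_pts, h.l]
    simp only [hσ, hw]
  refine ⟨S.X.map Fin.valEmbedding, σ, fun x => dst μ x (w x), ⟨fun x hx => ?_, fun x hx => ?_,
    fun p hp => ?_, fun x hx => ?_, ?_⟩, ?_, ?_⟩
  · obtain ⟨z, rfl⟩ := hmem x hx
    rw [h.n]; exact z.1.2
  · obtain ⟨z, rfl⟩ := hmem x hx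
    exact (h.facility _).2 (S.subset z.2)
  · rw [h.pts_eq] at hp
    obtain ⟨q, hq, rfl⟩ := mem_map.1 hp
    rw [Fin.valEmbedding_apply, hσ ⟨q, hq⟩]
    exact mem_map_of_mem _ (S.σ ⟨q, hq⟩).2
  · obtain ⟨z, rfl⟩ := hmem x hx
    exact ⟨v z, by rw [h.n]; exact (v z).2, by rw [hw z]⟩
  · rw [card_map, h.k]; exact S.card_le
  · rw [hcost, hv, mul_add, mul_sum, mul_sum]
    push_cast
    have hc : (0 : ℝ) ≤ c := Nat.cast_nonneg c
    congr 1
    · refine sum_congr rfl fun x _ => ?_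
      rw [h.dst_eq]; ring
    · refine sum_congr rfl fun p _ => ?_
      rw [natCast_sub_eq_max, h.dst_eq, h.dst_eq, ← mul_sub, mul_max_of_nonneg _ _ hc, mul_zero]
  · rw [hcost]
    exact dvd_add (dvd_sum fun x _ => (h.dvd _ _).mul_left _)
      (dvd_sum fun p _ => Nat.dvd_sub (h.dvd _ _) (h.dvd _ _))

/-- The radii of `R`, scaled back, are admissible thresholds for the norms of the clusters, so they
bound the objective from above; assigning points to their nearest balls gives the distances counted
by `near`. -/
theorem Scaled.exists_solution {I : TopInstance} {c : ℕ} {μ s : Mem} (h : Scaled I c μ)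
    {R d : ℕ → ℕ} (hF : Feas μ R) (h5 : ∀ v < μ 0 0, s 5 v = if R v ≠ 0 then 1 else 0)
    (h6 : ∀ v < μ 0 0, IsNear (μ 0 0) (dst μ) R v (s 6 v) (d v)) :
    ∃ S : Solution I.toSpace, S.StoredIn s ∧ c * I.objective S ≤ cost' μ R := by
  have hlt : ∀ v : Fin I.N, s 6 v < I.N := fun v => by
    have := (h6 v (by rw [h.n]; exact v.2)).lt
    rwa [h.n] at this
  have hX : (univ.filter fun x : Fin I.N => R x ≠ 0).map Fin.valEmbedding = opened (μ 0 0) R := by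
    ext x
    simp only [mem_map, mem_filter, mem_univ, true_and, Fin.valEmbedding_apply, mem_opened, h.n]
    exact ⟨by rintro ⟨z, hz, rfl⟩; exact ⟨z.2, hz⟩, fun ⟨h1, h2⟩ => ⟨⟨x, h1⟩, h2, rfl⟩⟩
  let S : Solution I.toSpace :=
    { X := univ.filter fun x => R x ≠ 0
      subset := fun x hx =>
        (h.facility x).1 (hF.mem x (by rw [h.n]; exact x.2) (mem_filter.1 hx).2)
      card_le := by
        have := hF.le
        rw [← hX, card_map, h.k] at this
        exact this
      σ := fun p => ⟨⟨s 6 p.1, hlt p.1⟩,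
        mem_filter.2 ⟨mem_univ _, (h6 p.1 (by rw [h.n]; exact p.1.2)).ne⟩⟩ }
  refine ⟨S, ⟨fun v => ?_, fun p => rfl⟩, ?_⟩
  · rw [h5 v (by rw [h.n]; exact v.2)]
    exact if_congr (by simp [S]) rfl rfl
  · have hc : (0 : ℝ) < c := by exact_mod_cast h.pos
    have hobj := mul_le_mul_of_nonneg_left
      (objective_le S (r := fun x => ((R x.1 - 1 : ℕ) : ℝ) / c) fun x => by positivity) hc.le
    refine hobj.trans ?_
    rw [mul_add, mul_sum, mul_sum, cost', cost, h.sum_pts, h.l, Nat.cast_add,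
      Nat.cast_sum, Nat.cast_sum]
    refine add_le_add ?_ (sum_le_sum fun p _ => ?_)
    · have e1 : ∑ x : {x // x ∈ S.X}, (c : ℝ) * (I.ℓ * (((R x.1 - 1 : ℕ) : ℝ) / c))
          = ((∑ x ∈ opened (μ 0 0) R, I.ℓ * (R x - 1) : ℕ) : ℝ) := by
        rw [← hX, sum_map, Nat.cast_sum]
        refine (sum_coe_sort S.X fun x => (c : ℝ) * (I.ℓ * (((R x - 1 : ℕ) : ℝ) / c))).trans
          (sum_congr rfl fun x _ => ?_)
        rw [Fin.valEmbedding_apply, Nat.cast_mul]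
        field_simp
      have e3 : ∑ x ∈ opened (μ 0 0) R, I.ℓ * (R x - 1) ≤ ∑ x ∈ range (μ 0 0), I.ℓ * (R x - 1) :=
        sum_le_sum_of_subset (filter_subset _ _)
      rw [e1, ← Nat.cast_sum]
      exact_mod_cast e3
    · have hp := h6 p.1 (by rw [h.n]; exact p.1.2)
      rw [hp.near_eq, ← hp.eq, natCast_sub_eq_max (dst μ _ _), mul_max_of_nonneg _ _ hc.le, mul_zero, mul_sub]
      have e2 : (dst μ p.1 (s 6 p.1) : ℝ) = c * I.δ p.1 (S.σ p).1 := h.dst_eq p.1 (S.σ p).1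
      rw [e2, mul_div_cancel₀ _ hc.ne']

/-- In units of `K` the error is at most 24, while `u` and `y` are multiples of 100. If `y = 0`,
then `u` is less than 100 units and hence 0; otherwise 24 units are less than half of `y`. -/
theorem le_of_costBound {u y M K N : ℕ} (hM : M = 100 * K) (hK : 36 * N * (N * N) ≤ 36 * K)
    (hu : M ∣ u) (hy : M ∣ y)
    (hle : u ≤ 13 * y + 4 * (3 * N * (N * N)) + 12 * N) (hN : N ≤ K) (hK0 : 0 < K) :
    2 * u ≤ 27 * y := by
  obtain ⟨a, rfl⟩ := hu
  obtain ⟨b, rfl⟩ := hy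
  subst hM
  have h1 : 100 * a ≤ 1300 * b + 24 := by
    have : K * (100 * a) ≤ K * (1300 * b + 24) := by nlinarith
    exact Nat.le_of_mul_le_mul_left this hK0
  have h2 : 200 * a ≤ 2700 * b := by omega
  calc 2 * (100 * K * a) = K * (200 * a) := by ring
    _ ≤ K * (2700 * b) := Nat.mul_le_mul_left _ h2
    _ = 27 * (100 * K * b) := by ring

end Clustering

open Clustering ArrayLang NestedNorm in
theorem theorem1 (ε : ℝ) (hε : 0 < ε) :
    ∃ c : RAM.Prog, NestedNorm.IsPolyTimeApprox c (13.5 + ε) := by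
  obtain ⟨q, hq⟩ := exists_exec_seq (ro := roInput) (ro' := roSetup) rfl
    (fun a ha => by
      simp only [roSetup, Bool.or_eq_true, Bool.and_eq_true, decide_eq_true_eq] at ha
      omega) rfl setupS_wf mainS_wf
  refine ⟨.seq setupS.comp mainS.comp, q, fun I => ?_⟩
  obtain ⟨s, t, hexec, ht, hs⟩ := hq I.bits I.input 0 (bdd_input I) (by
    change I.N ≤ _
    unfold TopInstance.bits
    omega)
  refine ⟨s, t, hexec, ht, fun ⟨Y₀⟩ => ?_⟩
  obtain ⟨c, hscaled⟩ := setup_spec I 0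
  set μ := setupS.run 0 I.input
  obtain ⟨Z, σ, r, hZ, -, -⟩ := hscaled.exists_target Y₀
  obtain ⟨R, d, hF, hbound, h5, h6⟩ := main_spec (fun _ _ => rfl) hscaled.ready ⟨Z, σ, r, hZ⟩ 0
  rw [← hs 5 (by decide)] at h5
  rw [← hs 6 (by decide)] at h6
  obtain ⟨S, hS, hcost⟩ := hscaled.exists_solution hF h5 h6
  refine ⟨S, hS, fun Y => ?_⟩
  -- The cost of `R` need not be divisible by `100 * N ^ 3`. The output is therefore measured with
  -- its own optimal radii, which can only be cheaper.
  obtain ⟨ZS, σS, rS, -, hUS, hdS⟩ := hscaled.exists_target S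
  obtain ⟨ZY, σY, rY, hZY, hUY, hdY⟩ := hscaled.exists_target Y
  have h1 := hbound _ _ _ hZY
  have h2 : targetCost μ ZS σS rS ≤ cost' μ R := by
    rw [← hUS] at hcost; exact_mod_cast hcost
  have hN : 0 < I.N := by
    obtain ⟨p, -⟩ := Finset.card_pos.1 (lt_of_lt_of_le I.one_le I.le_card)
    exact p.pos
  have h3 := le_of_costBound (N := I.N) (K := I.N ^ 3) rfl (by ring_nf; exact le_rfl) hdS hdY
    (by have := h2.trans h1; rwa [costBound, hscaled.n] at this)
    (Nat.le_self_pow (by decide) _) (by positivity)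
  have h4 : 2 * ((c : ℝ) * I.objective S) ≤ 27 * (c * I.objective Y) := by
    rw [← hUS, ← hUY]; exact_mod_cast h3
  have hc : (0 : ℝ) < c := by exact_mod_cast hscaled.pos
  have h5 : I.objective S ≤ 13.5 * I.objective Y := by
    refine le_of_mul_le_mul_left ?_ hc
    linarith
  have h6 : 0 ≤ I.objective Y := by
    have : (0 : ℝ) ≤ c * I.objective Y := by rw [← hUY]; exact Nat.cast_nonneg _
    exact nonneg_of_mul_nonneg_right this hc
  nlinarith
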